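/- Let $\Phi$ be a (reduced, crystallographic, not necessarily irreducible) root system of rank $n$ with a fixed set of simple roots, positive roots $\Phi^+$, half-sum of positive roots $\delta$, Weyl group $W$ with length function $l$, and set $\Lambda^+$ of dominant integral weights. The Witten zeta function $\zeta_\Phi$ of $\Phi$ is the meromorphic function on $\mathbb{C}$ which for $\Re(s)>1$ is given by the absolutely convergent series $$\zeta_\Phi(s)=\sum_{\lambda\in\Lambda^+}(\dim V_\lambda)^{-s},\qquad \dim V_\lambda=\prod_{\alpha\in\Phi^+}\frac{(\lambda+\delta,\alpha^\vee)}{(\delta,\alpha^\vee)},$$ that is, by the sum of $(\dim V)^{-s}$ over the irreducible representations $V$ of the compact simply connected Lie group with root system $\Phi$. This meromorphic function exists, and for every positive integer $m$ the following hold. (a) If $m$ is even, then $\operatorname{ord}_{s=-m}\zeta_\Phi(s)\ge n$, the rank of $\Phi$. (b) If $m$ is odd, then $\operatorname{ord}_{s=-m}\zeta_\Phi(s)$ is at least the number of odd Weyl degrees of $\Phi$, the Weyl degrees being the positive integers $d_1,\dots,d_n$ (with multiplicity) such that $\sum_{w\in W}q^{l(w)}=\prod_{k=1}^n\frac{q^{d_k}-1}{q-1}$.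 Moreover, explicitly, $$\operatorname{ord}_{s=-m}\zeta_\Phi(s)\ \ge\ \begin{cases}\lfloor n/2\rfloor & \text{if }\Phi=A_n\text{ for any }n,\\ 1&\text{if }\Phi=D_n\text{ with }n\ge 5\text{ odd},\\ 2&\text{if }\Phi=E_6,\\ 0&\text{otherwise.}\end{cases}$$ -/

import Mathlib

noncomputable section

namespace WittenZeta

open Polynomial

variable {ι M N : Type*} [Fintype ι] [AddCommGroup M] [Module ℝ M] [AddCommGroup N] [Module ℝ N]
  {P : RootPairing ι ℝ M N}

open Classical in
/-- The finite set of (indices of) positive roots with respect to the base `b`. -/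
def positiveRoots (b : P.Base) : Finset ι :=
  Finset.univ.filter fun i => b.IsPos i

/-- Half the sum of the positive roots. -/
def halfSum (b : P.Base) : M :=
  (1 / 2 : ℝ) • ∑ i ∈ positiveRoots b, P.root i

/-- The dominant integral weights: vectors that pair integrally with every coroot, and
non-negatively with the coroots of the simple roots. -/
def dominantWeights (b : P.Base) : Set M :=
  {l | (∀ i, ∃ z : ℤ, P.toLinearMap l (P.coroot i) = z) ∧
    ∀ i ∈ b.support, 0 ≤ P.toLinearMap l (P.coroot i)}

/-- The dimension of the irreducible representation of highest weight `l` (for the simply connected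
compact Lie group, equivalently the complex semisimple Lie algebra, with the given root system),
as given by Weyl's formula `∏_{α > 0} (l + δ, α^∨) / (δ, α^∨)`. -/
def weylDim (b : P.Base) (l : M) : ℝ :=
  (∏ i ∈ positiveRoots b, P.toLinearMap (l + halfSum b) (P.coroot i)) /
    ∏ i ∈ positiveRoots b, P.toLinearMap (halfSum b) (P.coroot i)

/-- `Z` is the Witten zeta function of the root system: a meromorphic function on the whole complex
plane which for `1 < re s` is the sum of the (absolutely convergent) series
`∑ (dim V)^(-s)` over the irreducible representations `V`, indexed by the dominant weights. -/
def IsWittenZeta (b : P.Base) (Z : ℂ → ℂ) : Prop :=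
  Meromorphic Z ∧
    ∀ s : ℂ, 1 < s.re →
      HasSum (fun l : dominantWeights b => ((weylDim b (l : M) : ℝ) : ℂ) ^ (-s)) (Z s)

/-- The length of a Weyl group element: the least length of a word in the simple reflections
that represents it. -/
def weylLength (b : P.Base) (w : P.weylGroup) : ℕ :=
  sInf {k | ∃ u : List b.support, u.length = k ∧
    (u.map fun i => RootPairing.weylGroup.ofIdx P (i : ι)).prod = w}

/-- The Poincaré polynomial `∑_w X^(l(w))` of the (finite) Weyl group. -/
def poincarePolynomial (b : P.Base) : ℤ[X] :=
  ∑ᶠ w : P.weylGroup, X ^ weylLength b w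

/-- `d` is the multiset of degrees of the Weyl group: positive integers `d₁, …, dₙ`, with `n` the
rank, such that the Poincaré polynomial is `∏ (X^dₖ - 1) / (X - 1)`. -/
def IsWeylDegrees (b : P.Base) (d : Multiset ℕ) : Prop :=
  Multiset.card d = Module.finrank ℝ M ∧ (∀ k ∈ d, 0 < k) ∧
    poincarePolynomial b * (X - 1) ^ Module.finrank ℝ M =
      (d.map fun k => (X ^ k - 1 : ℤ[X])).prod

/-- The root system has the Cartan matrix `C`, up to the numbering of the simple roots. -/
def HasCartanType [P.IsCrystallographic] (b : P.Base) {n : ℕ} (C : Matrix (Fin n) (Fin n) ℤ) :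
    Prop :=
  ∃ e : b.support ≃ Fin n, Matrix.reindex e e b.cartanMatrix = C

end WittenZeta

end

noncomputable section

namespace WittenZeta

open Complex Set Metric MeasureTheory

/-- The functional `g ↦ ∫∫ W g` on bounded continuous functions on the plane, over a square. -/
def squareIntegralCLM (W : ℝ × ℝ → ℂ) (hW : Continuous W) (C : ℝ) (hC : ∀ p, ‖W p‖ ≤ C) :
    BoundedContinuousFunction (ℝ × ℝ) ℂ →L[ℂ] ℂ :=
  LinearMap.mkContinuous
    { toFun := fun g => ∫ y in (0 : ℝ)..(2 * Real.pi), ∫ x in (0 : ℝ)..(2 * Real.pi),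
        W (x, y) * g (x, y)
      map_add' := by
        intro g h
        have hc : ∀ g : BoundedContinuousFunction (ℝ × ℝ) ℂ,
            Continuous fun p : ℝ × ℝ => W p * g p := fun g => hW.mul g.continuous
        have hi : ∀ g : BoundedContinuousFunction (ℝ × ℝ) ℂ, Continuous fun y : ℝ =>
            ∫ x in (0 : ℝ)..(2 * Real.pi), W (x, y) * g (x, y) := fun g =>
          intervalIntegral.continuous_parametric_intervalIntegral_of_continuous'
            (f := fun y x => W (x, y) * g (x, y))
            ((hc g).comp (continuous_snd.prodMk continuous_fst)) _ _
        rw [← intervalIntegral.integral_add ((hi g).intervalIntegrable _ _)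
          ((hi h).intervalIntegrable _ _)]
        congr 1
        ext y
        have hx : ∀ g : BoundedContinuousFunction (ℝ × ℝ) ℂ, Continuous fun x : ℝ =>
            W (x, y) * g (x, y) := fun g => (hc g).comp (continuous_id.prodMk continuous_const)
        rw [← intervalIntegral.integral_add ((hx g).intervalIntegrable _ _)
          ((hx h).intervalIntegrable _ _)]
        simp [mul_add]
      map_smul' := by
        intro c g
        simp only [RingHom.id_apply, BoundedContinuousFunction.coe_smul, smul_eq_mul]
        rw [← intervalIntegral.integral_const_mul]
        congr 1
        ext y
        rw [← intervalIntegral.integral_const_mul]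
        congr 1
        ext x
        ring }
    (C * (2 * Real.pi) * (2 * Real.pi)) (by
      intro g
      have hC0 : 0 ≤ C := (norm_nonneg _).trans (hC (0, 0))
      have h1 : ∀ y : ℝ, ‖∫ x in (0 : ℝ)..(2 * Real.pi), W (x, y) * g (x, y)‖ ≤
          C * ‖g‖ * (2 * Real.pi) := by
        intro y
        refine (intervalIntegral.norm_integral_le_of_norm_le_const (C := C * ‖g‖) ?_).trans ?_
        · intro x _
          rw [norm_mul]
          exact mul_le_mul (hC _) (g.norm_coe_le_norm _) (norm_nonneg _) hC0
        · rw [sub_zero, abs_of_pos Real.two_pi_pos]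
      refine (intervalIntegral.norm_integral_le_of_norm_le_const (fun y _ => h1 y)).trans ?_
      rw [sub_zero, abs_of_pos Real.two_pi_pos]
      exact le_of_eq (by ring))

lemma analyticAt_ringInverse_sub {A : Type*} [NormedRing A] [NormedAlgebra ℂ A] [CompleteSpace A]
    (e : A) (s : ℂ) (h : IsUnit (e - algebraMap ℂ A s)) :
    AnalyticAt ℂ (fun z => Ring.inverse (e - algebraMap ℂ A z)) s := by
  obtain ⟨u, hu⟩ := h
  have h1 := analyticAt_inverse (𝕜 := ℂ) u
  rw [hu] at h1
  have h2 : AnalyticAt ℂ (fun z => e - algebraMap ℂ A z) s :=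
    analyticAt_const.sub ((Algebra.linearMap ℂ A).toContinuousLinearMap.analyticAt s)
  exact AnalyticAt.fun_comp h1 h2

/-- The circle `θ ↦ c + R e^{iθ}` as a bounded continuous function. -/
def circleBCF {X : Type*} [TopologicalSpace X] (θ : X → ℝ) (hθ : Continuous θ) (c : ℂ) (R : ℝ) :
    BoundedContinuousFunction X ℂ :=
  BoundedContinuousFunction.ofNormedAddCommGroup (fun x => circleMap c R (θ x))
    ((continuous_circleMap c R).comp hθ) (‖c‖ + |R|) (fun x => by
      simp only [circleMap]
      refine (norm_add_le _ _).trans ?_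
      simp)

lemma circleBCF_inverse {X : Type*} [TopologicalSpace X] (θ : X → ℝ) (hθ : Continuous θ) (c : ℂ)
    {R : ℝ} {s : ℂ} (hs : s ∈ ball c R) :
    IsUnit (circleBCF θ hθ c R - algebraMap ℂ (BoundedContinuousFunction X ℂ) s) ∧
    ∀ x, Ring.inverse (circleBCF θ hθ c R - algebraMap ℂ (BoundedContinuousFunction X ℂ) s) x =
      (circleMap c R (θ x) - s)⁻¹ := by
  have hR : 0 < R := (dist_nonneg).trans_lt (mem_ball.mp hs)
  have hd : 0 < R - dist s c := sub_pos.mpr (mem_ball.mp hs)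
  have hn : ∀ x, R - dist s c ≤ ‖circleMap c R (θ x) - s‖ := by
    intro x
    have h1 : ‖circleMap c R (θ x) - c‖ = R := by simp [circleMap, abs_of_pos hR]
    have h2 : ‖circleMap c R (θ x) - c‖ ≤ ‖circleMap c R (θ x) - s‖ + ‖s - c‖ :=
      norm_sub_le_norm_sub_add_norm_sub _ _ _
    rw [dist_eq_norm]
    linarith
  have hne : ∀ x, circleMap c R (θ x) - s ≠ 0 := fun x h => by
    have := hn x
    rw [h, norm_zero] at this
    linarith
  let v : BoundedContinuousFunction X ℂ :=
    BoundedContinuousFunction.ofNormedAddCommGroup (fun x => (circleMap c R (θ x) - s)⁻¹)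
      ((((continuous_circleMap c R).comp hθ).sub continuous_const).inv₀ hne)
      (R - dist s c)⁻¹ (fun x => by
        rw [norm_inv]
        exact inv_anti₀ hd (hn x))
  have e1 : (circleBCF θ hθ c R - algebraMap ℂ (BoundedContinuousFunction X ℂ) s) * v = 1 := by
    ext x
    exact mul_inv_cancel₀ (hne x)
  let u : (BoundedContinuousFunction X ℂ)ˣ := ⟨_, v, e1, by rw [mul_comm]; exact e1⟩
  refine ⟨⟨u, rfl⟩, fun x => ?_⟩
  have : Ring.inverse (circleBCF θ hθ c R - algebraMap ℂ (BoundedContinuousFunction X ℂ) s) = v :=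
    Ring.inverse_unit u
  rw [this]
  rfl

/-- Osgood's lemma in two variables. -/
theorem analyticAt_of_separately_differentiable {f : ℂ × ℂ → ℂ} {s₀ x₀ : ℂ} {R : ℝ} (hR : 0 < R)
    (hc : ContinuousOn f (closedBall s₀ R ×ˢ closedBall x₀ R))
    (h1 : ∀ x ∈ closedBall x₀ R, DifferentiableOn ℂ (fun s => f (s, x)) (ball s₀ R))
    (h2 : ∀ s ∈ closedBall s₀ R, DifferentiableOn ℂ (fun x => f (s, x)) (ball x₀ R)) :
    AnalyticAt ℂ f (s₀, x₀) := by
  set e₁ := circleMap s₀ R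
  set e₂ := circleMap x₀ R
  have hm₁ : ∀ θ, e₁ θ ∈ closedBall s₀ R := circleMap_mem_closedBall _ hR.le
  have hm₂ : ∀ θ, e₂ θ ∈ closedBall x₀ R := circleMap_mem_closedBall _ hR.le
  have hd₁ : Continuous fun θ => deriv e₁ θ := by
    simp only [e₁, deriv_circleMap]
    exact (continuous_circleMap 0 R).mul continuous_const
  have hd₂ : Continuous fun θ => deriv e₂ θ := by
    simp only [e₂, deriv_circleMap]
    exact (continuous_circleMap 0 R).mul continuous_const
  have hfc : Continuous fun p : ℝ × ℝ => f (e₁ p.1, e₂ p.2) :=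
    hc.comp_continuous (((continuous_circleMap s₀ R).comp continuous_fst).prodMk
      ((continuous_circleMap x₀ R).comp continuous_snd)) fun p => ⟨hm₁ _, hm₂ _⟩
  let W : ℝ × ℝ → ℂ := fun p => deriv e₁ p.1 * deriv e₂ p.2 * f (e₁ p.1, e₂ p.2)
  have hW : Continuous W :=
    ((hd₁.comp continuous_fst).mul (hd₂.comp continuous_snd)).mul hfc
  obtain ⟨C₀, hC₀⟩ := ((isCompact_closedBall s₀ R).prod
    (isCompact_closedBall x₀ R)).exists_bound_of_continuousOn hc
  have hC : ∀ p, ‖W p‖ ≤ R * R * C₀ := by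
    intro p
    have a1 : ‖deriv e₁ p.1‖ = R := by simp [e₁, deriv_circleMap, abs_of_pos hR]
    have a2 : ‖deriv e₂ p.2‖ = R := by simp [e₂, deriv_circleMap, abs_of_pos hR]
    simp only [W, norm_mul, a1, a2]
    exact mul_le_mul_of_nonneg_left (hC₀ _ ⟨hm₁ _, hm₂ _⟩) (by positivity)
  let Lf := squareIntegralCLM W hW _ hC
  let E₁ := circleBCF (X := ℝ × ℝ) Prod.fst continuous_fst s₀ R
  let E₂ := circleBCF (X := ℝ × ℝ) Prod.snd continuous_snd x₀ R
  let al := algebraMap ℂ (BoundedContinuousFunction (ℝ × ℝ) ℂ)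
  have key : AnalyticAt ℂ (fun p : ℂ × ℂ =>
      (2 * Real.pi * I : ℂ)⁻¹ * (2 * Real.pi * I : ℂ)⁻¹ *
        Lf (Ring.inverse (E₁ - al p.1) * Ring.inverse (E₂ - al p.2))) (s₀, x₀) := by
    refine analyticAt_const.mul (AnalyticAt.fun_comp (Lf.analyticAt _) (AnalyticAt.mul ?_ ?_))
    · exact AnalyticAt.fun_comp (f := Prod.fst) (g := fun z => Ring.inverse (E₁ - al z))
        (analyticAt_ringInverse_sub _ _ (circleBCF_inverse _ _ _ (mem_ball_self hR)).1)
        analyticAt_fst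
    · exact AnalyticAt.fun_comp (f := Prod.snd) (g := fun z => Ring.inverse (E₂ - al z))
        (analyticAt_ringInverse_sub _ _ (circleBCF_inverse _ _ _ (mem_ball_self hR)).1)
        analyticAt_snd
  refine key.congr ?_
  have hnhds : ball s₀ R ×ˢ ball x₀ R ∈ nhds (s₀, x₀) :=
    prod_mem_nhds (ball_mem_nhds _ hR) (ball_mem_nhds _ hR)
  filter_upwards [hnhds] with p hp
  obtain ⟨hp1, hp2⟩ := hp
  have hpi : (2 * Real.pi * I : ℂ) ≠ 0 := by simp [Real.pi_ne_zero]
  have i1 : ∀ x ∈ closedBall x₀ R, ∮ z in C(s₀, R), (z - p.1)⁻¹ • f (z, x) =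
      (2 * Real.pi * I : ℂ) • f (p.1, x) := by
    intro x hx
    refine circleIntegral_sub_inv_smul_of_differentiable_on_off_countable (s := ∅) countable_empty
      hp1 (f := fun z => f (z, x)) ?_ ?_
    · exact hc.comp (by fun_prop) fun z hz => ⟨hz, hx⟩
    · intro z hz
      exact (h1 x hx).differentiableAt (isOpen_ball.mem_nhds (by simpa using hz))
  have i2 : ∮ z in C(x₀, R), (z - p.2)⁻¹ • f (p.1, z) =
      (2 * Real.pi * I : ℂ) • f (p.1, p.2) := by
    refine circleIntegral_sub_inv_smul_of_differentiable_on_off_countable (s := ∅) countable_empty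
      hp2 (f := fun z => f (p.1, z)) ?_ ?_
    · exact hc.comp (by fun_prop) fun z hz => ⟨ball_subset_closedBall hp1, hz⟩
    · intro z hz
      exact (h2 p.1 (ball_subset_closedBall hp1)).differentiableAt
        (isOpen_ball.mem_nhds (by simpa using hz))
  have hL : Lf (Ring.inverse (E₁ - al p.1) * Ring.inverse (E₂ - al p.2)) =
      (2 * Real.pi * I : ℂ) * ((2 * Real.pi * I : ℂ) * f p) := by
    change (∫ y in (0 : ℝ)..(2 * Real.pi), ∫ x in (0 : ℝ)..(2 * Real.pi), W (x, y) *
      (Ring.inverse (E₁ - al p.1) (x, y) * Ring.inverse (E₂ - al p.2) (x, y))) = _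
    simp only [E₁, E₂, al, (circleBCF_inverse (X := ℝ × ℝ) Prod.fst continuous_fst s₀ hp1).2,
      (circleBCF_inverse (X := ℝ × ℝ) Prod.snd continuous_snd x₀ hp2).2]
    rw [show f p = f (p.1, p.2) from rfl, ← smul_eq_mul (a := (2 * Real.pi * I : ℂ)) (b := f _),
      ← i2, circleIntegral, ← intervalIntegral.integral_const_mul]
    congr 1
    ext y
    have := i1 (e₂ y) (hm₂ y)
    rw [circleIntegral] at this
    simp only [smul_eq_mul] at this ⊢
    rw [show (2 * Real.pi * I : ℂ) * (deriv e₂ y * ((e₂ y - p.2)⁻¹ * f (p.1, e₂ y))) =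
      (deriv e₂ y * (e₂ y - p.2)⁻¹) * ((2 * Real.pi * I : ℂ) * f (p.1, e₂ y)) by ring, ← this,
      ← intervalIntegral.integral_const_mul]
    congr 1
    ext x
    simp only [W, e₁, e₂]
    ring
  rw [hL]
  field_simp

end WittenZeta

end

noncomputable section

namespace WittenZeta

open Complex Set Metric MeasureTheory Filter Topology

/-- The error of the trapezoid rule for `(σ - 1) ∫ u^(-σ)` on the segment from `y` to `y + 1`. -/
def trapezoidError (σ y : ℂ) : ℂ :=
  (σ - 1) / 2 * (y ^ (-σ) + (y + 1) ^ (-σ)) - (y ^ (1 - σ) - (y + 1) ^ (1 - σ))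

lemma mem_slitPlane_add {y : ℂ} (hy : 0 < y.re) {u : ℝ} (hu : 0 ≤ u) : y + u ∈ slitPlane := by
  left
  simp only [add_re, ofReal_re]
  linarith

lemma trapezoidError_eq (σ : ℂ) {y : ℂ} (hy : 0 < y.re) :
    trapezoidError σ y = ∫ u in (0 : ℝ)..1,
      (σ - 1) / 2 * (σ * (σ + 1)) * (u * (1 - u)) * (y + u) ^ (-σ - 2) := by
  let E : ℂ → ℂ := fun u => (σ - 1) / 2 * (-σ) * (u * (1 - u)) * (y + u) ^ (-σ - 1) -
    (σ - 1) / 2 * (1 - 2 * u) * (y + u) ^ (-σ) + (y + u) ^ (1 - σ)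
  have hE : ∀ u ∈ uIcc (0 : ℝ) 1, HasDerivAt (fun u : ℝ => E u)
      ((σ - 1) / 2 * (σ * (σ + 1)) * (u * (1 - u)) * (y + u) ^ (-σ - 2)) u := by
    intro u hu
    rw [uIcc_of_le zero_le_one] at hu
    have hs := mem_slitPlane_add hy hu.1
    have hid : HasDerivAt (fun u : ℂ => y + u) 1 (u : ℂ) := (hasDerivAt_id _).const_add y
    have h1 := hid.cpow_const (c := -σ - 1) hs
    have h2 := hid.cpow_const (c := -σ) hs
    have h3 := hid.cpow_const (c := 1 - σ) hs
    have h4 : HasDerivAt (fun u : ℂ => u * (1 - u)) (1 - 2 * u) (u : ℂ) := by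
      have := (hasDerivAt_id (u : ℂ)).mul ((hasDerivAt_id (u : ℂ)).const_sub 1)
      refine this.congr_deriv ?_
      simp only [id]
      ring
    have h5 : HasDerivAt (fun u : ℂ => 1 - 2 * u) (-2) (u : ℂ) := by
      have := ((hasDerivAt_id (u : ℂ)).const_mul 2).const_sub 1
      refine this.congr_deriv ?_
      simp
    have h6 := (((h4.const_mul ((σ - 1) / 2 * (-σ))).mul h1).sub
      ((h5.const_mul ((σ - 1) / 2)).mul h2)).add h3
    have h7 := HasDerivAt.comp_ofReal (z := u) (e := E) (h6.congr_deriv rfl)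
    refine h7.congr_deriv ?_
    rw [show -σ - 1 - 1 = -σ - 2 by ring, show 1 - σ - 1 = -σ by ring]
    ring_nf
  have hcont : ContinuousOn (fun u : ℝ =>
      (σ - 1) / 2 * (σ * (σ + 1)) * (u * (1 - u)) * (y + u) ^ (-σ - 2)) (uIcc (0 : ℝ) 1) := by
    rw [uIcc_of_le zero_le_one]
    refine ContinuousOn.mul (by fun_prop) ?_
    exact ContinuousOn.cpow (by fun_prop) continuousOn_const
      fun u hu => mem_slitPlane_add hy hu.1
  rw [intervalIntegral.integral_eq_sub_of_hasDerivAt hE hcont.intervalIntegrable]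
  simp only [E, trapezoidError, ofReal_one, ofReal_zero]
  ring_nf

lemma norm_trapezoidError_le {σ y : ℂ} {a B : ℝ} (hσ : -1 + a ≤ σ.re)
    (hB : ‖σ‖ ≤ B) {k : ℕ} (hy : (k : ℝ) + 1 ≤ y.re) (ha : 0 ≤ a) :
    ‖trapezoidError σ y‖ ≤
      (B + 1) * (B * (B + 1)) * Real.exp (Real.pi * B) * ((k : ℝ) + 1) ^ (-(1 + a)) := by
  have hk : (0 : ℝ) < (k : ℝ) + 1 := by positivity
  have hy0 : 0 < y.re := hk.trans_le hy
  have hB0 : 0 ≤ B := (norm_nonneg _).trans hB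
  rw [trapezoidError_eq σ hy0]
  refine (intervalIntegral.norm_integral_le_of_norm_le_const (C := (B + 1) * (B * (B + 1)) *
    Real.exp (Real.pi * B) * ((k : ℝ) + 1) ^ (-(1 + a))) ?_).trans (by simp)
  intro u hu
  rw [uIoc_of_le zero_le_one] at hu
  have hb : ‖(y + u) ^ (-σ - 2)‖ ≤ Real.exp (Real.pi * B) * ((k : ℝ) + 1) ^ (-(1 + a)) := by
    refine (norm_cpow_le _ _).trans ?_
    have hre : (k : ℝ) + 1 ≤ ‖y + u‖ := by
      refine le_trans ?_ (re_le_norm _)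
      simp only [add_re, ofReal_re]
      linarith [hu.1]
    have h1 : ‖y + u‖ ^ (-σ - 2).re ≤ ((k : ℝ) + 1) ^ (-(1 + a)) := by
      have e1 : (-σ - 2).re ≤ -(1 + a) := by
        simp only [sub_re, neg_re, re_ofNat]
        linarith
      calc ‖y + u‖ ^ (-σ - 2).re ≤ ‖y + u‖ ^ (-(1 + a)) := by
            refine Real.rpow_le_rpow_of_exponent_le ?_ e1
            have : (0 : ℝ) ≤ k := by positivity
            linarith
        _ ≤ _ := Real.rpow_le_rpow_of_nonpos hk hre (by linarith)
    rw [div_eq_mul_inv, ← Real.exp_neg, mul_comm]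
    refine mul_le_mul (Real.exp_le_exp.mpr ?_) h1 (by positivity) (by positivity)
    have e2 : (-σ - 2).im = -σ.im := by simp
    rw [e2]
    calc -((y + u).arg * -σ.im) ≤ |(y + u).arg * σ.im| := by
          rw [mul_neg, neg_neg]
          exact le_abs_self _
      _ = |(y + u).arg| * |σ.im| := abs_mul _ _
      _ ≤ Real.pi * B := mul_le_mul (abs_arg_le_pi _) ((abs_im_le_norm _).trans hB)
          (abs_nonneg _) Real.pi_pos.le
  have hσ1 : ‖(σ - 1) / 2‖ ≤ B + 1 := by
    rw [norm_div]
    have : ‖σ - 1‖ ≤ B + 1 := (norm_sub_le _ _).trans (by simpa using hB)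
    have h2 : ‖(2 : ℂ)‖ = 2 := by simp
    rw [h2]
    linarith [norm_nonneg (σ - 1)]
  have hσ2 : ‖σ * (σ + 1)‖ ≤ B * (B + 1) := by
    rw [norm_mul]
    have : ‖σ + 1‖ ≤ B + 1 := (norm_add_le _ _).trans (by simpa using hB)
    exact mul_le_mul hB this (norm_nonneg _) hB0
  have hu1 : ‖(u : ℂ) * (1 - u)‖ ≤ 1 := by
    rw [← ofReal_one, ← ofReal_sub, ← ofReal_mul, norm_real, Real.norm_eq_abs, abs_le]
    constructor <;> nlinarith [hu.1, hu.2]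
  rw [norm_mul, norm_mul, norm_mul]
  calc ‖(σ - 1) / 2‖ * ‖σ * (σ + 1)‖ * ‖(u : ℂ) * (1 - u)‖ * ‖(y + u) ^ (-σ - 2)‖
      ≤ (B + 1) * (B * (B + 1)) * 1 * (Real.exp (Real.pi * B) * ((k : ℝ) + 1) ^ (-(1 + a))) := by
        gcongr
    _ = _ := by ring

/-- `(σ - 1)` times the Hurwitz zeta function at `x + 1`, continued to `-1 < re σ`. -/
def hurwitzTail (p : ℂ × ℂ) : ℂ :=
  (p.1 - 1) * (p.2 + 1) ^ (-p.1) + (p.1 - 1) / 2 * (p.2 + 2) ^ (-p.1) + (p.2 + 2) ^ (1 - p.1) +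
    ∑' k : ℕ, trapezoidError p.1 (p.2 + 2 + k)

lemma summable_trapezoid_bound {a : ℝ} (ha : 0 < a) (C : ℝ) :
    Summable fun k : ℕ => C * ((k : ℝ) + 1) ^ (-(1 + a)) := by
  refine Summable.mul_left C ?_
  have := (summable_nat_add_iff 1).mpr (Real.summable_nat_rpow_inv.mpr (show 1 < 1 + a by linarith))
  refine this.congr fun k => ?_
  rw [Real.rpow_neg (by positivity)]
  simp

lemma analyticAt_cpow_add {c : ℂ} (hc : 1 ≤ c.re) {e : ℂ × ℂ → ℂ} {p : ℂ × ℂ}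
    (he : AnalyticAt ℂ e p) (hp : -1 < p.2.re) :
    AnalyticAt ℂ (fun q : ℂ × ℂ => (q.2 + c) ^ e q) p := by
  refine (analyticAt_snd.add analyticAt_const).cpow he ?_
  left
  rw [Pi.add_apply, add_re]
  linarith

lemma analyticAt_trapezoidError {c : ℂ} (hc : 1 ≤ c.re) {p : ℂ × ℂ} (hp : -1 < p.2.re) :
    AnalyticAt ℂ (fun q : ℂ × ℂ => trapezoidError q.1 (q.2 + c)) p := by
  have hc1 : (1 : ℝ) ≤ (c + 1).re := by simp only [add_re, one_re]; linarith
  have h1 : AnalyticAt ℂ (fun q : ℂ × ℂ => -q.1) p := analyticAt_fst.neg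
  have h2 : AnalyticAt ℂ (fun q : ℂ × ℂ => 1 - q.1) p := analyticAt_const.sub analyticAt_fst
  have e : (fun q : ℂ × ℂ => trapezoidError q.1 (q.2 + c)) = fun q : ℂ × ℂ => (q.1 - 1) / 2 *
      ((q.2 + c) ^ (-q.1) + (q.2 + (c + 1)) ^ (-q.1)) -
      ((q.2 + c) ^ (1 - q.1) - (q.2 + (c + 1)) ^ (1 - q.1)) := by
    funext q
    rw [trapezoidError, add_assoc q.2 c 1]
  rw [e]
  exact (((analyticAt_fst.sub analyticAt_const).div analyticAt_const two_ne_zero).mul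
    ((analyticAt_cpow_add hc h1 hp).add (analyticAt_cpow_add hc1 h1 hp))).sub
    ((analyticAt_cpow_add hc h2 hp).sub (analyticAt_cpow_add hc1 h2 hp))

lemma analyticAt_tsum_trapezoidError {p : ℂ × ℂ} (h1 : -1 < p.1.re) (h2 : -1 < p.2.re) :
    AnalyticAt ℂ (fun q : ℂ × ℂ => ∑' k : ℕ, trapezoidError q.1 (q.2 + 2 + k)) p := by
  obtain ⟨σ₀, x₀⟩ := p
  simp only at h1 h2
  set R : ℝ := min ((σ₀.re + 1) / 2) ((x₀.re + 1) / 2) with hRdef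
  have hR : 0 < R := lt_min (by linarith) (by linarith)
  have hRσ : R ≤ (σ₀.re + 1) / 2 := min_le_left _ _
  have hRx : R ≤ (x₀.re + 1) / 2 := min_le_right _ _
  set a : ℝ := (σ₀.re + 1) / 2 with ha
  have ha0 : 0 < a := by linarith
  set B : ℝ := ‖σ₀‖ + R
  have hre : ∀ {z w : ℂ}, z ∈ closedBall w R → w.re - R ≤ z.re := by
    intro z w hz
    rw [mem_closedBall, dist_eq_norm] at hz
    have := (abs_re_le_norm (z - w)).trans hz
    rw [sub_re] at this
    linarith [(abs_le.mp this).1]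
  have hbound : ∀ (k : ℕ) (q : ℂ × ℂ), q ∈ closedBall σ₀ R ×ˢ closedBall x₀ R →
      ‖trapezoidError q.1 (q.2 + 2 + k)‖ ≤
      (B + 1) * (B * (B + 1)) * Real.exp (Real.pi * B) * ((k : ℝ) + 1) ^ (-(1 + a)) := by
    intro k q hq
    refine norm_trapezoidError_le ?_ ?_ ?_ ha0.le
    · have := hre hq.1
      linarith
    · have : ‖q.1 - σ₀‖ ≤ R := by simpa [dist_eq_norm] using hq.1
      calc ‖q.1‖ = ‖σ₀ + (q.1 - σ₀)‖ := by congr 1; ring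
        _ ≤ _ := (norm_add_le _ _).trans (by simp only [B]; linarith)
    · have := hre hq.2
      simp only [add_re, re_ofNat, natCast_re]
      linarith
  have hsum := summable_trapezoid_bound ha0 ((B + 1) * (B * (B + 1)) * Real.exp (Real.pi * B))
  have hmem : ∀ q ∈ closedBall σ₀ R ×ˢ closedBall x₀ R, -1 < q.2.re := by
    intro q hq
    have := hre hq.2
    linarith
  have han : ∀ (k : ℕ), ∀ q ∈ closedBall σ₀ R ×ˢ closedBall x₀ R,
      AnalyticAt ℂ (fun q : ℂ × ℂ => trapezoidError q.1 (q.2 + 2 + k)) q := by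
    intro k q hq
    have := analyticAt_trapezoidError (c := 2 + (k : ℂ))
      (by simp only [add_re, re_ofNat, natCast_re]; linarith [(Nat.cast_nonneg k : (0:ℝ) ≤ k)])
      (hmem q hq)
    simpa only [add_assoc] using this
  refine analyticAt_of_separately_differentiable hR ?_ ?_ ?_
  · exact continuousOn_tsum (fun k q hq => (han k q hq).continuousAt.continuousWithinAt) hsum hbound
  · intro x hx
    refine differentiableOn_tsum_of_summable_norm hsum (fun k s hs => ?_) isOpen_ball
      (fun k s hs => hbound k (s, x) ⟨ball_subset_closedBall hs, hx⟩)
    exact ((han k (s, x) ⟨ball_subset_closedBall hs, hx⟩).differentiableAt.comp s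
      (f := fun s => (s, x)) (by fun_prop)).differentiableWithinAt
  · intro s hs
    refine differentiableOn_tsum_of_summable_norm hsum (fun k x hx => ?_) isOpen_ball
      (fun k x hx => hbound k (s, x) ⟨hs, ball_subset_closedBall hx⟩)
    exact ((han k (s, x) ⟨hs, ball_subset_closedBall hx⟩).differentiableAt.comp x
      (f := fun x => (s, x)) (by fun_prop)).differentiableWithinAt

lemma analyticAt_hurwitzTail {p : ℂ × ℂ} (h1 : -1 < p.1.re) (h2 : -1 < p.2.re) :
    AnalyticAt ℂ hurwitzTail p := by
  have e1 : AnalyticAt ℂ (fun q : ℂ × ℂ => -q.1) p := analyticAt_fst.neg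
  have e2 : AnalyticAt ℂ (fun q : ℂ × ℂ => 1 - q.1) p := analyticAt_const.sub analyticAt_fst
  have e3 : AnalyticAt ℂ (fun q : ℂ × ℂ => q.1 - 1) p := analyticAt_fst.sub analyticAt_const
  exact (((e3.mul (analyticAt_cpow_add (by simp) e1 h2)).add
    ((e3.div analyticAt_const two_ne_zero).mul (analyticAt_cpow_add (by simp) e1 h2))).add
    (analyticAt_cpow_add (by simp) e2 h2)).add (analyticAt_tsum_trapezoidError h1 h2)

lemma sum_trapezoidError (σ y : ℂ) (K : ℕ) :
    ∑ k ∈ Finset.range K, trapezoidError σ (y + k) =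
      (σ - 1) * (∑ k ∈ Finset.range K, (y + k) ^ (-σ)) - (σ - 1) / 2 * y ^ (-σ) +
      (σ - 1) / 2 * (y + K) ^ (-σ) - y ^ (1 - σ) + (y + K) ^ (1 - σ) := by
  induction K with
  | zero => simp
  | succ K ih =>
    rw [Finset.sum_range_succ, Finset.sum_range_succ, ih, trapezoidError]
    push_cast
    rw [add_assoc]
    ring_nf

lemma tendsto_add_nat_cpow (y : ℂ) {e : ℂ} (he : e.re < 0) :
    Tendsto (fun K : ℕ => (y + K) ^ e) atTop (𝓝 0) := by
  rw [tendsto_zero_iff_norm_tendsto_zero]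
  have hK : Tendsto (fun K : ℕ => ‖y + K‖) atTop atTop := by
    refine tendsto_atTop_mono (f := fun K : ℕ => (K : ℝ) - ‖y‖) (fun K => ?_)
      (tendsto_atTop_add_const_right _ _ tendsto_natCast_atTop_atTop)
    have := norm_sub_norm_le (K : ℂ) (-y)
    simp only [norm_neg, sub_neg_eq_add, Complex.norm_natCast] at this
    rwa [add_comm] at this
  have h2 := (tendsto_rpow_neg_atTop (y := -e.re) (by linarith)).comp hK
  have h3 := h2.mul_const (Real.exp (Real.pi * |e.im|))
  rw [zero_mul] at h3
  refine squeeze_zero (fun _ => norm_nonneg _) (fun K => ?_) h3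
  refine (norm_cpow_le _ _).trans ?_
  simp only [Function.comp_apply, neg_neg]
  rw [div_eq_mul_inv, ← Real.exp_neg]
  refine mul_le_mul_of_nonneg_left (Real.exp_le_exp.mpr ?_) (by positivity)
  calc -((y + K).arg * e.im) ≤ |(y + K).arg * e.im| := neg_le_abs _
    _ = |(y + K).arg| * |e.im| := abs_mul _ _
    _ ≤ _ := mul_le_mul_of_nonneg_right (abs_arg_le_pi _) (abs_nonneg _)

lemma hasSum_hurwitzTail {c : ℝ} (hc : 0 ≤ c) {σ : ℂ} (hσ : 1 < σ.re) {z : ℂ}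
    (h : HasSum (fun k : ℕ => ((c : ℂ) + 1 + k) ^ (-σ)) z) :
    hurwitzTail (σ, c) = (σ - 1) * z := by
  have h0 : HasSum (fun k : ℕ => ((c : ℂ) + 2 + k) ^ (-σ)) (z - ((c : ℂ) + 1) ^ (-σ)) := by
    have := (hasSum_nat_add_iff' 1).mpr h
    simp only [Finset.sum_range_one, Nat.cast_zero, add_zero] at this
    refine this.congr_fun fun k => ?_
    push_cast
    congr 1
    ring
  have hs : Summable fun k : ℕ => trapezoidError σ ((c : ℂ) + 2 + k) := by
    refine Summable.of_norm_bounded (summable_trapezoid_bound (a := 2) (by norm_num) _)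
      (fun k => norm_trapezoidError_le (a := 2) ?_ le_rfl ?_ (by norm_num))
    · linarith
    · simp only [add_re, ofReal_re, re_ofNat, natCast_re]
      linarith
  have h1 := hs.hasSum.tendsto_sum_nat
  simp only [sum_trapezoidError] at h1
  have h2 := (((((h0.tendsto_sum_nat.const_mul (σ - 1)).sub_const
    ((σ - 1) / 2 * ((c : ℂ) + 2) ^ (-σ))).add
    ((tendsto_add_nat_cpow ((c : ℂ) + 2) (e := -σ) (by simp; linarith)).const_mul
      ((σ - 1) / 2))).sub_const (((c : ℂ) + 2) ^ (1 - σ))).add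
    (tendsto_add_nat_cpow ((c : ℂ) + 2) (e := 1 - σ) (by simp; linarith)))
  have h3 := tendsto_nhds_unique h1 h2
  rw [hurwitzTail, h3]
  ring

open HurwitzZeta in
/-- The Hurwitz zeta function in terms of `hurwitzTail`. -/
theorem hurwitzZeta_eq_hurwitzTail {c : ℝ} (hc : c ∈ Icc (0 : ℝ) 1) {σ : ℂ} (hσ : -1 < σ.re)
    (hσ1 : σ ≠ 1) (hσ0 : σ ≠ 0) :
    (σ - 1) * hurwitzZeta c σ = (σ - 1) * (c : ℂ) ^ (-σ) + hurwitzTail (σ, c) := by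
  let P : ℂ → ℂ := fun σ => if c = 0 then 0 else (c : ℂ) ^ (-σ)
  have hP : ∀ σ : ℂ, σ ≠ 0 → P σ = (c : ℂ) ^ (-σ) := by
    intro σ hσ
    simp only [P]
    split_ifs with h
    · rw [h, ofReal_zero, zero_cpow (neg_ne_zero.mpr hσ)]
    · rfl
  let h : ℂ → ℂ := fun σ => (σ - 1) * (hurwitzZeta c σ - 1 / (σ - 1) / Gammaℝ σ) + (Gammaℝ σ)⁻¹
  have hh : ∀ σ : ℂ, σ ≠ 1 → h σ = (σ - 1) * hurwitzZeta c σ := by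
    intro σ hσ
    have : σ - 1 ≠ 0 := sub_ne_zero.mpr hσ
    simp only [h]
    rw [mul_sub, one_div, div_eq_mul_inv, mul_inv_cancel_left₀ this]
    ring_nf
  let U : Set ℂ := {σ | -1 < σ.re}
  have hU : IsOpen U := isOpen_lt continuous_const continuous_re
  have hUc : IsPreconnected U := (convex_halfSpace_re_gt (-1)).isPreconnected
  have hhd : DifferentiableOn ℂ h U := by
    intro σ _
    refine (DifferentiableAt.add ?_ differentiable_Gammaℝ_inv.differentiableAt).differentiableWithinAt
    refine DifferentiableAt.mul (by fun_prop) ?_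
    by_cases h1 : σ = 1
    · rw [h1]
      exact differentiableAt_hurwitzZeta_sub_one_div c
    · refine (differentiableAt_hurwitzZeta _ h1).sub ?_
      simp only [div_eq_mul_inv]
      exact ((differentiableAt_const _).mul (((differentiableAt_id (𝕜 := ℂ)).sub_const
        (1 : ℂ)).inv (sub_ne_zero.mpr h1))).mul differentiable_Gammaℝ_inv.differentiableAt
  have hPd : DifferentiableOn ℂ P U := by
    by_cases h0 : c = 0
    · simp only [P, h0, if_true]
      exact differentiableOn_const _
    · simp only [P, h0, if_false]
      intro σ _
      refine DifferentiableAt.differentiableWithinAt ?_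
      exact (differentiableAt_id.neg).const_cpow (Or.inl (by exact_mod_cast h0))
  have hTd : DifferentiableOn ℂ (fun σ => hurwitzTail (σ, c)) U := by
    intro σ hσ
    exact ((analyticAt_hurwitzTail (p := (σ, (c : ℂ))) hσ
      (by simp only [ofReal_re]; linarith [hc.1])).differentiableAt.comp σ
      (f := fun σ => (σ, (c : ℂ))) (by fun_prop)).differentiableWithinAt
  have key : EqOn h (fun σ => (σ - 1) * P σ + hurwitzTail (σ, c)) U := by
    refine (hhd.analyticOnNhd hU).eqOn_of_preconnected_of_eventuallyEq
      (DifferentiableOn.analyticOnNhd ?_ hU) hUc (z₀ := 2) (by simp [U]; norm_num) ?_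
    · exact ((differentiableOn_id.sub_const 1).mul hPd).add hTd
    · have hV : {σ : ℂ | 1 < σ.re} ∈ 𝓝 (2 : ℂ) :=
        (isOpen_lt continuous_const continuous_re).mem_nhds (by simp)
      filter_upwards [hV] with σ hσ
      have hσ' : 1 < σ.re := hσ
      have hne1 : σ ≠ 1 := fun h => by simp [h] at hσ'
      have hne0 : σ ≠ 0 := fun h => by simp [h] at hσ'; linarith
      rw [hh σ hne1, hP σ hne0]
      have hs := hasSum_hurwitzZeta_of_one_lt_re hc hσ'
      have hs' := (hasSum_nat_add_iff' 1).mpr hs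
      simp only [Finset.sum_range_one, Nat.cast_zero, zero_add] at hs'
      rw [hasSum_hurwitzTail hc.1 hσ' (z := hurwitzZeta c σ - 1 / (c : ℂ) ^ σ)]
      · rw [cpow_neg]
        ring
      · refine hs'.congr_fun fun k => ?_
        rw [cpow_neg, one_div]
        push_cast
        congr 2
        ring_nf
  rw [← hh σ hσ1, ← hP σ hσ0]
  exact key hσ

end WittenZeta

end

noncomputable section

namespace WittenZeta

open Complex Set Metric MeasureTheory Filter Topology HurwitzZeta

/-- `|v|^(-s)` or, if `odd` is true, `sgn v |v|^(-s)`; zero at `v = 0`. -/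
def latticePow (odd : Bool) (s : ℂ) (v : ℤ) : ℂ :=
  if v = 0 then 0 else (if odd then (v.sign : ℂ) else 1) * ((|v| : ℤ) : ℂ) ^ (-s)

/-- The Fourier series with coefficients `latticePow`. -/
def periodicZeta (odd : Bool) (s : ℂ) (c : ℝ) : ℂ :=
  if odd then 2 * I * sinZeta c s else 2 * cosZeta c s

lemma hasSum_periodicZeta (odd : Bool) {s : ℂ} (hs : 1 < s.re) (c : ℝ) :
    HasSum (fun v : ℤ => latticePow odd s v * cexp (2 * Real.pi * I * c * v))
      (periodicZeta odd s c) := by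
  have hs0 : s ≠ 0 := fun h => by simp [h] at hs; linarith
  cases odd
  · have := (hasSum_int_cosZeta c hs).mul_left 2
    refine this.congr_fun fun v => ?_
    by_cases hv : v = 0
    · simp [latticePow, hv, zero_cpow hs0]
    · simp only [latticePow, if_neg hv, cpow_neg, Bool.false_eq_true, if_false]
      ring
  · have := (hasSum_int_sinZeta c hs).mul_left (2 * I)
    refine this.congr_fun fun v => ?_
    by_cases hv : v = 0
    · simp [latticePow, hv]
    · simp only [latticePow, if_neg hv, cpow_neg, if_true]
      have : I * I = -1 := I_mul_I
      linear_combination ((v.sign : ℂ) * cexp (2 * Real.pi * I * c * v) *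
        (((|v| : ℤ) : ℂ) ^ s)⁻¹) * this

lemma norm_latticePow_le (odd : Bool) (s : ℂ) (v : ℤ) :
    ‖latticePow odd s v‖ ≤ (|(v : ℝ)| ^ s.re)⁻¹ := by
  by_cases hv : v = 0
  · simp only [latticePow, hv, if_true, norm_zero]
    positivity
  · have h1 : ‖(if odd then (v.sign : ℂ) else 1)‖ = 1 := by
      cases odd
      · simp
      · rcases lt_or_gt_of_ne hv with h | h
        · simp [Int.sign_eq_neg_one_of_neg h]
        · simp [Int.sign_eq_one_of_pos h]
    have h2 : (((|v| : ℤ) : ℂ)) = ((|(v : ℝ)| : ℝ) : ℂ) := by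
      rw [← Int.cast_abs, ofReal_intCast]
    rw [latticePow, if_neg hv, norm_mul, h1, one_mul, h2, norm_cpow_eq_rpow_re_of_pos, neg_re,
      Real.rpow_neg (abs_nonneg _)]
    exact abs_pos.mpr (by exact_mod_cast hv)

lemma summable_norm_latticePow (odd : Bool) {s : ℂ} (hs : 1 < s.re) :
    Summable fun v : ℤ => ‖latticePow odd s v‖ :=
  Summable.of_nonneg_of_le (fun _ => norm_nonneg _) (norm_latticePow_le odd s)
    (by simpa [Real.rpow_neg] using Real.summable_abs_int_rpow hs)

/-- The sign of `periodicZeta` under `c ↦ -c`. -/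
def paritySign (odd : Bool) : ℂ := if odd then -1 else 1

/-- The archimedean factor in the functional equation of `periodicZeta`. -/
def gammaFactor (odd : Bool) (s : ℂ) : ℂ :=
  (if odd then -2 * I else -2) * (2 * Real.pi) ^ (-(1 - s)) * Gamma (2 - s) *
    (if odd then sin (Real.pi * (1 - s) / 2) else cos (Real.pi * (1 - s) / 2))

theorem periodicZeta_eq (odd : Bool) {s : ℂ} (hs : 1 < s.re) (hs2 : s.re < 2) {c : ℝ}
    (hc : c ∈ Icc (0 : ℝ) 1) :
    (s - 1) * s * periodicZeta odd s c = gammaFactor odd s *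
      (s * (c : ℂ) ^ (s - 1) + paritySign odd * (s * ((1 - c : ℝ) : ℂ) ^ (s - 1)) -
        hurwitzTail (1 - s, c) - paritySign odd * hurwitzTail (1 - s, (1 - c : ℝ))) := by
  have hne0 : s ≠ 0 := fun h => by simp [h] at hs; linarith
  have hne1 : s ≠ 1 := fun h => by simp [h] at hs
  have hσ : -1 < (1 - s).re := by simp; linarith
  have hσ1 : 1 - s ≠ 1 := by simpa using hne0
  have hσ0 : 1 - s ≠ 0 := fun h => hne1 (by linear_combination -h)
  have hG : ∀ n : ℕ, 1 - s ≠ -n := by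
    intro n h
    have : (1 - s).re = -(n : ℝ) := by rw [h]; simp
    simp only [sub_re, one_re] at this
    rcases n with _ | n
    · simp at this; linarith
    · push_cast at this
      linarith [(Nat.cast_nonneg n : (0 : ℝ) ≤ n)]
  have hG1 : ∀ n : ℕ, 1 - s ≠ 1 - n := by
    intro n h
    have h' : s.re = n := by
      have : s = n := by linear_combination -h
      rw [this]; simp
    rw [h'] at hs hs2
    have a1 : 1 < n := by exact_mod_cast hs
    have a2 : n < 2 := by exact_mod_cast hs2
    omega
  have e1 := hurwitzZeta_eq_hurwitzTail hc hσ hσ1 hσ0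
  have hc' : 1 - c ∈ Icc (0 : ℝ) 1 := ⟨by linarith [hc.2], by linarith [hc.1]⟩
  have e2 := hurwitzZeta_eq_hurwitzTail hc' hσ hσ1 hσ0
  have hneg : ((1 - c : ℝ) : UnitAddCircle) = -(c : UnitAddCircle) := by
    rw [AddCircle.coe_sub, AddCircle.coe_period, zero_sub]
  rw [hneg] at e2
  rw [show -(1 - s) = s - 1 by ring, show 1 - s - 1 = -s by ring] at e1 e2
  have h1 : hurwitzZeta (c : UnitAddCircle) (1 - s) =
      hurwitzZetaEven c (1 - s) + hurwitzZetaOdd c (1 - s) := rfl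
  have h2 : hurwitzZeta (-(c : UnitAddCircle)) (1 - s) =
      hurwitzZetaEven c (1 - s) - hurwitzZetaOdd c (1 - s) := by
    change hurwitzZetaEven _ _ + hurwitzZetaOdd _ _ = _
    rw [hurwitzZetaEven_neg, hurwitzZetaOdd_neg]
    ring
  have hgam : Gamma (2 - s) = (1 - s) * Gamma (1 - s) := by
    rw [← Gamma_add_one _ hσ0]
    congr 1
    ring
  rw [h1] at e1
  rw [h2] at e2
  cases odd
  · have hz := cosZeta_one_sub (c : UnitAddCircle) hG1
    rw [sub_sub_cancel] at hz
    simp only [periodicZeta, Bool.false_eq_true, if_false, gammaFactor, paritySign, hz, hgam]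
    linear_combination (2 * (2 * Real.pi : ℂ) ^ (-(1 - s)) * (1 - s) * Gamma (1 - s) *
      cos (Real.pi * (1 - s) / 2)) * (e1 + e2)
  · have hz := sinZeta_one_sub (c : UnitAddCircle) hG
    rw [sub_sub_cancel] at hz
    simp only [periodicZeta, if_true, gammaFactor, paritySign, hz, hgam]
    linear_combination (2 * I * (2 * Real.pi : ℂ) ^ (-(1 - s)) * (1 - s) * Gamma (1 - s) *
      sin (Real.pi * (1 - s) / 2)) * (e1 - e2)

lemma periodicZeta_add_int (odd : Bool) (s : ℂ) (c : ℝ) (k : ℤ) :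
    periodicZeta odd s (c + k) = periodicZeta odd s c := by
  have : ((c + k : ℝ) : UnitAddCircle) = (c : UnitAddCircle) := by
    rw [AddCircle.coe_add]
    refine add_eq_left.mpr ((AddCircle.coe_eq_zero_iff (1 : ℝ)).mpr ⟨k, by simp⟩)
  unfold periodicZeta
  rw [this]

lemma continuous_periodicZeta (odd : Bool) {s : ℂ} (hs : 1 < s.re) :
    Continuous (periodicZeta odd s) := by
  have h : periodicZeta odd s = fun c : ℝ =>
      ∑' v : ℤ, latticePow odd s v * cexp (2 * Real.pi * I * c * v) :=
    funext fun c => (hasSum_periodicZeta odd hs c).tsum_eq.symm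
  rw [h]
  refine continuous_tsum (fun v => by fun_prop) (summable_norm_latticePow odd hs) fun v c => ?_
  rw [norm_mul, show (2 * Real.pi * I * c * v : ℂ) = ((2 * Real.pi * c * v : ℝ) : ℂ) * I by
    push_cast; ring, norm_exp_ofReal_mul_I, mul_one]

lemma analyticAt_gammaFactor (odd : Bool) {s : ℂ} (hs : s.re < 2) :
    AnalyticAt ℂ (gammaFactor odd) s := by
  have hopen : IsOpen {s : ℂ | s.re < 2} := isOpen_lt continuous_re continuous_const
  refine DifferentiableOn.analyticAt (s := {s : ℂ | s.re < 2}) ?_ (hopen.mem_nhds hs)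
  intro z hz
  have hz' : z.re < 2 := hz
  have hpi : (2 * Real.pi : ℂ) ≠ 0 := by simp [Real.pi_ne_zero]
  have hG : DifferentiableAt ℂ (fun z => Gamma (2 - z)) z := by
    refine DifferentiableAt.comp z (differentiableAt_Gamma _ fun m h => ?_) (by fun_prop)
    have : (2 - z).re = -(m : ℝ) := by rw [h]; simp
    simp only [sub_re, re_ofNat] at this
    linarith [(Nat.cast_nonneg m : (0 : ℝ) ≤ m)]
  have hP : DifferentiableAt ℂ (fun z : ℂ => (2 * Real.pi : ℂ) ^ (-(1 - z))) z :=
    DifferentiableAt.const_cpow (by fun_prop) (Or.inl hpi)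
  unfold gammaFactor
  cases odd
  · simp only [Bool.false_eq_true, if_false]
    exact (((differentiableAt_const _).mul hP).mul hG).mul (by fun_prop)
      |>.differentiableWithinAt
  · simp only [if_true]
    exact (((differentiableAt_const _).mul hP).mul hG).mul (by fun_prop)
      |>.differentiableWithinAt

lemma gammaFactor_neg_nat_eq_zero (odd : Bool) {m : ℕ} (h : odd = true ↔ Odd m) :
    gammaFactor odd (-m) = 0 := by
  cases odd
  · have he : Even m := by
      rw [← Nat.not_odd_iff_even]
      exact fun ho => by simpa using h.mpr ho
    obtain ⟨k, rfl⟩ := he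
    have : cos (Real.pi * (1 - -((k + k : ℕ) : ℂ)) / 2) = 0 := by
      rw [Complex.cos_eq_zero_iff]
      exact ⟨k, by push_cast; ring⟩
    simp only [gammaFactor, Bool.false_eq_true, if_false, this, mul_zero]
  · obtain ⟨k, rfl⟩ := h.mp rfl
    have : sin (Real.pi * (1 - -((2 * k + 1 : ℕ) : ℂ)) / 2) = 0 := by
      rw [Complex.sin_eq_zero_iff]
      exact ⟨k + 1, by push_cast; ring⟩
    simp only [gammaFactor, if_true, this, mul_zero]

end WittenZeta

end

noncomputable section

namespace WittenZeta

open Complex Set Metric MeasureTheory Filter Topology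

/-- The Cauchy integral formula on a polydisc. -/
theorem torusIntegral_cauchy {n : ℕ} {R : ℝ} {c : Fin n → ℂ} {f : (Fin n → ℂ) → ℂ}
    {U : Set (Fin n → ℂ)} (hU : IsOpen U) (hR : 0 < R) (hf : DifferentiableOn ℂ f U)
    (hsub : closedBall c R ⊆ U) {p : Fin n → ℂ} (hp : p ∈ ball c R) :
    (∯ w in T(c, fun _ => R), (∏ i, (w i - p i)⁻¹) * f w) = (2 * Real.pi * I) ^ n * f p := by
  induction n with
  | zero =>
    rw [torusIntegral_dim0]
    simp [Subsingleton.elim c p]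
  | succ n ih =>
    have hpi : ∀ i, p i ∈ ball (c i) R := fun i => by
      rw [mem_ball] at hp ⊢
      exact (dist_le_pi_dist p c i).trans_lt hp
    have hcont : Continuous fun θ : Fin (n + 1) → ℝ =>
        (∏ i, (torusMap c (fun _ => R) θ i - p i)⁻¹) * f (torusMap c (fun _ => R) θ) := by
      have ht : Continuous (torusMap c fun _ => R) := by
        unfold torusMap; fun_prop
      have hm : ∀ θ, torusMap c (fun _ => R) θ ∈ closedBall c R := fun θ => by
        rw [mem_closedBall, dist_pi_le_iff hR.le]
        intro i
        exact circleMap_mem_closedBall (c i) hR.le (θ i)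
      refine Continuous.mul (continuous_finsetProd _ fun i _ => ?_)
        (hf.continuousOn.comp_continuous ht fun θ => hsub (hm θ))
      refine Continuous.inv₀ (by fun_prop) fun θ h => ?_
      have h1 : torusMap c (fun _ => R) θ i = circleMap (c i) R (θ i) := rfl
      rw [sub_eq_zero, h1] at h
      exact circleMap_ne_mem_ball (hpi i) (θ i) h
    rw [torusIntegral_succ]
    · have inner : ∀ w ∈ sphere (c 0) R,
          (∯ y in T(c ∘ Fin.succ, fun _ => R),
            (∏ i, ((Fin.cons w y : Fin (n + 1) → ℂ) i - p i)⁻¹) * f (Fin.cons w y)) =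
          (2 * Real.pi * I) ^ n * ((w - p 0)⁻¹ * f (Fin.cons w (p ∘ Fin.succ))) := by
        intro w hw
        have hcl : Continuous fun y : Fin n → ℂ => (Fin.cons w y : Fin (n + 1) → ℂ) := by
          fun_prop
        have hdiff : Differentiable ℂ fun y : Fin n → ℂ => (Fin.cons w y : Fin (n + 1) → ℂ) := by
          rw [differentiable_pi]
          intro i
          refine Fin.cases ?_ (fun j => ?_) i
          · simp
          · simpa using differentiable_apply j
        have := ih (c := c ∘ Fin.succ) (f := fun y => f (Fin.cons w y))
          (U := (fun y : Fin n → ℂ => (Fin.cons w y : Fin (n + 1) → ℂ)) ⁻¹' U)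
          (hU.preimage hcl) (hf.comp hdiff.differentiableOn fun y hy => hy)
          (fun y hy => hsub (by
            rw [mem_closedBall, dist_pi_le_iff hR.le] at hy ⊢
            intro i
            refine Fin.cases ?_ (fun j => ?_) i
            · simpa using (mem_sphere.mp hw).le
            · simpa using hy j)) (p := p ∘ Fin.succ) (by
            rw [mem_ball, dist_pi_lt_iff hR]
            exact fun i => hpi i.succ)
        simp only [Fin.prod_univ_succ, Fin.cons_zero, Fin.cons_succ, mul_assoc]
        rw [torusIntegral_const_mul]
        simp only [Function.comp_apply] at this ⊢
        rw [this]
        ring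
      have h2 := circleIntegral_sub_inv_smul_of_differentiable_on_off_countable (s := ∅)
        countable_empty (hpi 0) (f := fun w => f (Fin.cons w (p ∘ Fin.succ))) ?_ ?_
      · have h3 := circleIntegral.integral_congr hR.le inner
        refine h3.trans ?_
        rw [circleIntegral.integral_const_mul]
        simp only [smul_eq_mul] at h2
        rw [h2, pow_succ, show (Fin.cons (p 0) (p ∘ Fin.succ) : Fin (n + 1) → ℂ) = p from
          Fin.cons_self_tail p]
        ring
      · refine hf.continuousOn.comp (by fun_prop) fun w hw => hsub ?_
        rw [mem_closedBall, dist_pi_le_iff hR.le]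
        intro i
        refine Fin.cases ?_ (fun j => ?_) i
        · simpa using hw
        · simpa using (mem_ball.mp (hpi j.succ)).le
      · intro w hw
        have hdiff : Differentiable ℂ fun w : ℂ =>
            (Fin.cons w (p ∘ Fin.succ) : Fin (n + 1) → ℂ) := by
          rw [differentiable_pi]
          intro i
          refine Fin.cases ?_ (fun j => ?_) i
          · simp
          · simp
        refine (hf.differentiableAt (hU.mem_nhds (hsub ?_))).comp w hdiff.differentiableAt
        rw [mem_closedBall, dist_pi_le_iff hR.le]
        intro i
        refine Fin.cases ?_ (fun j => ?_) i
        · simpa using (mem_ball.mp hw.1).le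
        · simpa using (mem_ball.mp (hpi j.succ)).le
    · exact hcont.continuousOn.integrableOn_compact isCompact_Icc

/-- A parametric integral of functions depending holomorphically on finitely many complex
parameters is jointly analytic in the parameters. -/
theorem analyticAt_integral_pi {n : ℕ} {h : (Fin n → ℂ) → ℝ → ℂ} {U : Set (Fin n → ℂ)}
    (hU : IsOpen U) {c : Fin n → ℂ} (hcU : c ∈ U)
    (hd : ∀ y ∈ Icc (0 : ℝ) 1, DifferentiableOn ℂ (fun p => h p y) U)
    (hc : ContinuousOn (fun q : (Fin n → ℂ) × ℝ => h q.1 q.2) (U ×ˢ Icc (0 : ℝ) 1)) :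
    AnalyticAt ℂ (fun p => ∫ y in Icc (0 : ℝ) 1, h p y) c := by
  obtain ⟨R, hR, hsub⟩ := nhds_basis_closedBall.mem_iff.mp (hU.mem_nhds hcU)
  set X := Fin n → ℝ
  let A : Set X := Icc (0 : X) fun _ => 2 * Real.pi
  let tm : X → (Fin n → ℂ) := torusMap c fun _ => R
  have ht : Continuous tm := by
    simp only [tm]; unfold torusMap; fun_prop
  have hm : ∀ θ, tm θ ∈ closedBall c R := fun θ => by
    rw [mem_closedBall, dist_pi_le_iff hR.le]
    intro i
    exact circleMap_mem_closedBall (c i) hR.le (θ i)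
  let jac : X → ℂ := fun θ => ∏ i, ((R : ℂ) * cexp (θ i * I) * I)
  have hjac : Continuous jac := by simp only [jac]; fun_prop
  let W : ℝ × X → ℂ := fun q => jac q.2 * h (tm q.2) q.1
  have hW : ContinuousOn W (Icc (0 : ℝ) 1 ×ˢ A) := by
    refine ContinuousOn.mul (hjac.comp continuous_snd).continuousOn ?_
    exact hc.comp (f := fun q : ℝ × X => (tm q.2, q.1)) (by fun_prop) fun q hq =>
      ⟨hsub (hm _), hq.1⟩
  have hK : IsCompact (Icc (0 : ℝ) 1 ×ˢ A) := isCompact_Icc.prod isCompact_Icc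
  have hKm : MeasurableSet (Icc (0 : ℝ) 1 ×ˢ A) := measurableSet_Icc.prod measurableSet_Icc
  obtain ⟨C, hC⟩ := hK.exists_bound_of_continuousOn hW
  have hint : ∀ g : BoundedContinuousFunction X ℂ,
      IntegrableOn (fun q : ℝ × X => W q * g q.2) (Icc (0 : ℝ) 1 ×ˢ A) :=
    fun g => (hW.mul (g.continuous.comp continuous_snd).continuousOn).integrableOn_compact hK
  let Φ : BoundedContinuousFunction X ℂ →L[ℂ] ℂ := LinearMap.mkContinuous
    { toFun := fun g => ∫ q in Icc (0 : ℝ) 1 ×ˢ A, W q * g q.2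
      map_add' := fun g g' => by
        rw [← integral_add (hint g) (hint g')]
        simp [mul_add]
      map_smul' := fun a g => by
        simp only [BoundedContinuousFunction.coe_smul, smul_eq_mul, RingHom.id_apply]
        rw [← integral_const_mul]
        congr 1
        ext q
        ring }
    (C * (volume (Icc (0 : ℝ) 1 ×ˢ A)).toReal) (fun g => by
      have h1 : ∀ q ∈ Icc (0 : ℝ) 1 ×ˢ A, ‖W q * g q.2‖ ≤ C * ‖g‖ := fun q hq => by
        rw [norm_mul]
        exact mul_le_mul (hC q hq) (g.norm_coe_le_norm _) (norm_nonneg _)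
          ((norm_nonneg _).trans (hC q hq))
      refine (norm_setIntegral_le_of_norm_le_const hK.measure_lt_top h1).trans ?_
      simp only [Measure.real]
      exact le_of_eq (by ring))
  let E : Fin n → BoundedContinuousFunction X ℂ := fun i =>
    circleBCF (X := X) (fun θ => θ i) (continuous_apply i) (c i) R
  let al := algebraMap ℂ (BoundedContinuousFunction X ℂ)
  have key : AnalyticAt ℂ (fun p : Fin n → ℂ => ((2 * Real.pi * I : ℂ) ^ n)⁻¹ *
      Φ (∏ i, Ring.inverse (E i - al (p i)))) c := by
    refine analyticAt_const.mul (AnalyticAt.fun_comp (Φ.analyticAt _) ?_)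
    refine Finset.analyticAt_fun_prod _ fun i _ => ?_
    exact AnalyticAt.fun_comp (f := fun p : Fin n → ℂ => p i)
      (g := fun z => Ring.inverse (E i - al z))
      (analyticAt_ringInverse_sub _ _ (circleBCF_inverse _ _ _ (mem_ball_self hR)).1)
      ((ContinuousLinearMap.proj (R := ℂ) (φ := fun _ : Fin n => ℂ) i).analyticAt _)
  refine key.congr ?_
  filter_upwards [ball_mem_nhds c hR] with p hp
  have hpi : (2 * Real.pi * I : ℂ) ^ n ≠ 0 := pow_ne_zero _ (by simp [Real.pi_ne_zero])
  rw [inv_mul_eq_iff_eq_mul₀ hpi, ← integral_const_mul]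
  change ∫ q in Icc (0 : ℝ) 1 ×ˢ A, W q * (∏ i, Ring.inverse (E i - al (p i))) q.2 = _
  rw [Measure.volume_eq_prod, setIntegral_prod _ (by
    simpa [Measure.volume_eq_prod] using hint (∏ i, Ring.inverse (E i - al (p i))))]
  refine setIntegral_congr_fun measurableSet_Icc fun y hy => ?_
  simp only
  rw [← torusIntegral_cauchy hU hR (hd y hy) hsub hp, torusIntegral]
  refine integral_congr_ae (Filter.Eventually.of_forall fun θ => ?_)
  have hpe : ∀ i, p i ∈ ball (c i) R := fun i => by
    rw [mem_ball] at hp ⊢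
    exact (dist_le_pi_dist p c i).trans_lt hp
  have : (∏ i, Ring.inverse (E i - al (p i))) θ = ∏ i, (tm θ i - p i)⁻¹ := by
    have h0 : ∀ (s : Finset (Fin n)) (G : Fin n → BoundedContinuousFunction X ℂ),
        (∏ i ∈ s, G i) θ = ∏ i ∈ s, G i θ := fun s G => by
      induction s using Finset.cons_induction with
      | empty => simp
      | cons a s ha ih => rw [Finset.prod_cons, Finset.prod_cons, ← ih]; rfl
    rw [h0]
    refine Finset.prod_congr rfl fun i _ => ?_
    exact (circleBCF_inverse (X := X) (fun θ => θ i) (continuous_apply i) (c i) (hpe i)).2 θ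
  simp only [this, W, jac, tm, smul_eq_mul]
  ring

theorem analyticAt_integral {E : Type*} [NormedAddCommGroup E] [NormedSpace ℂ E]
    [FiniteDimensional ℂ E] {h : E → ℝ → ℂ} {U : Set E} (hU : IsOpen U) {c : E} (hcU : c ∈ U)
    (hd : ∀ y ∈ Icc (0 : ℝ) 1, DifferentiableOn ℂ (fun p => h p y) U)
    (hc : ContinuousOn (fun q : E × ℝ => h q.1 q.2) (U ×ˢ Icc (0 : ℝ) 1)) :
    AnalyticAt ℂ (fun p => ∫ y in Icc (0 : ℝ) 1, h p y) c := by
  let e : E ≃L[ℂ] (Fin (Module.finrank ℂ E) → ℂ) := (Module.finBasis ℂ E).equivFunL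
  have := analyticAt_integral_pi (h := fun q y => h (e.symm q) y) (U := e.symm ⁻¹' U)
    (hU.preimage e.symm.continuous) (c := e c) (by simpa using hcU)
    (fun y hy => (hd y hy).comp e.symm.differentiable.differentiableOn fun q hq => hq)
    (hc.comp (f := fun q : (Fin (Module.finrank ℂ E) → ℂ) × ℝ => (e.symm q.1, q.2))
      (by fun_prop) fun q hq => hq)
  have h2 := AnalyticAt.fun_comp (f := e)
    (g := fun q => ∫ y in Icc (0 : ℝ) 1, h (e.symm q) y) this
    (e.analyticAt c)
  simpa using h2

end WittenZeta

end

noncomputable section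

namespace WittenZeta

open Complex Set Metric MeasureTheory Filter Topology

variable {E : Type*} [NormedAddCommGroup E] [NormedSpace ℂ E]

/-- The partial derivative in the last variable. -/
def partialDeriv (Ψ : E × ℂ → ℂ) (q : E × ℂ) : ℂ := fderiv ℂ Ψ q (0, 1)

lemma analyticAt_partialDeriv {Ψ : E × ℂ → ℂ} {q : E × ℂ} (h : AnalyticAt ℂ Ψ q) :
    AnalyticAt ℂ (partialDeriv Ψ) q :=
  AnalyticAt.fun_comp (f := fderiv ℂ Ψ) (g := fun T : E × ℂ →L[ℂ] ℂ => T (0, 1))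
    ((ContinuousLinearMap.apply ℂ ℂ ((0, 1) : E × ℂ)).analyticAt _) h.fderiv

lemma hasDerivAt_partialDeriv {Ψ : E × ℂ → ℂ} {p : E} {y : ℝ}
    (h : AnalyticAt ℂ Ψ (p, (y : ℂ))) :
    HasDerivAt (fun t : ℝ => Ψ (p, (t : ℂ))) (partialDeriv Ψ (p, (y : ℂ))) y := by
  have h1 := h.differentiableAt.hasFDerivAt
  have h2 : HasDerivAt (fun z : ℂ => ((p, z) : E × ℂ)) (0, 1) (y : ℂ) :=
    (hasDerivAt_const _ _).prodMk (hasDerivAt_id _)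
  exact (h1.comp_hasDerivAt (y : ℂ) h2).comp_ofReal

lemma integral_cpow_mul_succ {Ψ : E × ℂ → ℂ} {p : E}
    (hΨ : ∀ y ∈ Icc (0 : ℝ) 1, AnalyticAt ℂ Ψ (p, (y : ℂ))) {e : ℂ} (he : -1 < e.re) :
    (e + 1) * ∫ y in Icc (0 : ℝ) 1, (y : ℂ) ^ e * Ψ (p, (y : ℂ)) =
      ∫ y in Icc (0 : ℝ) 1, (y : ℂ) ^ (e + 1) *
        ((e + 2) * Ψ (p, 1) - partialDeriv Ψ (p, (y : ℂ))) := by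
  have hc : ContinuousOn (fun y : ℝ => Ψ (p, (y : ℂ))) (Icc 0 1) := fun y hy =>
    (hasDerivAt_partialDeriv (hΨ y hy)).continuousAt.continuousWithinAt
  have hc' : ContinuousOn (fun y : ℝ => partialDeriv Ψ (p, (y : ℂ))) (Icc 0 1) := fun y hy =>
    ((analyticAt_partialDeriv (hΨ y hy)).continuousAt.comp (f := fun y : ℝ => ((p, (y : ℂ)) : E × ℂ))
      (by fun_prop)).continuousWithinAt
  have he1 : e + 1 ≠ 0 := fun h => by
    have := congrArg re h
    simp at this
    linarith
  have hp : ContinuousOn (fun y : ℝ => (y : ℂ) ^ (e + 1)) (Icc 0 1) := by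
    refine fun y hy => (continuousAt_ofReal_cpow_const _ _ (Or.inl ?_)).continuousWithinAt
    simp; linarith
  have h01 : uIcc (0 : ℝ) 1 = Icc 0 1 := uIcc_of_le zero_le_one
  have i1 : IntervalIntegrable (fun y : ℝ => (y : ℂ) ^ e) volume 0 1 :=
    intervalIntegral.intervalIntegrable_cpow' he
  have i2 : IntervalIntegrable (fun y : ℝ => partialDeriv Ψ (p, (y : ℂ))) volume 0 1 :=
    (hc'.mono (by rw [h01])).intervalIntegrable
  have ibp := intervalIntegral.integral_mul_deriv_eq_deriv_mul_of_hasDerivAt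
    (u := fun y : ℝ => Ψ (p, (y : ℂ))) (v := fun y : ℝ => (y : ℂ) ^ (e + 1))
    (u' := fun y : ℝ => partialDeriv Ψ (p, (y : ℂ))) (v' := fun y : ℝ => (e + 1) * (y : ℂ) ^ e)
    (a := 0) (b := 1) (by rwa [h01]) (by rwa [h01])
    (fun y hy => hasDerivAt_partialDeriv (hΨ y (by
      simp at hy; exact ⟨hy.1.le, hy.2.le⟩)))
    (fun y hy => by
      have hy0 : y ≠ 0 := by simp at hy; exact hy.1.ne'
      have := hasDerivAt_ofReal_cpow_const (x := y) hy0 (r := e + 1) he1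
      simpa using this)
    i2 (i1.const_mul _)
  have hint : ∫ y in (0 : ℝ)..1, (y : ℂ) ^ (e + 1) = 1 / (e + 2) := by
    rw [integral_cpow (Or.inl (by simp; linarith))]
    have : e + 1 + 1 ≠ 0 := fun h => by
      have := congrArg re h
      simp at this
      linarith
    simp [zero_cpow this]
    ring
  have he2 : e + 2 ≠ 0 := fun h => by
    have := congrArg re h
    simp at this
    linarith
  simp only [integral_Icc_eq_integral_Ioc, ← intervalIntegral.integral_of_le zero_le_one]
  have i3 : IntervalIntegrable (fun y : ℝ => (y : ℂ) ^ (e + 1)) volume 0 1 :=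
    (hp.mono (by rw [h01])).intervalIntegrable
  have i4 : IntervalIntegrable (fun y : ℝ => (y : ℂ) ^ (e + 1) * partialDeriv Ψ (p, (y : ℂ)))
      volume 0 1 := ((hp.mul hc').mono (by rw [h01])).intervalIntegrable
  simp only [mul_sub]
  rw [intervalIntegral.integral_sub (i3.mul_const _) i4, intervalIntegral.integral_mul_const, hint,
    ← intervalIntegral.integral_const_mul]
  have e1 : ∫ y in (0 : ℝ)..1, (e + 1) * ((y : ℂ) ^ e * Ψ (p, (y : ℂ))) =
      ∫ y in (0 : ℝ)..1, Ψ (p, (y : ℂ)) * ((e + 1) * (y : ℂ) ^ e) := by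
    congr 1; ext y; ring
  rw [e1, ibp]
  have e2 : ∫ y in (0 : ℝ)..1, partialDeriv Ψ (p, (y : ℂ)) * (y : ℂ) ^ (e + 1) =
      ∫ y in (0 : ℝ)..1, (y : ℂ) ^ (e + 1) * partialDeriv Ψ (p, (y : ℂ)) := by
    congr 1; ext y; ring
  rw [e2]
  simp [zero_cpow he1]
  field_simp

lemma exists_integral_cpow_mul_eq {V : Set E} (L : ℕ) :
    ∀ (Ψ : E × ℂ → ℂ) (e : E → ℂ), (∀ p, AnalyticAt ℂ e p) →
      (∀ p ∈ V, ∀ y ∈ Icc (0 : ℝ) 1, AnalyticAt ℂ Ψ (p, (y : ℂ))) →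
    ∃ G : E × ℂ → ℂ, (∀ p ∈ V, ∀ y ∈ Icc (0 : ℝ) 1, AnalyticAt ℂ G (p, (y : ℂ))) ∧
      ∀ p ∈ V, -1 < (e p).re →
        (∏ l ∈ Finset.range L, (e p + l + 1)) * ∫ y in Icc (0 : ℝ) 1, (y : ℂ) ^ e p * Ψ (p, (y : ℂ)) =
          ∫ y in Icc (0 : ℝ) 1, (y : ℂ) ^ (e p + L) * G (p, (y : ℂ)) := by
  induction L with
  | zero => exact fun Ψ e _ hΨ => ⟨Ψ, hΨ, fun p _ _ => by simp⟩
  | succ L ih =>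
    intro Ψ e he hΨ
    obtain ⟨G, hG, hGeq⟩ := ih
      (fun q => (e q.1 + 2) * Ψ (q.1, 1) - partialDeriv Ψ q) (fun p => e p + 1)
      (fun p => (he p).add analyticAt_const) (fun p hp y hy => by
        have h1 : AnalyticAt ℂ (fun q : E × ℂ => e q.1) (p, (y : ℂ)) :=
          AnalyticAt.fun_comp (f := Prod.fst) (he p) analyticAt_fst
        have h2 : AnalyticAt ℂ (fun q : E × ℂ => Ψ (q.1, 1)) (p, (y : ℂ)) := by
          have := hΨ p hp 1 (by simp)
          rw [ofReal_one] at this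
          exact AnalyticAt.fun_comp (f := fun q : E × ℂ => ((q.1, (1 : ℂ)) : E × ℂ)) this
            (analyticAt_fst.prod analyticAt_const)
        exact ((h1.add analyticAt_const).mul h2).sub (analyticAt_partialDeriv (hΨ p hp y hy)))
    refine ⟨G, hG, fun p hp hre => ?_⟩
    have := hGeq p hp (by simp; linarith)
    rw [← integral_cpow_mul_succ (hΨ p hp) hre] at this
    rw [Finset.prod_range_succ']
    have e1 : ∀ l : ℕ, e p + ((l + 1 : ℕ) : ℂ) + 1 = e p + 1 + l + 1 := fun l => by
      push_cast; ring
    simp only [e1, Nat.cast_zero, add_zero, mul_assoc]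
    rw [this]
    refine setIntegral_congr_fun measurableSet_Icc fun y _ => ?_
    congr 2
    push_cast
    ring

theorem exists_analytic_integral_cpow_mul [FiniteDimensional ℂ E] {V : Set E} {Ψ : E × ℂ → ℂ}
    {e : E → ℂ} (he : ∀ p, AnalyticAt ℂ e p)
    (hΨ : ∀ p ∈ V, ∀ y ∈ Icc (0 : ℝ) 1, AnalyticAt ℂ Ψ (p, (y : ℂ))) (L : ℕ)
    (hL : ∀ p ∈ V, 0 < (e p).re + L) :
    ∃ G : E → ℂ, (∀ p ∈ V, AnalyticAt ℂ G p) ∧ ∀ p ∈ V, -1 < (e p).re →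
      (∏ l ∈ Finset.range L, (e p + l + 1)) * ∫ y in Icc (0 : ℝ) 1, (y : ℂ) ^ e p * Ψ (p, (y : ℂ)) =
        G p := by
  obtain ⟨G, hG, hGeq⟩ := exists_integral_cpow_mul_eq L Ψ e he hΨ
  refine ⟨fun p => ∫ y in Icc (0 : ℝ) 1, (y : ℂ) ^ (e p + L) * G (p, (y : ℂ)), fun p hp => ?_,
    hGeq⟩
  have hopen : IsOpen {q : E × ℝ | AnalyticAt ℂ G (q.1, (q.2 : ℂ))} :=
    (isOpen_analyticAt ℂ G).preimage
      (f := fun q : E × ℝ => ((q.1, (q.2 : ℂ)) : E × ℂ)) (by fun_prop)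
  obtain ⟨u, v, hu, hv, hpu, hIv, huv⟩ := generalized_tube_lemma (s := {p}) isCompact_singleton
    (t := Icc (0 : ℝ) 1) isCompact_Icc hopen (by
      rintro ⟨q, y⟩ ⟨hq, hy⟩
      rw [mem_singleton_iff] at hq
      simp only at hq hy
      subst hq
      exact hG q hp y hy)
  have hec : Continuous e := continuous_iff_continuousAt.mpr fun p => (he p).continuousAt
  have hre : IsOpen {q : E | 0 < (e q + L).re} :=
    isOpen_lt continuous_const (continuous_re.comp (hec.add continuous_const))
  have hGa : ∀ q ∈ u, ∀ y ∈ Icc (0 : ℝ) 1, AnalyticAt ℂ G (q, (y : ℂ)) := fun q hq y hy =>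
    huv (show (q, y) ∈ u ×ˢ v from ⟨hq, hIv hy⟩)
  refine analyticAt_integral (U := u ∩ {q : E | 0 < (e q + L).re}) (hu.inter hre)
    ⟨hpu rfl, by simpa using hL p hp⟩ ?_ ?_
  · intro y hy q hq
    have h1 : DifferentiableAt ℂ (fun q => G (q, (y : ℂ))) q :=
      (hGa q hq.1 y hy).differentiableAt.comp (f := fun q : E => ((q, (y : ℂ)) : E × ℂ)) q
        (by fun_prop)
    have h2 : DifferentiableAt ℂ (fun q => (y : ℂ) ^ (e q + L)) q := by
      rcases hy.1.eq_or_lt with h | h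
      · rw [← h]
        have : (fun _ : E => (0 : ℂ)) =ᶠ[𝓝 q] fun q => ((0 : ℝ) : ℂ) ^ (e q + L) := by
          filter_upwards [hre.mem_nhds hq.2] with z hz
          rw [ofReal_zero, zero_cpow]
          intro h0
          exact (lt_irrefl (0 : ℝ)) (by simpa [h0] using (show 0 < (e z + L).re from hz))
        exact (differentiableAt_const _).congr_of_eventuallyEq this.symm
      · exact DifferentiableAt.const_cpow ((he q).differentiableAt.add_const _)
          (Or.inl (by exact_mod_cast h.ne'))
    exact (h2.mul h1).differentiableWithinAt
  · rintro ⟨q, y⟩ ⟨hq, hy⟩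
    have h1 : ContinuousAt (fun r : E × ℝ => G (r.1, (r.2 : ℂ))) (q, y) :=
      (hGa q hq.1 y hy).continuousAt.comp
        (f := fun r : E × ℝ => ((r.1, (r.2 : ℂ)) : E × ℂ)) (by fun_prop)
    have h2 : ContinuousAt (fun r : E × ℝ => (r.2 : ℂ) ^ (e r.1 + L)) (q, y) := by
      have h3 : ContinuousAt (fun x : ℂ × ℂ => x.1 ^ x.2) ((y : ℂ), e q + L) := by
        rcases hy.1.eq_or_lt with h | h
        · simp only at h
          rw [← h]
          exact_mod_cast continuousAt_cpow_zero_of_re_pos hq.2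
        · exact continuousAt_cpow (Or.inl (by simpa using h))
      exact ContinuousAt.comp (g := fun x : ℂ × ℂ => x.1 ^ x.2) (x := (q, y))
        (f := fun r : E × ℝ => ((r.2 : ℂ), e r.1 + L)) h3
        ((continuous_ofReal.comp continuous_snd).prodMk
          ((hec.comp continuous_fst).add continuous_const)).continuousAt
    exact (h2.mul h1).continuousWithinAt

end WittenZeta

end

noncomputable section

namespace WittenZeta

open Set Metric MeasureTheory Filter Topology
open scoped ENNReal

/-- The open orthant. -/
def orthant (ι : Type*) : Set (ι → ℝ) := {x | ∀ i, 0 < x i}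

/-- The open unit cube. -/
def unitCube (ι : Type*) : Set (ι → ℝ) := {x | ∀ i, 0 < x i ∧ x i < 1}

lemma measurableSet_orthant (ι : Type*) [Fintype ι] : MeasurableSet (orthant ι) := by
  have : orthant ι = Set.pi univ fun _ => Ioi 0 := by ext; simp [orthant]
  rw [this]
  exact MeasurableSet.univ_pi fun _ => measurableSet_Ioi

lemma unitCube_eq_pi (ι : Type*) : unitCube ι = Set.pi univ fun _ => Ioo 0 1 := by
  ext; simp [unitCube]

lemma measurableSet_unitCube (ι : Type*) [Fintype ι] : MeasurableSet (unitCube ι) := by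
  rw [unitCube_eq_pi]
  exact MeasurableSet.univ_pi fun _ => measurableSet_Ioo

lemma volume_unitCube (ι : Type*) [Fintype ι] : volume (unitCube ι) = 1 := by
  rw [unitCube_eq_pi, Real.volume_pi_Ioo]
  simp

lemma volume_coord_eq {ι : Type*} [Fintype ι] {i j : ι} (hij : i ≠ j) :
    volume {x : ι → ℝ | x i = x j} = 0 := by
  classical
  let S : Submodule ℝ (ι → ℝ) := LinearMap.ker
    (LinearMap.proj (R := ℝ) (φ := fun _ : ι => ℝ) i - LinearMap.proj (φ := fun _ : ι => ℝ) j)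
  have h : {x : ι → ℝ | x i = x j} = (S : Set (ι → ℝ)) := by
    ext x
    simp [S, sub_eq_zero]
  rw [h]
  refine Measure.addHaar_submodule _ S fun htop => ?_
  have : (Pi.single i 1 : ι → ℝ) ∈ S := by rw [htop]; trivial
  simp [S, Pi.single_eq_of_ne hij.symm] at this

/-- The part of the orthant where the `i`-th coordinate is the largest. -/
def maxSector {ι : Type*} (i : ι) : Set (ι → ℝ) := {x | 0 < x i ∧ ∀ j, j ≠ i → 0 < x j ∧ x j < x i}

lemma measurableSet_maxSector {ι : Type*} [Fintype ι] (i : ι) : MeasurableSet (maxSector i) := by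
  have : maxSector i = {x : ι → ℝ | 0 < x i} ∩ ⋂ j : ι, {x | j ≠ i → 0 < x j ∧ x j < x i} := by
    ext; simp [maxSector]
  rw [this]
  refine (measurableSet_lt measurable_const (measurable_pi_apply i)).inter
    (MeasurableSet.iInter fun j => ?_)
  by_cases h : j = i
  · simp [h]
  · simp only [ne_eq, h, not_false_eq_true, true_implies]
    exact (measurableSet_lt measurable_const (measurable_pi_apply j)).inter
      (measurableSet_lt (measurable_pi_apply j) (measurable_pi_apply i))

lemma orthant_ae_eq_iUnion_maxSector (ι : Type*) [Fintype ι] [Nonempty ι] :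
    (orthant ι : Set (ι → ℝ)) =ᵐ[volume] ⋃ i : ι, maxSector i := by
  have hae : ∀ᵐ x : ι → ℝ, ∀ i j, i ≠ j → x i ≠ x j := by
    rw [ae_all_iff]; intro i
    rw [ae_all_iff]; intro j
    by_cases h : i = j
    · simp [h]
    · have := volume_coord_eq h
      refine Filter.Eventually.mono (compl_mem_ae_iff.mpr this) fun x hx _ => hx
  filter_upwards [hae] with x hx
  refine propext ⟨fun h => ?_, fun h => ?_⟩
  · obtain ⟨i, -, hi⟩ := Finset.exists_max_image Finset.univ x Finset.univ_nonempty
    exact mem_iUnion.mpr ⟨i, h i, fun j hj => ⟨h j, lt_of_le_of_ne (hi j (Finset.mem_univ _))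
      (hx j i hj)⟩⟩
  · obtain ⟨i, hi, h2⟩ := mem_iUnion.mp h
    intro j
    by_cases hj : j = i
    · exact hj ▸ hi
    · exact (h2 j hj).1

lemma lintegral_maxSector {n : ℕ} (i : Fin (n + 1)) {F : (Fin (n + 1) → ℝ) → ℝ≥0∞}
    (hF : Measurable F) :
    ∫⁻ x in maxSector i, F x = ∫⁻ y in Ioi (0 : ℝ), ENNReal.ofReal (y ^ n) *
      ∫⁻ u in unitCube (Fin n), F (i.insertNth y (y • u)) := by
  have hem := (volume_preserving_piFinSuccAbove (fun _ : Fin (n + 1) => ℝ) i).symm _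
  rw [← lintegral_indicator (measurableSet_maxSector i), ← hem.lintegral_comp
    (hF.indicator (measurableSet_maxSector i)), Measure.volume_eq_prod,
    lintegral_prod (fun a => (maxSector i).indicator F
      ((MeasurableEquiv.piFinSuccAbove (fun _ => ℝ) i).symm a))
    (((hF.indicator (measurableSet_maxSector i)).comp hem.measurable).aemeasurable),
    ← lintegral_indicator measurableSet_Ioi]
  refine lintegral_congr fun y => ?_
  simp only [MeasurableEquiv.piFinSuccAbove_symm_apply, Fin.insertNthEquiv, Equiv.coe_fn_mk]
  by_cases hy : 0 < y
  · have hmem : ∀ u : Fin n → ℝ, (i.insertNth y (y • u) : Fin (n + 1) → ℝ) ∈ maxSector i ↔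
        u ∈ unitCube (Fin n) := by
      intro u
      simp only [maxSector, unitCube, mem_ofPred_eq, Fin.insertNth_apply_same, hy, true_and]
      rw [i.forall_iff_succAbove]
      simp [Fin.succAbove_ne, hy]
    have hmeas : Measurable fun x' : Fin n → ℝ =>
        (maxSector i).indicator F (i.insertNth y x') :=
      (hF.indicator (measurableSet_maxSector i)).comp
        (hem.measurable.comp (measurable_const.prodMk measurable_id))
    have hsc := Measure.map_addHaar_smul (volume : Measure (Fin n → ℝ)) hy.ne'
    have hyn : (0 : ℝ) < y ^ n := pow_pos hy n
    have h1 : (∫⁻ x' : Fin n → ℝ, (maxSector i).indicator F (i.insertNth y x')) =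
        ENNReal.ofReal (y ^ n) * ∫⁻ u : Fin n → ℝ,
          (maxSector i).indicator F (i.insertNth y (y • u)) := by
      have := lintegral_map (μ := (volume : Measure (Fin n → ℝ))) hmeas
        (measurable_const_smul y)
      rw [hsc, lintegral_smul_measure] at this
      rw [← this, smul_eq_mul, ← mul_assoc, ← ENNReal.ofReal_mul hyn.le]
      simp only [Module.finrank_fin_fun]
      rw [abs_of_pos (inv_pos.mpr hyn), mul_inv_cancel₀ hyn.ne', ENNReal.ofReal_one, one_mul]
    rw [indicator_of_mem (show y ∈ Ioi (0 : ℝ) from hy), ← lintegral_indicator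
      (measurableSet_unitCube _)]
    refine h1.trans ?_
    congr 1
    refine lintegral_congr fun u => ?_
    by_cases hu : u ∈ unitCube (Fin n)
    · rw [indicator_of_mem hu, indicator_of_mem ((hmem u).mpr hu)]
    · rw [indicator_of_notMem hu, indicator_of_notMem (fun h => hu ((hmem u).mp h))]
  · rw [indicator_of_notMem (show y ∉ Ioi (0 : ℝ) from hy)]
    refine (lintegral_congr fun x' => ?_).trans lintegral_zero
    refine indicator_of_notMem (fun h => hy ?_) _
    simpa using h.1

/-- Polar coordinates for the maximum norm. -/
def polarMeasure (n : ℕ) : Measure (ℝ × (Fin n → ℝ)) :=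
  ((volume.restrict (Ioi (0 : ℝ))).withDensity fun y => ENNReal.ofReal (y ^ n)).prod
    (volume.restrict (unitCube (Fin n)))

/-- The polar coordinate chart in which the `i`-th coordinate is the largest. -/
def polarChart {n : ℕ} (i : Fin (n + 1)) (q : ℝ × (Fin n → ℝ)) : Fin (n + 1) → ℝ :=
  q.1 • (i.insertNth 1 q.2 : Fin (n + 1) → ℝ)

lemma polarChart_eq {n : ℕ} (i : Fin (n + 1)) (y : ℝ) (u : Fin n → ℝ) :
    polarChart i (y, u) = i.insertNth y (y • u) := by
  ext j
  refine i.succAboveCases ?_ (fun k => ?_) j <;> simp [polarChart]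

lemma continuous_polarChart {n : ℕ} (i : Fin (n + 1)) : Continuous (polarChart i) := by
  unfold polarChart
  refine continuous_fst.smul (continuous_pi fun j => ?_)
  refine i.succAboveCases ?_ (fun k => ?_) j
  · simpa using continuous_const
  · simp only [Fin.insertNth_apply_succAbove]
    fun_prop

instance (n : ℕ) : SFinite ((volume.restrict (Ioi (0 : ℝ))).withDensity
    fun y => ENNReal.ofReal (y ^ n)) := by infer_instance

theorem restrict_orthant_eq_sum (n : ℕ) :
    (volume : Measure (Fin (n + 1) → ℝ)).restrict (orthant _) =
      ∑ i, (polarMeasure n).map (polarChart i) := by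
  refine Measure.ext_of_lintegral _ fun F hF => ?_
  rw [lintegral_finsetSum_measure, setLIntegral_congr (orthant_ae_eq_iUnion_maxSector _),
    lintegral_iUnion measurableSet_maxSector, tsum_fintype]
  · refine Finset.sum_congr rfl fun i _ => ?_
    rw [lintegral_maxSector i hF, lintegral_map hF (continuous_polarChart i).measurable,
      polarMeasure, lintegral_prod (fun a => F (polarChart i a))
        (hF.comp (continuous_polarChart i).measurable).aemeasurable,
      lintegral_withDensity_eq_lintegral_mul _ (by fun_prop)]
    · simp only [Pi.mul_apply, polarChart_eq]
    · exact Measurable.lintegral_prod_right' (f := fun q : ℝ × (Fin n → ℝ) => F (polarChart i q))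
        (hF.comp (continuous_polarChart i).measurable)
  · intro i j hij
    refine Set.disjoint_left.mpr fun x hi hj => ?_
    exact absurd (hi.2 j hij.symm).2 (not_lt.mpr (hj.2 i hij).2.le)

lemma integral_polarMeasure {n : ℕ} {G : ℝ × (Fin n → ℝ) → ℂ}
    (hG : Integrable G (polarMeasure n)) :
    ∫ q, G q ∂(polarMeasure n) =
      ∫ u in unitCube (Fin n), ∫ y in Ioi (0 : ℝ), (y : ℂ) ^ n * G (y, u) := by
  rw [polarMeasure, integral_prod_symm _ hG]
  refine integral_congr_ae (Filter.Eventually.of_forall fun u => ?_)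
  simp only
  rw [integral_withDensity_eq_integral_toReal_smul (by fun_prop) (by simp)]
  refine setIntegral_congr_fun measurableSet_Ioi fun y hy => ?_
  rw [ENNReal.toReal_ofReal (pow_nonneg (le_of_lt hy) n), Complex.real_smul]
  push_cast
  rfl

theorem integral_orthant_eq_sum {n : ℕ} {F : (Fin (n + 1) → ℝ) → ℂ}
    (hF : IntegrableOn F (orthant _)) :
    ∫ x in orthant (Fin (n + 1)), F x = ∑ i : Fin (n + 1), ∫ u in unitCube (Fin n),
      ∫ y in Ioi (0 : ℝ), (y : ℂ) ^ n * F (y • (i.insertNth 1 u : Fin (n + 1) → ℝ)) := by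
  rw [IntegrableOn, restrict_orthant_eq_sum, integrable_finsetSum_measure] at hF
  rw [restrict_orthant_eq_sum, integral_finsetSum_measure hF]
  refine Finset.sum_congr rfl fun i hi => ?_
  have h1 := hF i hi
  have hm := (continuous_polarChart i).measurable
  rw [integral_map hm.aemeasurable h1.1]
  exact integral_polarMeasure ((integrable_map_measure h1.1 hm.aemeasurable).mp h1)

theorem integral_unitCube_eq_sum {n : ℕ} {F : (Fin (n + 1) → ℝ) → ℂ}
    (hF : IntegrableOn F (unitCube _)) :
    ∫ x in unitCube (Fin (n + 1)), F x = ∑ i : Fin (n + 1), ∫ u in unitCube (Fin n),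
      ∫ y in Ioo (0 : ℝ) 1, (y : ℂ) ^ n * F (y • (i.insertNth 1 u : Fin (n + 1) → ℝ)) := by
  have hsub : unitCube (Fin (n + 1)) ⊆ orthant _ := fun x hx i => (hx i).1
  have hm := measurableSet_unitCube (Fin (n + 1))
  have h1 := integral_orthant_eq_sum (F := (unitCube _).indicator F)
    ((integrable_indicator_iff hm).mpr hF).integrableOn
  rw [setIntegral_indicator hm, inter_eq_self_of_subset_right hsub] at h1
  rw [h1]
  refine Finset.sum_congr rfl fun i _ => ?_
  refine setIntegral_congr_fun (measurableSet_unitCube _) fun u hu => ?_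
  have hind : ∀ y ∈ Ioi (0 : ℝ), (y : ℂ) ^ n *
      (unitCube _).indicator F (y • (i.insertNth 1 u : Fin (n + 1) → ℝ)) =
      (Iio (1 : ℝ)).indicator
        (fun y : ℝ => (y : ℂ) ^ n * F (y • (i.insertNth 1 u : Fin (n + 1) → ℝ))) y := by
    intro y hy
    have hy0 : 0 < y := hy
    by_cases h : y < 1
    · rw [indicator_of_mem (show y ∈ Iio (1 : ℝ) from h), indicator_of_mem]
      intro j
      refine i.succAboveCases ?_ (fun k => ?_) j
      · simpa using ⟨hy0, h⟩
      · simp only [Pi.smul_apply, Fin.insertNth_apply_succAbove, smul_eq_mul]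
        have := hu k
        exact ⟨mul_pos hy0 this.1, by nlinarith⟩
    · rw [indicator_of_notMem (show y ∉ Iio (1 : ℝ) from h), indicator_of_notMem, mul_zero]
      intro hmem
      have := (hmem i).2
      simp at this
      exact h this
  rw [setIntegral_congr_fun measurableSet_Ioi hind, setIntegral_indicator measurableSet_Iio,
    Ioi_inter_Iio]

end WittenZeta

end

noncomputable section

namespace WittenZeta

open Complex Set Metric MeasureTheory Filter Topology

/-- The vertical strip `-K < re s < 2`. -/
def strip (K : ℕ) : Set ℂ := {s | -(K : ℝ) < s.re ∧ s.re < 2}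

/-- `J`, given on `1 < re s < 2`, continues meromorphically to `strip K` with poles of order at
most `d`. -/
def HasContinuation (K d : ℕ) (J : ℂ → ℂ) : Prop :=
  ∃ F : ℂ → ℂ, (∀ s ∈ strip K, MeromorphicAt F s ∧
    ((-(d : ℤ) : ℤ) : WithTop ℤ) ≤ meromorphicOrderAt F s) ∧
    ∀ s : ℂ, 1 < s.re → s.re < 2 → F s = J s

namespace HasContinuation

variable {K d : ℕ} {J J' : ℂ → ℂ}

lemma congr (h : HasContinuation K d J) (hJ : ∀ s : ℂ, 1 < s.re → s.re < 2 → J s = J' s) :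
    HasContinuation K d J' := by
  obtain ⟨F, h1, h2⟩ := h
  exact ⟨F, h1, fun s a b => (h2 s a b).trans (hJ s a b)⟩

lemma of_analytic (h : ∀ s ∈ strip K, AnalyticAt ℂ J s) : HasContinuation K d J :=
  ⟨J, fun s hs => ⟨(h s hs).meromorphicAt, le_trans (by
    exact_mod_cast (by omega : -(d : ℤ) ≤ 0)) (h s hs).meromorphicOrderAt_nonneg⟩, fun _ _ _ => rfl⟩

lemma zero : HasContinuation K d (fun _ => 0) := of_analytic fun _ _ => analyticAt_const

lemma add (h : HasContinuation K d J) (h' : HasContinuation K d J') :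
    HasContinuation K d (fun s => J s + J' s) := by
  obtain ⟨F, h1, h2⟩ := h
  obtain ⟨F', h1', h2'⟩ := h'
  refine ⟨F + F', fun s hs => ⟨(h1 s hs).1.add (h1' s hs).1, ?_⟩, fun s a b => ?_⟩
  · exact (le_min (h1 s hs).2 (h1' s hs).2).trans
      (meromorphicOrderAt_add (h1 s hs).1 (h1' s hs).1)
  · simp [h2 s a b, h2' s a b]

lemma sum {κ : Type*} {T : Finset κ} {J : κ → ℂ → ℂ} (h : ∀ i ∈ T, HasContinuation K d (J i)) :
    HasContinuation K d (fun s => ∑ i ∈ T, J i s) := by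
  classical
  induction T using Finset.induction_on with
  | empty => simpa using zero
  | insert a T ha ih =>
    refine ((h a (Finset.mem_insert_self _ _)).add
      (ih fun i hi => h i (Finset.mem_insert_of_mem hi))).congr fun s _ _ => ?_
    rw [Finset.sum_insert ha]

lemma mul {A : ℂ → ℂ} {c : ℤ} (h : HasContinuation K d J) {d' : ℕ}
    (hA : ∀ s ∈ strip K, MeromorphicAt A s ∧ (c : WithTop ℤ) ≤ meromorphicOrderAt A s)
    (hd : -(d' : ℤ) ≤ c - d) :
    HasContinuation K d' (fun s => A s * J s) := by
  obtain ⟨F, h1, h2⟩ := h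
  refine ⟨A * F, fun s hs => ⟨(hA s hs).1.mul (h1 s hs).1, ?_⟩, fun s a b => ?_⟩
  · rw [meromorphicOrderAt_mul (hA s hs).1 (h1 s hs).1]
    refine le_trans ?_ (add_le_add (hA s hs).2 (h1 s hs).2)
    rw [← WithTop.coe_add]
    exact_mod_cast hd
  · simp [h2 s a b]

end HasContinuation

lemma order_inv_prod_affine (k c L : ℕ) (s : ℂ) :
    MeromorphicAt (fun s : ℂ => (∏ l ∈ Finset.range L, (k * (s - 1) + c + l + 1))⁻¹) s ∧
    ((-1 : ℤ) : WithTop ℤ) ≤ meromorphicOrderAt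
      (fun s : ℂ => (∏ l ∈ Finset.range L, (k * (s - 1) + c + l + 1))⁻¹) s := by
  have han : ∀ T : Finset ℕ, AnalyticAt ℂ (fun s : ℂ => ∏ l ∈ T, (k * (s - 1) + c + l + 1)) s :=
    fun T => Finset.analyticAt_fun_prod _ fun l _ => by fun_prop
  refine ⟨(han _).meromorphicAt.inv, ?_⟩
  by_cases h0 : ∏ l ∈ Finset.range L, ((k : ℂ) * (s - 1) + c + l + 1) = 0
  · obtain ⟨l₀, hl₀, hz⟩ := Finset.prod_eq_zero_iff.mp h0
    have hk : (k : ℂ) ≠ 0 := by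
      intro hk
      rw [hk] at hz
      simp only [zero_mul, zero_add] at hz
      have : ((c + l₀ + 1 : ℕ) : ℂ) = 0 := by push_cast; exact hz
      exact absurd (Nat.cast_eq_zero.mp this) (by omega)
    have hne : ∏ l ∈ (Finset.range L).erase l₀, ((k : ℂ) * (s - 1) + c + l + 1) ≠ 0 := by
      rw [Finset.prod_ne_zero_iff]
      intro l hl h
      have : (l : ℂ) = l₀ := by linear_combination h - hz
      exact (Finset.mem_erase.mp hl).1 (Nat.cast_injective this)
    have heq : (fun s : ℂ => (∏ l ∈ Finset.range L, (k * (s - 1) + c + l + 1))⁻¹) =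
        (fun z : ℂ => (z - s)⁻¹) * fun z : ℂ => ((k : ℂ) *
          ∏ l ∈ (Finset.range L).erase l₀, ((k : ℂ) * (z - 1) + c + l + 1))⁻¹ := by
      ext z
      rw [← Finset.mul_prod_erase _ _ hl₀, Pi.mul_apply, ← mul_inv]
      congr 1
      linear_combination (∏ l ∈ (Finset.range L).erase l₀, ((k : ℂ) * (z - 1) + c + l + 1)) * hz
    have h1 : MeromorphicAt (fun z : ℂ => (z - s)⁻¹) s :=
      (analyticAt_id.sub analyticAt_const).meromorphicAt.inv
    have h2 : AnalyticAt ℂ (fun z : ℂ => ((k : ℂ) *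
          ∏ l ∈ (Finset.range L).erase l₀, ((k : ℂ) * (z - 1) + c + l + 1))⁻¹) s :=
      (analyticAt_const.mul (han _)).inv (mul_ne_zero hk hne)
    rw [heq, meromorphicOrderAt_mul h1 h2.meromorphicAt]
    have h3 : meromorphicOrderAt (fun z : ℂ => (z - s)⁻¹) s = ((-1 : ℤ) : WithTop ℤ) := by
      rw [meromorphicOrderAt_eq_int_iff h1]
      refine ⟨1, analyticAt_const, one_ne_zero, Filter.Eventually.of_forall fun z => ?_⟩
      simp
    rw [h3]
    exact le_add_of_nonneg_right h2.meromorphicOrderAt_nonneg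
  · exact le_trans (by exact_mod_cast (by norm_num : (-1 : ℤ) ≤ 0))
      ((han _).inv h0).meromorphicOrderAt_nonneg

/-- `Ψ(s, u)` is analytic at all points of `strip K × [0, 1]^b`. -/
def AnalyticOnCube (K : ℕ) {b : ℕ} (Ψ : ℂ × (Fin b → ℂ) → ℂ) : Prop :=
  ∀ s ∈ strip K, ∀ u : Fin b → ℝ, (∀ j, u j ∈ Icc (0 : ℝ) 1) →
    AnalyticAt ℂ Ψ (s, fun j => (u j : ℂ))

lemma AnalyticOnCube.prod {K b : ℕ} {κ : Type*} {T : Finset κ} {Ψ : κ → ℂ × (Fin b → ℂ) → ℂ}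
    (h : ∀ i ∈ T, AnalyticOnCube K (Ψ i)) : AnalyticOnCube K (fun q => ∏ i ∈ T, Ψ i q) :=
  fun s hs u hu => Finset.analyticAt_fun_prod _ fun i hi => h i hi s hs u hu

lemma analyticOnCube_affine_cpow {b : ℕ} {c : ℝ} (hc : 0 < c) {a : Fin b → ℝ} (ha : ∀ j, 0 ≤ a j)
    {e : ℂ → ℂ} {s : ℂ} (he : AnalyticAt ℂ e s) {u : Fin b → ℝ} (hu : ∀ j, u j ∈ Icc (0 : ℝ) 1) :
    AnalyticAt ℂ (fun q : ℂ × (Fin b → ℂ) => ((c : ℂ) + ∑ j, (a j : ℂ) * q.2 j) ^ (e q.1))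
      (s, fun j => (u j : ℂ)) := by
  have h1 : AnalyticAt ℂ (fun q : ℂ × (Fin b → ℂ) => (c : ℂ) + ∑ j, (a j : ℂ) * q.2 j)
      (s, fun j => (u j : ℂ)) := by
    refine analyticAt_const.add (Finset.analyticAt_fun_sum _ fun j _ => analyticAt_const.mul ?_)
    exact ((ContinuousLinearMap.proj (R := ℂ) (φ := fun _ : Fin b => ℂ) j).comp
      (ContinuousLinearMap.snd ℂ ℂ (Fin b → ℂ))).analyticAt _
  refine AnalyticAt.cpow h1 (AnalyticAt.fun_comp (f := Prod.fst) he analyticAt_fst) (Or.inl ?_)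
  have : 0 ≤ ∑ j, a j * u j := Finset.sum_nonneg fun j _ => mul_nonneg (ha j) (hu j).1
  simp only [add_re, ofReal_re, re_sum, mul_re, ofReal_im, mul_zero, sub_zero]
  linarith

lemma setIntegral_unitCube_zero (f : (Fin 0 → ℝ) → ℂ) :
    ∫ u in unitCube (Fin 0), f u = f default := by
  have : unitCube (Fin 0) = univ := by ext; simp [unitCube]
  rw [this, Measure.restrict_univ, integral_unique]
  have : (volume : Measure (Fin 0 → ℝ)).real univ = 1 := by
    simp [Measure.real, ← this, volume_unitCube]
  rw [this, one_smul]
  congr 1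
  exact Subsingleton.elim _ _

lemma mem_strip_of_one_lt {K : ℕ} {s : ℂ} (hs1 : 1 < s.re) (hs2 : s.re < 2) : s ∈ strip K := ⟨by
  have : (0 : ℝ) ≤ K := Nat.cast_nonneg _
  linarith, hs2⟩

lemma integrableOn_forms {K b : ℕ} {κ : Type*} (T : Finset κ) (a : κ → Fin b → ℝ)
    {Ψ : ℂ × (Fin b → ℂ) → ℂ} (hΨ : AnalyticOnCube K Ψ) {s : ℂ} (hs1 : 1 < s.re)
    (hs2 : s.re < 2) :
    IntegrableOn (fun u : Fin b → ℝ => (∏ f ∈ T,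
      ((∑ j, a f j * u j : ℝ) : ℂ) ^ (s - 1)) * Ψ (s, fun j => (u j : ℂ))) (unitCube (Fin b)) := by
  have hcont : ContinuousOn (fun u : Fin b → ℝ => (∏ f ∈ T,
      ((∑ j, a f j * u j : ℝ) : ℂ) ^ (s - 1)) * Ψ (s, fun j => (u j : ℂ)))
      (Set.pi univ fun _ => Icc 0 1) := by
    refine ContinuousOn.mul (Continuous.continuousOn (continuous_finsetProd _ fun f _ => ?_)) ?_
    · refine continuous_iff_continuousAt.mpr fun u => ?_
      exact ContinuousAt.comp (g := fun x : ℝ => (x : ℂ) ^ (s - 1))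
        (f := fun u : Fin b → ℝ => ∑ j, a f j * u j)
        (continuousAt_ofReal_cpow_const _ _ (Or.inl (by simpa using hs1)))
        (Continuous.continuousAt (by fun_prop))
    · intro u hu
      refine ContinuousAt.continuousWithinAt ?_
      exact ContinuousAt.comp (g := Ψ)
        (f := fun u : Fin b → ℝ => ((s, fun j => (u j : ℂ)) : ℂ × (Fin b → ℂ)))
        (hΨ s (mem_strip_of_one_lt hs1 hs2) u fun j => hu j (mem_univ _)).continuousAt
        (Continuous.continuousAt (by fun_prop))
  refine (hcont.integrableOn_compact (isCompact_univ_pi fun _ => isCompact_Icc)).mono_set ?_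
  rw [unitCube_eq_pi]
  exact Set.pi_mono fun _ _ => Ioo_subset_Icc_self

/-- The integral of a product of powers of non-negative linear forms over the cube. -/
theorem hasContinuation_integral_forms (K : ℕ) {κ : Type*} (b : ℕ) :
    ∀ (T : Finset κ) (a : κ → Fin b → ℝ) (Ψ : ℂ × (Fin b → ℂ) → ℂ), (∀ f ∈ T, ∀ j, 0 ≤ a f j) →
      (∀ f ∈ T, ∃ j, 0 < a f j) → AnalyticOnCube K Ψ →
    HasContinuation K b (fun s => ∫ u in unitCube (Fin b),
      (∏ f ∈ T, ((∑ j, a f j * u j : ℝ) : ℂ) ^ (s - 1)) * Ψ (s, fun j => (u j : ℂ))) := by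
  classical
  induction b with
  | zero =>
    intro T a Ψ _ hT hΨ
    have hTe : T = ∅ := Finset.eq_empty_of_forall_notMem fun f hf => (hT f hf).choose.elim0
    subst hTe
    simp only [setIntegral_unitCube_zero, Finset.prod_empty, one_mul]
    exact HasContinuation.of_analytic fun s hs =>
      AnalyticAt.fun_comp (f := fun s : ℂ => (s, fun j => ((default : Fin 0 → ℝ) j : ℂ)))
        (hΨ s hs default fun j => j.elim0) (analyticAt_id.prod analyticAt_const)
  | succ b ih =>
    intro T a Ψ ha hT hΨ
    have key : ∀ i : Fin (b + 1), HasContinuation K (b + 1) (fun s => ∫ u in unitCube (Fin b),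
        ∫ y in Ioo (0 : ℝ) 1, (y : ℂ) ^ b * ((∏ f ∈ T,
          ((∑ j, a f j * (y • (i.insertNth 1 u : Fin (b + 1) → ℝ)) j : ℝ) : ℂ) ^ (s - 1)) *
          Ψ (s, fun j => ((y • (i.insertNth 1 u : Fin (b + 1) → ℝ)) j : ℂ)))) := by
      intro i
      let T₁ := T.filter fun f => 0 < a f i
      let T₀ := T.filter fun f => ¬ 0 < a f i
      let a' : κ → Fin b → ℝ := fun f j => a f (i.succAbove j)
      let V : Set (ℂ × (Fin b → ℂ)) :=
        {p | p.1 ∈ strip K ∧ ∃ u : Fin b → ℝ, (∀ j, u j ∈ Icc (0 : ℝ) 1) ∧ p.2 = fun j => (u j : ℂ)}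
      let e : ℂ × (Fin b → ℂ) → ℂ := fun p => T.card * (p.1 - 1) + b
      let Ψ₁ : (ℂ × (Fin b → ℂ)) × ℂ → ℂ := fun q =>
        Ψ (q.1.1, q.2 • (i.insertNth 1 q.1.2 : Fin (b + 1) → ℂ)) *
          ∏ f ∈ T₁, ((a f i : ℂ) + ∑ j, (a' f j : ℂ) * q.1.2 j) ^ (q.1.1 - 1)
      have hcast : ∀ (u : Fin b → ℝ) (y : ℝ), (fun j => ((y • (i.insertNth 1 u : Fin (b + 1) → ℝ)) j : ℂ)) =
          (y : ℂ) • (i.insertNth 1 (fun j => (u j : ℂ)) : Fin (b + 1) → ℂ) := by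
        intro u y
        ext j
        refine i.succAboveCases ?_ (fun k => ?_) j <;> simp
      have hΨ₁ : ∀ p ∈ V, ∀ y ∈ Icc (0 : ℝ) 1, AnalyticAt ℂ Ψ₁ (p, (y : ℂ)) := by
        rintro ⟨s, v⟩ ⟨hs, u, hu, hv⟩ y hy
        simp only at hs hv
        subst hv
        refine AnalyticAt.mul ?_ ?_
        · have h1 := hΨ s hs (y • (i.insertNth 1 u : Fin (b + 1) → ℝ)) (fun j => by
            refine i.succAboveCases ?_ (fun k => ?_) j
            · simpa using hy
            · simp only [Pi.smul_apply, Fin.insertNth_apply_succAbove, smul_eq_mul]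
              exact ⟨mul_nonneg hy.1 (hu k).1, mul_le_one₀ hy.2 (hu k).1 (hu k).2⟩)
          rw [hcast] at h1
          refine AnalyticAt.fun_comp (f := fun q : (ℂ × (Fin b → ℂ)) × ℂ =>
            (q.1.1, q.2 • (i.insertNth 1 q.1.2 : Fin (b + 1) → ℂ))) h1 ?_
          have hf1 : AnalyticAt ℂ (fun q : (ℂ × (Fin b → ℂ)) × ℂ => q.1.1)
              ((s, fun j => (u j : ℂ)), (y : ℂ)) :=
            ((ContinuousLinearMap.fst ℂ ℂ (Fin b → ℂ)).comp
              (ContinuousLinearMap.fst ℂ (ℂ × (Fin b → ℂ)) ℂ)).analyticAt _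
          refine hf1.prod ?_
          rw [analyticAt_pi_iff]
          intro j
          refine i.succAboveCases ?_ (fun k => ?_) j
          · simp only [Pi.smul_apply, Fin.insertNth_apply_same, smul_eq_mul, mul_one]
            exact analyticAt_snd
          · simp only [Pi.smul_apply, Fin.insertNth_apply_succAbove, smul_eq_mul]
            refine analyticAt_snd.mul ?_
            exact (((ContinuousLinearMap.proj (R := ℂ) (φ := fun _ : Fin b => ℂ) k).comp
              (ContinuousLinearMap.snd ℂ ℂ (Fin b → ℂ))).comp
              (ContinuousLinearMap.fst ℂ (ℂ × (Fin b → ℂ)) ℂ)).analyticAt _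
        · refine Finset.analyticAt_fun_prod _ fun f hf => ?_
          have hf' := Finset.mem_filter.mp hf
          exact AnalyticAt.fun_comp (f := Prod.fst) (g := fun q : ℂ × (Fin b → ℂ) =>
            ((a f i : ℂ) + ∑ j, (a' f j : ℂ) * q.2 j) ^ (q.1 - 1))
            (analyticOnCube_affine_cpow hf'.2 (fun j => ha f hf'.1 _)
              (e := fun s => s - 1) (by fun_prop) hu) analyticAt_fst
      obtain ⟨G, hG, hGeq⟩ := exists_analytic_integral_cpow_mul (V := V) (Ψ := Ψ₁) (e := e)
        (fun p => (analyticAt_const.mul (analyticAt_fst.sub analyticAt_const)).add analyticAt_const)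
        hΨ₁ (T.card * (K + 1) + 1) (by
          rintro ⟨s, v⟩ ⟨hs, -⟩
          have h1 : (e (s, v)).re = T.card * (s.re - 1) + b := by simp [e]
          rw [h1]
          push_cast
          have h2 : (0 : ℝ) ≤ T.card * (s.re + K) :=
            mul_nonneg (Nat.cast_nonneg _) (by have : -(K : ℝ) < s.re := hs.1; linarith)
          have h3 : (0 : ℝ) ≤ b := Nat.cast_nonneg _
          nlinarith)
      have hIH := ih T₀ a' G (fun f hf j => ha f (Finset.mem_filter.mp hf).1 _)
        (fun f hf => by
          have hf' := Finset.mem_filter.mp hf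
          obtain ⟨j, hj⟩ := hT f hf'.1
          have hji : j ≠ i := fun h => hf'.2 (h ▸ hj)
          obtain ⟨k, rfl⟩ := Fin.exists_succAbove_eq hji
          exact ⟨k, hj⟩)
        (fun s hs u hu => hG _ ⟨hs, u, hu, rfl⟩)
      refine (hIH.mul (c := -1) (d' := b + 1)
        (fun s _ => order_inv_prod_affine T.card b (T.card * (K + 1) + 1) s)
        (by push_cast; omega)).congr fun s hs1 hs2 => ?_
      have hsK : s ∈ strip K := ⟨by
        have : (0 : ℝ) ≤ K := Nat.cast_nonneg _
        linarith, hs2⟩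
      rw [← integral_const_mul]
      refine setIntegral_congr_fun (measurableSet_unitCube _) fun u hu => ?_
      have hu' : ∀ j, u j ∈ Icc (0 : ℝ) 1 := fun j => ⟨(hu j).1.le, (hu j).2.le⟩
      set v : Fin b → ℂ := fun j => (u j : ℂ) with hv
      have hp : ((s, v) : ℂ × (Fin b → ℂ)) ∈ V := ⟨hsK, u, hu', rfl⟩
      have hre : (e (s, v)).re = T.card * (s.re - 1) + b := by simp [e]
      have hre0 : 0 ≤ (e (s, v)).re := by
        rw [hre]
        exact add_nonneg (mul_nonneg (Nat.cast_nonneg _) (by linarith)) (Nat.cast_nonneg _)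
      have hD : ∏ l ∈ Finset.range (T.card * (K + 1) + 1), (e (s, v) + l + 1) ≠ 0 := by
        rw [Finset.prod_ne_zero_iff]
        intro l _ h
        have := congrArg re h
        simp only [add_re, natCast_re, one_re, zero_re] at this
        linarith [(Nat.cast_nonneg l : (0 : ℝ) ≤ l)]
      have hGv := hGeq (s, v) hp (by linarith)
      have hGv' : (∏ l ∈ Finset.range (T.card * (K + 1) + 1), (T.card * (s - 1) + b + l + 1 : ℂ))⁻¹ *
          G (s, v) = ∫ y in Ioo (0 : ℝ) 1, (y : ℂ) ^ e (s, v) * Ψ₁ ((s, v), (y : ℂ)) := by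
        rw [← hGv, integral_Icc_eq_integral_Ioo]
        exact inv_mul_cancel_left₀ hD _
      rw [mul_left_comm, hGv', ← integral_const_mul]
      refine setIntegral_congr_fun measurableSet_Ioo fun y hy => ?_
      have hform : ∀ f, (∑ j, a f j * (y • (i.insertNth 1 u : Fin (b + 1) → ℝ)) j : ℝ) =
          y * (a f i + ∑ j, a' f j * u j) := by
        intro f
        rw [i.sum_univ_succAbove]
        simp only [Pi.smul_apply, Fin.insertNth_apply_same, Fin.insertNth_apply_succAbove,
          smul_eq_mul, mul_add, Finset.mul_sum, a']
        congr 1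
        · ring
        · exact Finset.sum_congr rfl fun j _ => by ring
      have hfnn : ∀ f ∈ T, 0 ≤ a f i + ∑ j, a' f j * u j := fun f hf =>
        add_nonneg (ha f hf i) (Finset.sum_nonneg fun j _ => mul_nonneg (ha f hf _) (hu j).1.le)
      have hprod : (∏ f ∈ T,
          ((∑ j, a f j * (y • (i.insertNth 1 u : Fin (b + 1) → ℝ)) j : ℝ) : ℂ) ^ (s - 1)) =
          (y : ℂ) ^ (T.card * (s - 1)) * ((∏ f ∈ T₁, ((a f i : ℂ) + ∑ j, (a' f j : ℂ) * v j) ^ (s - 1)) *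
            ∏ f ∈ T₀, ((∑ j, a' f j * u j : ℝ) : ℂ) ^ (s - 1)) := by
        have : ∀ f ∈ T, ((∑ j, a f j * (y • (i.insertNth 1 u : Fin (b + 1) → ℝ)) j : ℝ) : ℂ) ^ (s - 1)
            = (y : ℂ) ^ (s - 1) * ((a f i + ∑ j, a' f j * u j : ℝ) : ℂ) ^ (s - 1) := by
          intro f hf
          rw [hform f, ofReal_mul, mul_cpow_ofReal_nonneg hy.1.le (hfnn f hf)]
        rw [Finset.prod_congr rfl this, Finset.prod_mul_distrib, Finset.prod_const,
          ← cpow_nat_mul, ← Finset.prod_filter_mul_prod_filter_not T (fun f => 0 < a f i)]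
        congr 2
        · refine Finset.prod_congr rfl fun f _ => ?_
          push_cast
          rfl
        · refine Finset.prod_congr rfl fun f hf => ?_
          have hf' := Finset.mem_filter.mp hf
          have : a f i = 0 := le_antisymm (not_lt.mp hf'.2) (ha f hf'.1 i)
          rw [this, zero_add]
      have hy0 : (y : ℂ) ≠ 0 := by exact_mod_cast hy.1.ne'
      rw [hprod, hcast u y]
      simp only [Ψ₁, e]
      rw [cpow_add _ _ hy0, cpow_natCast]
      ring
    refine (HasContinuation.sum (T := Finset.univ) fun i _ => key i).congr fun s hs1 hs2 => ?_
    symm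
    refine integral_unitCube_eq_sum (F := fun u => (∏ f ∈ T,
      ((∑ j, a f j * u j : ℝ) : ℂ) ^ (s - 1)) * Ψ (s, fun j => (u j : ℂ))) (integrableOn_forms T a hΨ hs1 hs2)

end WittenZeta

end

noncomputable section

namespace WittenZeta

open Set Metric MeasureTheory Filter Topology

variable {W : Type*} [AddCommGroup W] [Module ℝ W]

/-- Replace the generator `w j` by `w j + c • w i`. -/
def shear {m : ℕ} (w : Fin m → W) (i j : Fin m) (c : ℝ) : Fin m → W :=
  Function.update w j (w j + c • w i)

/-- The coordinate change induced by `shear`. -/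
def shearMap {m : ℕ} (i j : Fin m) (c : ℝ) (x : Fin m → ℝ) : Fin m → ℝ :=
  Function.update x i (x i + c * x j)

lemma sum_shear {m : ℕ} (w : Fin m → W) {i j : Fin m} (hij : i ≠ j) (c : ℝ) (x : Fin m → ℝ) :
    ∑ l, x l • shear w i j c l = ∑ l, shearMap i j c x l • w l := by
  have h1 : ∀ l, x l • shear w i j c l = x l • w l + if l = j then (c * x j) • w i else 0 := by
    intro l
    by_cases h : l = j
    · subst h
      simp [shear, smul_add, smul_smul, mul_comm]
    · simp [shear, h]
  have h2 : ∀ l, shearMap i j c x l • w l = x l • w l + if l = i then (c * x j) • w i else 0 := by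
    intro l
    by_cases h : l = i
    · subst h
      simp [shearMap, add_smul]
    · simp [shearMap, h]
  simp only [h1, h2, Finset.sum_add_distrib, Finset.sum_ite_eq', Finset.mem_univ, if_true]

lemma measurePreserving_shearMap {m : ℕ} {i j : Fin m} (hij : i ≠ j) (c : ℝ) :
    MeasurePreserving (shearMap i j c) volume volume := by
  have h := Real.volume_preserving_transvectionStruct
    (⟨i, j, hij, c⟩ : Matrix.TransvectionStruct (Fin m) ℝ)
  have e : shearMap i j c = Matrix.toLin'
      (⟨i, j, hij, c⟩ : Matrix.TransvectionStruct (Fin m) ℝ).toMatrix := ?_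
  · rw [e]
    exact h
  refine funext fun x => funext fun l => ?_
  simp only [shearMap, Matrix.TransvectionStruct.toMatrix, Matrix.transvection, Matrix.toLin'_apply,
    Matrix.add_mulVec, Matrix.one_mulVec, Pi.add_apply, Matrix.single_mulVec]
  by_cases hl : l = i
  · subst hl
    simp
  · simp [hl]

lemma injective_shearMap {m : ℕ} {i j : Fin m} (hij : i ≠ j) (c : ℝ) :
    Function.Injective (shearMap i j c) := by
  intro x y h
  have h1 : ∀ l, l ≠ i → x l = y l := fun l hl => by
    have := congrFun h l
    simpa [shearMap, hl] using this
  ext l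
  by_cases hl : l = i
  · subst hl
    have := congrFun h l
    simp only [shearMap, Function.update_self, h1 j hij.symm] at this
    linarith
  · exact h1 l hl

lemma shearMap_preimage_orthant {m : ℕ} {i j : Fin m} (hij : i ≠ j) {c : ℝ} (hc : 0 < c) :
    shearMap i j c ⁻¹' (orthant (Fin m) ∩ {x | c * x j < x i}) = orthant (Fin m) := by
  ext x
  simp only [mem_preimage, mem_inter_iff, orthant, mem_ofPred_eq]
  have hj : shearMap i j c x j = x j := by simp [shearMap, hij.symm]
  have hi : shearMap i j c x i = x i + c * x j := by simp [shearMap]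
  rw [hj, hi]
  constructor
  · rintro ⟨h1, h2⟩ l
    by_cases hl : l = i
    · subst hl; linarith
    · have := h1 l
      simpa [shearMap, hl] using this
  · intro h
    refine ⟨fun l => ?_, by linarith [h i]⟩
    by_cases hl : l = i
    · subst hl
      rw [hi]
      have := h l
      have := mul_pos hc (h j)
      linarith
    · simpa [shearMap, hl] using h l

lemma volume_eq_mul_coord {m : ℕ} {i j : Fin m} (hij : i ≠ j) (c : ℝ) :
    volume {x : Fin m → ℝ | x i = c * x j} = 0 := by
  let S : Submodule ℝ (Fin m → ℝ) := LinearMap.ker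
    (LinearMap.proj (R := ℝ) (φ := fun _ : Fin m => ℝ) i -
      c • LinearMap.proj (φ := fun _ : Fin m => ℝ) j)
  have h : {x : Fin m → ℝ | x i = c * x j} = (S : Set (Fin m → ℝ)) := by
    ext x
    simp [S, sub_eq_zero]
  rw [h]
  refine Measure.addHaar_submodule _ S fun htop => ?_
  have : (Pi.single i 1 : Fin m → ℝ) ∈ S := by rw [htop]; trivial
  simp [S, Pi.single_eq_of_ne hij.symm] at this

/-- Cutting an orthant into two along the hyperplane `x i = c * x j`. -/
theorem integral_orthant_shear {m : ℕ} {i j : Fin m} (hij : i ≠ j) {c : ℝ} (hc : 0 < c)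
    {F : (Fin m → ℝ) → ℂ} (hF : IntegrableOn F (orthant _)) :
    IntegrableOn (F ∘ shearMap i j c) (orthant _) ∧
    IntegrableOn (F ∘ shearMap j i c⁻¹) (orthant _) ∧
    ∫ x in orthant (Fin m), F x = (∫ x in orthant (Fin m), F (shearMap i j c x)) +
      ∫ x in orthant (Fin m), F (shearMap j i c⁻¹ x) := by
  have piece : ∀ {i j : Fin m} (_ : i ≠ j) {c : ℝ} (_ : 0 < c),
      IntegrableOn (F ∘ shearMap i j c) (orthant _) ∧
      ∫ x in orthant (Fin m) ∩ {x | c * x j < x i}, F x =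
        ∫ x in orthant (Fin m), F (shearMap i j c x) := by
    intro i j hij c hc
    have hp := measurePreserving_shearMap hij c
    have hemb := hp.measurable.measurableEmbedding (injective_shearMap hij c)
    constructor
    · have := (hp.integrableOn_comp_preimage (f := F)
        (s := orthant (Fin m) ∩ {x | c * x j < x i}) hemb).mpr (hF.mono_set inter_subset_left)
      rwa [shearMap_preimage_orthant hij hc] at this
    · have := hp.setIntegral_preimage_emb hemb F (orthant (Fin m) ∩ {x | c * x j < x i})
      rw [shearMap_preimage_orthant hij hc] at this
      exact this.symm
  have p1 := piece hij hc
  have p2 := piece hij.symm (inv_pos.mpr hc)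
  refine ⟨p1.1, p2.1, ?_⟩
  rw [← p1.2, ← p2.2]
  have hm : ∀ (i j : Fin m) (c : ℝ), MeasurableSet {x : Fin m → ℝ | c * x j < x i} :=
    fun i j c => measurableSet_lt (by fun_prop) (by fun_prop)
  rw [← setIntegral_union ?_ ((measurableSet_orthant _).inter (hm _ _ _))
    (hF.mono_set inter_subset_left) (hF.mono_set inter_subset_left)]
  · refine setIntegral_congr_set ?_
    have hae : ∀ᵐ x : Fin m → ℝ, x i ≠ c * x j :=
      compl_mem_ae_iff.mpr (volume_eq_mul_coord hij c)
    filter_upwards [hae] with x hx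
    refine propext ⟨fun h => ?_, fun h => ?_⟩
    · rcases lt_or_gt_of_ne hx with h1 | h1
      · refine Or.inr ⟨h, ?_⟩
        change c⁻¹ * x i < x j
        rw [inv_mul_lt_iff₀ hc]
        exact h1
      · exact Or.inl ⟨h, h1⟩
    · rcases h with h | h <;> exact h.1
  · refine Set.disjoint_left.mpr fun x h1 h2 => ?_
    have a1 : c * x j < x i := h1.2
    have a2 : c⁻¹ * x i < x j := h2.2
    rw [inv_mul_lt_iff₀ hc] at a2
    exact lt_asymm a1 a2

/-- All generators lie on the same side of the hyperplane `f = 0`. -/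
def Coherent {m : ℕ} (w : Fin m → W) (f : W →ₗ[ℝ] ℝ) : Prop :=
  (∀ l, 0 ≤ f (w l)) ∨ ∀ l, f (w l) ≤ 0

lemma Coherent.shear {m : ℕ} {w : Fin m → W} {f : W →ₗ[ℝ] ℝ} (h : Coherent w f) (i j : Fin m)
    {c : ℝ} (hc : 0 ≤ c) : Coherent (shear w i j c) f := by
  refine h.imp (fun h l => ?_) fun h l => ?_ <;>
  by_cases hl : l = j
  · subst hl
    simp only [WittenZeta.shear, Function.update_self, map_add, map_smul, smul_eq_mul]
    exact add_nonneg (h l) (mul_nonneg hc (h i))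
  · simpa [WittenZeta.shear, hl] using h l
  · subst hl
    simp only [WittenZeta.shear, Function.update_self, map_add, map_smul, smul_eq_mul]
    exact add_nonpos (h l) (mul_nonpos_of_nonneg_of_nonpos hc (h i))
  · simpa [WittenZeta.shear, hl] using h l

/-- By repeated cutting, a simplicial cone is decomposed into simplicial cones on which finitely
many linear forms do not change sign. -/
theorem cone_induction {m : ℕ} {κ : Type*} (f : κ → W →ₗ[ℝ] ℝ) {P : (Fin m → W) → Prop}
    (hsplit : ∀ w i j c, i ≠ j → 0 < c → P (shear w i j c) → P (shear w j i c⁻¹) → P w)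
    (S : Finset κ) (hcoh : ∀ w, (∀ k ∈ S, Coherent w (f k)) → P w) (w : Fin m → W) : P w := by
  classical
  suffices H : ∀ T ⊆ S, ∀ w, (∀ k ∈ S, k ∉ T → Coherent w (f k)) → P w from
    H S subset_rfl w fun k hk hk' => absurd hk hk'
  intro T
  induction T using Finset.induction_on with
  | empty => exact fun _ w hw => hcoh w fun k hk => hw k hk (Finset.notMem_empty _)
  | insert k₀ T hk₀ ih =>
    intro hT w hw
    have hTS : T ⊆ S := fun k hk => hT (Finset.mem_insert_of_mem hk)
    induction hN : (Finset.univ.filter fun l => f k₀ (w l) ≠ 0).card using Nat.strong_induction_on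
      generalizing w with
    | _ N IH =>
    by_cases hc : Coherent w (f k₀)
    · refine ih hTS w fun k hk hkT => ?_
      by_cases hkk : k = k₀
      · exact hkk ▸ hc
      · exact hw k hk (by simp [hkk, hkT])
    · simp only [Coherent, not_or, not_forall, not_le] at hc
      obtain ⟨⟨j, hj⟩, i, hi⟩ := hc
      have hij : i ≠ j := fun h => by subst h; exact lt_asymm hi hj
      set c := -(f k₀ (w j)) / f k₀ (w i) with hcdef
      have hc0 : 0 < c := div_pos (neg_pos.mpr hj) hi
      have step : ∀ (i j : Fin m) (c : ℝ), 0 < c → f k₀ (w j) ≠ 0 →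
          f k₀ (w j) + c * f k₀ (w i) = 0 → P (shear w i j c) := by
        intro i j c hc0 hj hz
        refine IH _ ?_ _ (fun k hk hkT => (hw k hk hkT).shear i j hc0.le) rfl
        rw [← hN]
        refine Finset.card_lt_card ((Finset.ssubset_iff_of_subset fun l hl => ?_).mpr ⟨j, ?_, ?_⟩)
        · have hl' := (Finset.mem_filter.mp hl).2
          by_cases hlj : l = j
          · subst hlj
            exact Finset.mem_filter.mpr ⟨Finset.mem_univ _, hj⟩
          · simpa [shear, hlj] using hl'
        · exact Finset.mem_filter.mpr ⟨Finset.mem_univ _, hj⟩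
        · exact fun hmem => (Finset.mem_filter.mp hmem).2 (by simp [shear, hz])
      refine hsplit w i j c hij hc0 (step i j c hc0 hj.ne ?_)
        (step j i c⁻¹ (inv_pos.mpr hc0) hi.ne' ?_)
      · rw [hcdef]
        field_simp
        ring
      · rw [hcdef]
        have := hj.ne
        field_simp
        ring

end WittenZeta

end

noncomputable section

namespace WittenZeta

open Complex Set Metric MeasureTheory Filter Topology

/-- A function which is analytic on the cube up to a power of a non-negative linear form. -/
def IsFactor (K : ℕ) {n : ℕ} (g : ℂ → (Fin n → ℝ) → ℂ) : Prop :=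
  ∃ Ψ : ℂ × (Fin n → ℂ) → ℂ, AnalyticOnCube K Ψ ∧
    ((∀ s : ℂ, 1 < s.re → s.re < 2 → ∀ u ∈ unitCube (Fin n), g s u = Ψ (s, fun j => (u j : ℂ))) ∨
    ∃ a : Fin n → ℝ, (∀ j, 0 ≤ a j) ∧ (∃ j, 0 < a j) ∧
      ∀ s : ℂ, 1 < s.re → s.re < 2 → ∀ u ∈ unitCube (Fin n),
        g s u = ((∑ j, a j * u j : ℝ) : ℂ) ^ (s - 1) * Ψ (s, fun j => (u j : ℂ)))

lemma AnalyticOnCube.mul {K n : ℕ} {Ψ Ψ' : ℂ × (Fin n → ℂ) → ℂ} (h : AnalyticOnCube K Ψ)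
    (h' : AnalyticOnCube K Ψ') : AnalyticOnCube K (fun q => Ψ q * Ψ' q) :=
  fun s hs u hu => (h s hs u hu).mul (h' s hs u hu)

lemma IsFactor.mul {K n : ℕ} {g : ℂ → (Fin n → ℝ) → ℂ} (hg : IsFactor K g)
    {Ψ' : ℂ × (Fin n → ℂ) → ℂ} (h' : AnalyticOnCube K Ψ') :
    IsFactor K (fun s u => g s u * Ψ' (s, fun j => (u j : ℂ))) := by
  obtain ⟨Ψ, hΨ, h⟩ := hg
  refine ⟨fun q => Ψ q * Ψ' q, hΨ.mul h', h.imp (fun h s h1 h2 u hu => ?_) ?_⟩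
  · simp only [h s h1 h2 u hu]
  · rintro ⟨a, ha, ha', h⟩
    refine ⟨a, ha, ha', fun s h1 h2 u hu => ?_⟩
    simp only [h s h1 h2 u hu, mul_assoc]

theorem hasContinuation_integral_factors {K n : ℕ} {κ : Type*} [Fintype κ]
    {g : κ → ℂ → (Fin n → ℝ) → ℂ} (hg : ∀ k, IsFactor K (g k))
    {Ψ : ℂ × (Fin n → ℂ) → ℂ} (hΨ : AnalyticOnCube K Ψ) :
    HasContinuation K n (fun s => ∫ u in unitCube (Fin n),
      (∏ k, g k s u) * Ψ (s, fun j => (u j : ℂ))) ∧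
    ∀ s : ℂ, 1 < s.re → s.re < 2 → IntegrableOn
      (fun u => (∏ k, g k s u) * Ψ (s, fun j => (u j : ℂ))) (unitCube (Fin n)) := by
  classical
  choose Φ hΦ hg using hg
  let T : Finset κ := Finset.univ.filter fun k => ¬ ∀ s : ℂ, 1 < s.re → s.re < 2 →
    ∀ u ∈ unitCube (Fin n), g k s u = Φ k (s, fun j => (u j : ℂ))
  have hT : ∀ k, ∃ a : Fin n → ℝ, (k ∈ T → (∀ j, 0 ≤ a j) ∧ (∃ j, 0 < a j) ∧
      ∀ s : ℂ, 1 < s.re → s.re < 2 → ∀ u ∈ unitCube (Fin n),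
        g k s u = ((∑ j, a j * u j : ℝ) : ℂ) ^ (s - 1) * Φ k (s, fun j => (u j : ℂ))) := by
    intro k
    by_cases hk : k ∈ T
    · obtain ⟨a, ha⟩ := (hg k).resolve_left (Finset.mem_filter.mp hk).2
      exact ⟨a, fun _ => ha⟩
    · exact ⟨0, fun h => absurd h hk⟩
  choose a ha using hT
  have hTn : ∀ k, k ∉ T → ∀ s : ℂ, 1 < s.re → s.re < 2 →
      ∀ u ∈ unitCube (Fin n), g k s u = Φ k (s, fun j => (u j : ℂ)) := by
    intro k hk
    by_contra h
    exact hk (Finset.mem_filter.mpr ⟨Finset.mem_univ _, h⟩)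
  have hA : AnalyticOnCube K (fun q => (∏ k, Φ k q) * Ψ q) :=
    (AnalyticOnCube.prod fun k _ => hΦ k).mul hΨ
  have heq : ∀ s : ℂ, 1 < s.re → s.re < 2 → ∀ u ∈ unitCube (Fin n),
      (∏ k ∈ T, ((∑ j, a k j * u j : ℝ) : ℂ) ^ (s - 1)) *
        ((∏ k, Φ k (s, fun j => (u j : ℂ))) * Ψ (s, fun j => (u j : ℂ))) =
      (∏ k, g k s u) * Ψ (s, fun j => (u j : ℂ)) := by
    intro s h1 h2 u hu
    have hTp : ∏ k ∈ T, ((∑ j, a k j * u j : ℝ) : ℂ) ^ (s - 1) =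
        ∏ k, if k ∈ T then ((∑ j, a k j * u j : ℝ) : ℂ) ^ (s - 1) else 1 := by
      rw [Finset.prod_ite_mem, Finset.univ_inter]
    rw [← mul_assoc, hTp, ← Finset.prod_mul_distrib]
    congr 1
    refine Finset.prod_congr rfl fun k _ => ?_
    by_cases hk : k ∈ T
    · rw [if_pos hk, (ha k hk).2.2 s h1 h2 u hu]
    · rw [if_neg hk, one_mul, hTn k hk s h1 h2 u hu]
  constructor
  · refine (hasContinuation_integral_forms K n T a _ (fun k hk => (ha k hk).1)
      (fun k hk => (ha k hk).2.1) hA).congr fun s h1 h2 => ?_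
    exact setIntegral_congr_fun (measurableSet_unitCube _) fun u hu => heq s h1 h2 u hu
  · intro s h1 h2
    exact (integrableOn_forms T a hA h1 h2).congr_fun (fun u hu => heq s h1 h2 u hu)
      (measurableSet_unitCube _)

/-- An integrand on the cube whose factors are finite sums of admissible factors. -/
theorem hasContinuation_integral_sum_factors {K n : ℕ} {κ : Type*} [Fintype κ]
    {g : κ → Fin 3 → ℂ → (Fin n → ℝ) → ℂ} (hg : ∀ k c, IsFactor K (g k c))
    {Ψ : ℂ × (Fin n → ℂ) → ℂ} (hΨ : AnalyticOnCube K Ψ) :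
    HasContinuation K n (fun s => ∫ u in unitCube (Fin n),
      (∏ k, ∑ c, g k c s u) * Ψ (s, fun j => (u j : ℂ))) := by
  classical
  have hc : ∀ c : κ → Fin 3, _ := fun c =>
    hasContinuation_integral_factors (g := fun k => g k (c k)) (fun k => hg k (c k)) hΨ
  refine (HasContinuation.sum (T := Finset.univ) fun c _ => (hc c).1).congr fun s h1 h2 => ?_
  rw [← integral_finsetSum _ fun c _ => (hc c).2 s h1 h2]
  congr 1
  ext u
  rw [← Finset.sum_mul, Finset.prod_univ_sum, Fintype.piFinset_univ]

section Cone

variable {n : ℕ}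

/-- The value at the point `(u, 1)` (with `1` in position `i`) of the linear form with
coefficients `A`. -/
def chartForm (i : Fin (n + 1)) (A : Fin (n + 1) → ℝ) (u : Fin n → ℝ) : ℝ :=
  A i + ∑ j, A (i.succAbove j) * u j

/-- The complexification of `chartForm`. -/
def chartFormC (i : Fin (n + 1)) (A : Fin (n + 1) → ℝ) (u : Fin n → ℂ) : ℂ :=
  (A i : ℂ) + ∑ j, (A (i.succAbove j) : ℂ) * u j

lemma chartFormC_ofReal (i : Fin (n + 1)) (A : Fin (n + 1) → ℝ) (u : Fin n → ℝ) :
    chartFormC i A (fun j => (u j : ℂ)) = (chartForm i A u : ℂ) := by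
  simp [chartForm, chartFormC]

lemma sum_insertNth_mul (i : Fin (n + 1)) (A : Fin (n + 1) → ℝ) (u : Fin n → ℝ) :
    ∑ l, (i.insertNth 1 u : Fin (n + 1) → ℝ) l * A l = chartForm i A u := by
  rw [i.sum_univ_succAbove, chartForm]
  simp [mul_comm]

lemma chartForm_mono {i : Fin (n + 1)} {A B : Fin (n + 1) → ℝ} (h : ∀ l, A l ≤ B l) {u : Fin n → ℝ}
    (hu : ∀ j, u j ∈ Icc (0 : ℝ) 1) : chartForm i A u ≤ chartForm i B u :=
  add_le_add (h i) (Finset.sum_le_sum fun j _ => mul_le_mul_of_nonneg_right (h _) (hu j).1)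

lemma chartForm_pos {i : Fin (n + 1)} {A : Fin (n + 1) → ℝ} (h : ∀ l, 0 < A l) {u : Fin n → ℝ}
    (hu : ∀ j, u j ∈ Icc (0 : ℝ) 1) : 0 < chartForm i A u :=
  add_pos_of_pos_of_nonneg (h i) (Finset.sum_nonneg fun j _ => mul_nonneg (h _).le (hu j).1)

lemma analyticAt_chartFormC (i : Fin (n + 1)) (A : Fin (n + 1) → ℝ) (q : ℂ × (Fin n → ℂ)) :
    AnalyticAt ℂ (fun q : ℂ × (Fin n → ℂ) => chartFormC i A q.2) q := by
  refine analyticAt_const.add (Finset.analyticAt_fun_sum _ fun j _ => analyticAt_const.mul ?_)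
  exact ((ContinuousLinearMap.proj (R := ℂ) (φ := fun _ : Fin n => ℂ) j).comp
    (ContinuousLinearMap.snd ℂ ℂ (Fin n → ℂ))).analyticAt _

lemma analyticOnCube_chartForm_cpow (K : ℕ) (i : Fin (n + 1)) {R : Fin (n + 1) → ℝ}
    (hR : ∀ l, 0 < R l) {e : ℂ → ℂ} (he : ∀ s, AnalyticAt ℂ e s) :
    AnalyticOnCube K (fun q : ℂ × (Fin n → ℂ) => chartFormC i R q.2 ^ e q.1) :=
  fun s _ _ hu => analyticOnCube_affine_cpow (hR i) (fun _ => (hR _).le) (he s) hu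

lemma isFactor_chartForm_cpow (K : ℕ) (i : Fin (n + 1)) {A : Fin (n + 1) → ℝ}
    (hA : ∀ l, 0 ≤ A l) : IsFactor K fun s u => (chartForm i A u : ℂ) ^ (s - 1) := by
  rcases (hA i).eq_or_lt with h0 | hpos
  · by_cases hz : ∃ j, 0 < A (i.succAbove j)
    · refine ⟨fun _ => 1, fun s _ u _ => analyticAt_const, Or.inr
        ⟨fun j => A (i.succAbove j), fun j => hA _, hz, fun s _ _ u _ => ?_⟩⟩
      simp [chartForm, ← h0]
    · refine ⟨fun _ => 0, fun s _ u _ => analyticAt_const, Or.inl fun s hs _ u _ => ?_⟩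
      have hz' : ∀ j, A (i.succAbove j) = 0 := fun j =>
        le_antisymm (not_lt.mp fun h => hz ⟨j, h⟩) (hA _)
      have hs1 : s - 1 ≠ 0 := fun h => by
        have := congrArg re h
        simp at this
        linarith
      simp [chartForm, ← h0, hz', zero_cpow hs1]
  · refine ⟨fun q => chartFormC i A q.2 ^ (q.1 - 1), fun s hs u hu =>
      analyticOnCube_affine_cpow hpos (fun j => hA _) (e := fun s => s - 1) (by fun_prop) hu,
      Or.inl fun s _ _ u _ => ?_⟩
    simp only [chartFormC_ofReal]

lemma ofReal_div_cpow {a r : ℝ} (ha : 0 ≤ a) (hr : 0 < r) (s : ℂ) :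
    ((a / r : ℝ) : ℂ) ^ (s - 1) = (a : ℂ) ^ (s - 1) * (r : ℂ) ^ (1 - s) := by
  have h1 : ((r⁻¹ : ℝ) : ℂ) ^ (s - 1) = (r : ℂ) ^ (1 - s) := by
    rw [ofReal_inv, inv_cpow _ _ (by rw [arg_ofReal_of_nonneg hr.le]; exact Real.pi_pos.ne),
      ← cpow_neg, neg_sub]
  rw [div_eq_mul_inv, ofReal_mul, mul_cpow_ofReal_nonneg ha (inv_nonneg.mpr hr.le), h1]

lemma isFactor_ratio_cpow (K : ℕ) (i : Fin (n + 1)) {A R : Fin (n + 1) → ℝ}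
    (hA : ∀ l, 0 ≤ A l) (hR : ∀ l, 0 < R l) (c : ℂ) : IsFactor K fun s u =>
      c * (s * ((chartForm i A u / chartForm i R u : ℝ) : ℂ) ^ (s - 1)) := by
  have h1 : AnalyticOnCube K (fun q : ℂ × (Fin n → ℂ) =>
      c * q.1 * chartFormC i R q.2 ^ (1 - q.1)) := fun s hs u hu =>
    (analyticAt_const.mul analyticAt_fst).mul
      (analyticOnCube_chartForm_cpow K i hR (e := fun s => 1 - s) (fun s => by fun_prop) s hs u hu)
  obtain ⟨Ψ, hΨ, h⟩ := (isFactor_chartForm_cpow K i hA).mul h1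
  have e : ∀ s : ℂ, ∀ u ∈ unitCube (Fin n),
      c * (s * ((chartForm i A u / chartForm i R u : ℝ) : ℂ) ^ (s - 1)) =
      (chartForm i A u : ℂ) ^ (s - 1) * (c * s * chartFormC i R (fun j => (u j : ℂ)) ^ (1 - s)) := by
    intro s u hu
    have hu' : ∀ j, u j ∈ Icc (0 : ℝ) 1 := fun j => ⟨(hu j).1.le, (hu j).2.le⟩
    have h0 : 0 ≤ chartForm i A u := by
      have := chartForm_mono (i := i) (A := 0) hA hu'
      simpa [chartForm] using this
    rw [ofReal_div_cpow h0 (chartForm_pos hR hu'), chartFormC_ofReal]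
    ring
  refine ⟨Ψ, hΨ, h.imp (fun h s h1 h2 u hu => ?_) ?_⟩
  · exact (e s u hu).trans (h s h1 h2 u hu)
  · rintro ⟨a, ha, ha', h⟩
    exact ⟨a, ha, ha', fun s h1 h2 u hu => (e s u hu).trans (h s h1 h2 u hu)⟩

lemma analyticOnCube_tail_ratio (K : ℕ) (i : Fin (n + 1)) {A R : Fin (n + 1) → ℝ}
    (hA : ∀ l, 0 ≤ A l) (hR : ∀ l, 0 < R l) : AnalyticOnCube K fun q : ℂ × (Fin n → ℂ) =>
      hurwitzTail (1 - q.1, chartFormC i A q.2 / chartFormC i R q.2) := by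
  intro s hs u hu
  have hr := chartForm_pos (i := i) hR hu
  have h0 : 0 ≤ chartForm i A u := by
    have := chartForm_mono (i := i) (A := 0) hA hu
    simpa [chartForm] using this
  refine AnalyticAt.fun_comp (f := fun q : ℂ × (Fin n → ℂ) =>
    (1 - q.1, chartFormC i A q.2 / chartFormC i R q.2)) (analyticAt_hurwitzTail ?_ ?_) ?_
  · simp only [sub_re, one_re]
    linarith [hs.2]
  · simp only [chartFormC_ofReal]
    rw [← ofReal_div, ofReal_re]
    have := div_nonneg h0 hr.le
    linarith
  · refine (analyticAt_const.sub analyticAt_fst).prod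
      ((analyticAt_chartFormC i A _).div (analyticAt_chartFormC i R _) ?_)
    simp only [chartFormC_ofReal]
    exact_mod_cast hr.ne'

end Cone

end WittenZeta

end

noncomputable section

namespace WittenZeta

open Complex Set Metric MeasureTheory Filter Topology

/-- The expression of `periodicZeta` on a unit interval, up to the gamma factor. -/
def cellFun (odd : Bool) (s : ℂ) (x : ℝ) : ℂ :=
  s * (x : ℂ) ^ (s - 1) + paritySign odd * (s * ((1 - x : ℝ) : ℂ) ^ (s - 1)) -
    hurwitzTail (1 - s, x) - paritySign odd * hurwitzTail (1 - s, (1 - x : ℝ))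

lemma periodicZeta_eq_cellFun (odd : Bool) {s : ℂ} (hs : 1 < s.re) (hs2 : s.re < 2) {c : ℝ}
    {k : ℤ} (h1 : (k : ℝ) ≤ c) (h2 : c ≤ k + 1) :
    (s - 1) * s * periodicZeta odd s c = gammaFactor odd s * cellFun odd s (c - k) := by
  have := periodicZeta_eq odd hs hs2 (c := c - k) ⟨by linarith, by linarith⟩
  rw [← periodicZeta_add_int odd s (c - k) k, sub_add_cancel] at this
  exact this

variable {n : ℕ} {κ : Type*} [Fintype κ]

/-- The integrand of the torus integral, cleared of denominators. -/
def torusIntegrand (p : κ → Bool) (f : κ → (Fin n → ℝ) →ₗ[ℝ] ℝ) (s : ℂ) (t : Fin n → ℝ) : ℂ :=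
  ∏ k, ((s - 1) * s * periodicZeta (p k) s (f k t))

open Classical in
/-- The extension of `torusIntegrand` to the cone over the unit cube. -/
def coneIntegrand (p : κ → Bool) (f : κ → (Fin n → ℝ) →ₗ[ℝ] ℝ) (s : ℂ) (w : (Fin n → ℝ) × ℝ) : ℂ :=
  if ∀ i, 0 ≤ w.1 i ∧ w.1 i ≤ w.2 then
    ((w.2 : ℂ) ^ n)⁻¹ * torusIntegrand p f s (w.2⁻¹ • w.1) * cexp (-w.2) else 0

/-- The integral over the cone with generators `w` continues meromorphically. -/
def ConeContinuation (K : ℕ) (p : κ → Bool) (f : κ → (Fin n → ℝ) →ₗ[ℝ] ℝ)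
    (w : Fin (n + 1) → (Fin n → ℝ) × ℝ) : Prop :=
  ∃ J, HasContinuation K n J ∧ ∀ s : ℂ, 1 < s.re → s.re < 2 →
    ∫ x in orthant (Fin (n + 1)), coneIntegrand p f s (∑ l, x l • w l) =
      (∏ k, gammaFactor (p k) s) * J s

lemma isFactor_cellFun_terms (K : ℕ) (odd : Bool) (i : Fin (n + 1)) {A B R : Fin (n + 1) → ℝ}
    (hA : ∀ l, 0 ≤ A l) (hB : ∀ l, 0 ≤ B l) (hR : ∀ l, 0 < R l) (hAB : ∀ l, A l + B l = R l) :
    ∃ g : Fin 3 → ℂ → (Fin n → ℝ) → ℂ, (∀ c, IsFactor K (g c)) ∧ ∀ s, ∀ u ∈ unitCube (Fin n),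
      cellFun odd s (chartForm i A u / chartForm i R u) = ∑ c, g c s u := by
  refine ⟨![fun s u => 1 * (s * ((chartForm i A u / chartForm i R u : ℝ) : ℂ) ^ (s - 1)),
    fun s u => paritySign odd * (s * ((chartForm i B u / chartForm i R u : ℝ) : ℂ) ^ (s - 1)),
    fun s u => -hurwitzTail (1 - s, chartFormC i A (fun j => (u j : ℂ)) /
        chartFormC i R (fun j => (u j : ℂ))) - paritySign odd * hurwitzTail (1 - s,
        chartFormC i B (fun j => (u j : ℂ)) / chartFormC i R (fun j => (u j : ℂ)))], ?_, ?_⟩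
  · intro c
    fin_cases c
    · exact isFactor_ratio_cpow K i hA hR 1
    · exact isFactor_ratio_cpow K i hB hR _
    · refine ⟨fun q => -hurwitzTail (1 - q.1, chartFormC i A q.2 / chartFormC i R q.2) -
        paritySign odd * hurwitzTail (1 - q.1, chartFormC i B q.2 / chartFormC i R q.2),
        fun s hs u hu => ?_, Or.inl fun s _ _ u _ => rfl⟩
      exact (analyticOnCube_tail_ratio K i hA hR s hs u hu).neg.sub
        (analyticAt_const.mul (analyticOnCube_tail_ratio K i hB hR s hs u hu))
  · intro s u hu
    have hu' : ∀ j, u j ∈ Icc (0 : ℝ) 1 := fun j => ⟨(hu j).1.le, (hu j).2.le⟩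
    have hr := chartForm_pos (i := i) hR hu'
    have hsum : chartForm i A u + chartForm i B u = chartForm i R u := by
      simp only [chartForm, ← hAB, add_mul, Finset.sum_add_distrib]
      ring
    have h1 : 1 - chartForm i A u / chartForm i R u = chartForm i B u / chartForm i R u := by
      rw [← hsum] at hr ⊢
      field_simp
      ring
    rw [Fin.sum_univ_three, cellFun, h1]
    simp only [Matrix.cons_val_zero, Matrix.cons_val_one, Matrix.cons_val, chartFormC_ofReal,
      ofReal_div]
    ring

lemma coneContinuation_of_coherent (K : ℕ) (p : κ → Bool) (f : κ → (Fin n → ℝ) →ₗ[ℝ] ℝ)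
    {w : Fin (n + 1) → (Fin n → ℝ) × ℝ} (ht0 : ∀ l i, 0 ≤ (w l).1 i) (hr : ∀ l, 0 < (w l).2)
    (ht1 : ∀ l i, (w l).1 i ≤ (w l).2)
    (hz : ∀ k, ∃ z : ℤ, ∀ l, z * (w l).2 ≤ f k (w l).1 ∧ f k (w l).1 ≤ (z + 1) * (w l).2)
    (hint : ∀ s : ℂ, 1 < s.re → s.re < 2 →
      IntegrableOn (fun x => coneIntegrand p f s (∑ l, x l • w l)) (orthant (Fin (n + 1)))) :
    ConeContinuation K p f w := by
  choose z hz using hz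
  let R : Fin (n + 1) → ℝ := fun l => (w l).2
  let A : κ → Fin (n + 1) → ℝ := fun k l => f k (w l).1 - z k * (w l).2
  let B : κ → Fin (n + 1) → ℝ := fun k l => (z k + 1) * (w l).2 - f k (w l).1
  have hA : ∀ k l, 0 ≤ A k l := fun k l => sub_nonneg.mpr (hz k l).1
  have hB : ∀ k l, 0 ≤ B k l := fun k l => sub_nonneg.mpr (hz k l).2
  have hAB : ∀ k l, A k l + B k l = R l := fun k l => by simp only [A, B, R]; ring
  choose g hg hgeq using fun (i : Fin (n + 1)) (k : κ) =>
    isFactor_cellFun_terms K (p k) i (hA k) (hB k) hr (hAB k)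
  have hΨ : ∀ i, AnalyticOnCube K (fun q : ℂ × (Fin n → ℂ) =>
      chartFormC i R q.2 ^ (-((n + 1 : ℕ) : ℂ))) := fun i =>
    analyticOnCube_chartForm_cpow K i hr (e := fun _ => -((n + 1 : ℕ) : ℂ))
      fun _ => analyticAt_const
  refine ⟨_, HasContinuation.sum (T := Finset.univ) fun i _ =>
    hasContinuation_integral_sum_factors (hg i) (hΨ i), fun s h1 h2 => ?_⟩
  rw [integral_orthant_eq_sum (hint s h1 h2), Finset.mul_sum]
  refine Finset.sum_congr rfl fun i _ => ?_
  rw [← integral_const_mul]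
  refine setIntegral_congr_fun (measurableSet_unitCube _) fun u hu => ?_
  have hu' : ∀ j, u j ∈ Icc (0 : ℝ) 1 := fun j => ⟨(hu j).1.le, (hu j).2.le⟩
  set v : Fin (n + 1) → ℝ := i.insertNth 1 u with hv
  have hv0 : ∀ l, 0 ≤ v l := fun l => by
    refine i.succAboveCases ?_ (fun k => ?_) l
    · simp [hv]
    · simpa [hv] using (hu k).1.le
  set w₀ := ∑ l, v l • w l with hw₀
  have e1 : w₀.1 = ∑ l, v l • (w l).1 := by
    simp [hw₀, Prod.fst_sum]
  have e2 : w₀.2 = chartForm i R u := by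
    rw [← sum_insertNth_mul]
    simp [hw₀, hv, Prod.snd_sum, R]
  have hr0 : 0 < w₀.2 := e2 ▸ chartForm_pos hr hu'
  have e3 : ∀ k, f k w₀.1 = chartForm i (fun l => f k (w l).1) u := fun k => by
    rw [← sum_insertNth_mul, e1, map_sum]
    simp [hv]
  have hcond : ∀ i, 0 ≤ w₀.1 i ∧ w₀.1 i ≤ w₀.2 := by
    intro i
    have e4 : w₀.1 i = ∑ l, v l * (w l).1 i := by simp [e1]
    have e5 : w₀.2 = ∑ l, v l * (w l).2 := by simp [hw₀, Prod.snd_sum]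
    rw [e4, e5]
    exact ⟨Finset.sum_nonneg fun l _ => mul_nonneg (hv0 l) (ht0 l i),
      Finset.sum_le_sum fun l _ => mul_le_mul_of_nonneg_left (ht1 l i) (hv0 l)⟩
  have hy : ∀ y ∈ Ioi (0 : ℝ), (y : ℂ) ^ n * coneIntegrand p f s (∑ l, (y • v) l • w l) =
      ((w₀.2 : ℂ) ^ n)⁻¹ * torusIntegrand p f s (w₀.2⁻¹ • w₀.1) * cexp (-w₀.2 * y) := by
    intro y hy
    have hy0 : 0 < y := hy
    have e6 : ∑ l, (y • v) l • w l = y • w₀ := by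
      simp only [hw₀, Finset.smul_sum, Pi.smul_apply, smul_eq_mul, mul_smul]
    have hc : ∀ i, 0 ≤ (y • w₀).1 i ∧ (y • w₀).1 i ≤ (y • w₀).2 := fun i => by
      simp only [Prod.smul_fst, Prod.smul_snd, Pi.smul_apply, smul_eq_mul]
      exact ⟨mul_nonneg hy0.le (hcond i).1, mul_le_mul_of_nonneg_left (hcond i).2 hy0.le⟩
    have e7 : (y • w₀).2⁻¹ • (y • w₀).1 = w₀.2⁻¹ • w₀.1 := by
      simp only [Prod.smul_fst, Prod.smul_snd, smul_eq_mul, smul_smul]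
      congr 1
      field_simp
    rw [e6, coneIntegrand, if_pos hc, e7]
    simp only [Prod.smul_snd, smul_eq_mul, ofReal_mul, mul_pow]
    have hy0' : (y : ℂ) ≠ 0 := by exact_mod_cast hy0.ne'
    have : -((y : ℂ) * (w₀.2 : ℂ)) = -(w₀.2 : ℂ) * y := by ring
    rw [this, mul_inv]
    field_simp
  rw [setIntegral_congr_fun measurableSet_Ioi hy, integral_const_mul,
    integral_exp_mul_complex_Ioi (by simpa using hr0)]
  have hr0' : (w₀.2 : ℂ) ≠ 0 := by exact_mod_cast hr0.ne'
  have hprod : torusIntegrand p f s (w₀.2⁻¹ • w₀.1) =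
      (∏ k, gammaFactor (p k) s) * ∏ k, ∑ c, g i k c s u := by
    rw [torusIntegrand, ← Finset.prod_mul_distrib]
    refine Finset.prod_congr rfl fun k _ => ?_
    have e8 : f k (w₀.2⁻¹ • w₀.1) - z k = chartForm i (A k) u / chartForm i R u := by
      rw [map_smul, smul_eq_mul, e3]
      have e9 : chartForm i (A k) u = chartForm i (fun l => f k (w l).1) u -
          z k * chartForm i R u := by
        simp only [chartForm, A, R, sub_mul, Finset.sum_sub_distrib, mul_add, Finset.mul_sum,
          mul_assoc]
        ring
      rw [e9, e2]
      have : 0 < chartForm i R u := chartForm_pos (i := i) hr hu'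
      field_simp
    have hz1 := chartForm_mono (i := i) (A := 0) (hA k) hu'
    have hz2 := chartForm_mono (i := i) (A := A k) (B := R)
      (fun l => by linarith [hAB k l, hB k l]) hu'
    have hz0 : chartForm i (0 : Fin (n + 1) → ℝ) u = 0 := by simp [chartForm]
    rw [hz0] at hz1
    have hRpos := chartForm_pos (i := i) hr hu'
    have h8a : 0 ≤ f k (w₀.2⁻¹ • w₀.1) - z k := e8 ▸ div_nonneg hz1 hRpos.le
    have h8b : f k (w₀.2⁻¹ • w₀.1) - z k ≤ 1 := e8 ▸ (div_le_one hRpos).mpr hz2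
    rw [periodicZeta_eq_cellFun (p k) h1 h2 (k := z k) (by linarith) (by linarith), e8,
      hgeq i k s u hu]
  rw [hprod, chartFormC_ofReal, ← e2, cpow_neg, cpow_natCast, pow_succ]
  simp only [ofReal_zero, mul_zero, Complex.exp_zero]
  field_simp

lemma exists_bound_linearForm (f : κ → (Fin n → ℝ) →ₗ[ℝ] ℝ) :
    ∃ B : ℕ, ∀ k t, ∀ r : ℝ, (∀ i, 0 ≤ t i ∧ t i ≤ r) → 0 ≤ r → |f k t| ≤ B * r := by
  obtain ⟨B, hB⟩ := exists_nat_ge (∑ k, ∑ i, |f k (Pi.single i 1)|)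
  refine ⟨B, fun k t r ht hr => ?_⟩
  have h1 : f k t = ∑ i, t i * f k (Pi.single i 1) := by
    conv_lhs => rw [← Finset.univ_sum_single t, map_sum]
    refine Finset.sum_congr rfl fun i _ => ?_
    rw [← smul_eq_mul, ← map_smul, ← Pi.single_smul, smul_eq_mul, mul_one]
  rw [h1]
  calc |∑ i, t i * f k (Pi.single i 1)| ≤ ∑ i, |t i * f k (Pi.single i 1)| :=
        Finset.abs_sum_le_sum_abs _ _
    _ ≤ ∑ i, r * |f k (Pi.single i 1)| := by
        refine Finset.sum_le_sum fun i _ => ?_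
        rw [abs_mul, abs_of_nonneg (ht i).1]
        exact mul_le_mul_of_nonneg_right (ht i).2 (abs_nonneg _)
    _ = (∑ i, |f k (Pi.single i 1)|) * r := by rw [← Finset.mul_sum, mul_comm]
    _ ≤ B * r := by
        refine mul_le_mul_of_nonneg_right (le_trans ?_ hB) hr
        exact Finset.single_le_sum (f := fun k => ∑ i, |f k (Pi.single i 1)|)
          (fun k _ => Finset.sum_nonneg fun i _ => abs_nonneg _) (Finset.mem_univ k)

theorem coneContinuation (K : ℕ) (p : κ → Bool) (f : κ → (Fin n → ℝ) →ₗ[ℝ] ℝ)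
    (w : Fin (n + 1) → (Fin n → ℝ) × ℝ) (h0 : ∀ l i, 0 ≤ (w l).1 i) (hr : ∀ l, 0 ≤ (w l).2)
    (hpos : ∀ l, 0 < (w l).2 + ∑ i, (w l).1 i)
    (hint : ∀ s : ℂ, 1 < s.re → s.re < 2 →
      IntegrableOn (fun x => coneIntegrand p f s (∑ l, x l • w l)) (orthant (Fin (n + 1)))) :
    ConeContinuation K p f w := by
  obtain ⟨B, hB⟩ := exists_bound_linearForm f
  let form : (Fin n) ⊕ (κ × ℤ) → ((Fin n → ℝ) × ℝ) →ₗ[ℝ] ℝ := Sum.elim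
    (fun i => LinearMap.snd ℝ _ _ - (LinearMap.proj i).comp (LinearMap.fst ℝ _ _))
    (fun q => (f q.1).comp (LinearMap.fst ℝ _ _) - (q.2 : ℝ) • LinearMap.snd ℝ _ _)
  have H := cone_induction (m := n + 1) form (P := fun w => (∀ l i, 0 ≤ (w l).1 i) →
    (∀ l, 0 ≤ (w l).2) → (∀ l, 0 < (w l).2 + ∑ i, (w l).1 i) →
    (∀ s : ℂ, 1 < s.re → s.re < 2 →
      IntegrableOn (fun x => coneIntegrand p f s (∑ l, x l • w l)) (orthant (Fin (n + 1)))) →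
    ConeContinuation K p f w) ?_
    (Finset.univ.disjSum (Finset.univ ×ˢ Finset.Icc (-(B : ℤ)) (B + 1))) ?_ w
  · exact H h0 hr hpos hint
  · intro w i j c hij hc P1 P2 h0 hr hpos hint
    have shear_inv : ∀ (i j : Fin (n + 1)) (c : ℝ), 0 ≤ c →
        (∀ l i', 0 ≤ (shear w i j c l).1 i') ∧ (∀ l, 0 ≤ (shear w i j c l).2) ∧
        (∀ l, 0 < (shear w i j c l).2 + ∑ i', (shear w i j c l).1 i') := by
      intro i j c hc
      refine ⟨fun l i' => ?_, fun l => ?_, fun l => ?_⟩ <;>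
      by_cases hl : l = j
      · subst hl
        simpa [shear] using add_nonneg (h0 l i') (mul_nonneg hc (h0 i i'))
      · simpa [shear, hl] using h0 l i'
      · subst hl
        simpa [shear] using add_nonneg (hr l) (mul_nonneg hc (hr i))
      · simpa [shear, hl] using hr l
      · subst hl
        have a1 := hpos l
        have a2 := mul_nonneg hc (hpos i).le
        simp only [shear, Function.update_self, Prod.snd_add, Prod.smul_snd, Prod.fst_add,
          Prod.smul_fst, Pi.add_apply, Pi.smul_apply, smul_eq_mul, Finset.sum_add_distrib,
          ← Finset.mul_sum]
        linarith
      · simpa [shear, hl] using hpos l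
    have hsh := fun s (h1 : 1 < s.re) (h2 : s.re < 2) => integral_orthant_shear hij hc (hint s h1 h2)
    simp only [Function.comp_def, ← sum_shear w hij, ← sum_shear w hij.symm] at hsh
    obtain ⟨a1, a2, a3⟩ := shear_inv i j c hc.le
    obtain ⟨b1, b2, b3⟩ := shear_inv j i c⁻¹ (inv_pos.mpr hc).le
    obtain ⟨J1, hJ1, e1⟩ := P1 a1 a2 a3 fun s h1 h2 => (hsh s h1 h2).1
    obtain ⟨J2, hJ2, e2⟩ := P2 b1 b2 b3 fun s h1 h2 => (hsh s h1 h2).2.1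
    refine ⟨_, hJ1.add hJ2, fun s h1 h2 => ?_⟩
    rw [(hsh s h1 h2).2.2, e1 s h1 h2, e2 s h1 h2]
    ring
  · intro w hcoh h0 hr hpos hint
    have c1 : ∀ i, Coherent w (form (Sum.inl i)) := fun i => hcoh _ (by simp)
    have c2 : ∀ k, ∀ z ∈ Finset.Icc (-(B : ℤ)) (B + 1), Coherent w (form (Sum.inr (k, z))) :=
      fun k z hz => hcoh _ (by simpa using hz)
    by_cases hkeep : ∀ l i, (w l).1 i ≤ (w l).2
    · have hr' : ∀ l, 0 < (w l).2 := by
        intro l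
        refine lt_of_le_of_ne (hr l) fun h => ?_
        have : ∀ i, (w l).1 i = 0 := fun i => le_antisymm (h ▸ hkeep l i) (h0 l i)
        have h3 := hpos l
        simp [this, ← h] at h3
      refine coneContinuation_of_coherent K p f h0 hr' hkeep (fun k => ?_) hint
      have hbd : ∀ l, |f k (w l).1| ≤ B * (w l).2 := fun l =>
        hB k _ _ (fun i => ⟨h0 l i, hkeep l i⟩) (hr l)
      let good : ℤ → Prop := fun z => ∀ l, z * (w l).2 ≤ f k (w l).1
      have hgood0 : good (-(B : ℤ)) := fun l => by
        have := (abs_le.mp (hbd l)).1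
        push_cast
        linarith
      have hgoodB : ∀ z, good z → z ≤ B := by
        intro z hz
        by_contra h
        have h4 : (B : ℝ) + 1 ≤ z := by exact_mod_cast (by omega : (B : ℤ) + 1 ≤ z)
        have h5 := hz 0
        have h6 := (abs_le.mp (hbd 0)).2
        nlinarith [hr' 0]
      obtain ⟨z, hz, hmax⟩ := Int.exists_greatest_of_bdd (P := good) ⟨B, hgoodB⟩ ⟨_, hgood0⟩
      have hzB := hgoodB z hz
      have hzl := hmax _ hgood0
      refine ⟨z, fun l => ⟨hz l, ?_⟩⟩
      have h7 := (c2 k (z + 1) (by simp; omega)).resolve_left (fun h => by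
        have : good (z + 1) := fun l => by
          have := h l
          simp only [form, Sum.elim_inr, LinearMap.sub_apply, LinearMap.comp_apply,
            LinearMap.fst_apply, LinearMap.smul_apply, LinearMap.snd_apply, smul_eq_mul] at this
          linarith
        have := hmax _ this
        omega) l
      simp only [form, Sum.elim_inr, LinearMap.sub_apply, LinearMap.comp_apply,
        LinearMap.fst_apply, LinearMap.smul_apply, LinearMap.snd_apply, smul_eq_mul] at h7
      push_cast at h7
      linarith
    · simp only [not_forall, not_le] at hkeep
      obtain ⟨l₀, i, hli⟩ := hkeep
      have hneg : ∀ l, (w l).2 ≤ (w l).1 i := by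
        have := (c1 i).resolve_left (fun h => by
          have := h l₀
          simp [form] at this
          linarith)
        intro l
        simpa [form] using this l
      refine ⟨fun _ => 0, HasContinuation.zero, fun s h1 h2 => ?_⟩
      rw [mul_zero]
      refine (setIntegral_congr_fun (measurableSet_orthant _) fun x hx => ?_).trans
        (integral_zero _ _)
      refine if_neg fun h => ?_
      have h8 := (h i).2
      simp only [Prod.fst_sum, Prod.snd_sum, Finset.sum_apply, Prod.smul_fst, Prod.smul_snd,
        Pi.smul_apply, smul_eq_mul] at h8
      refine absurd h8 (not_le.mpr (Finset.sum_lt_sum (fun l _ =>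
        mul_le_mul_of_nonneg_left (hneg l) (hx l).le) ⟨l₀, Finset.mem_univ _,
          mul_lt_mul_of_pos_left hli (hx l₀)⟩))

end WittenZeta

end

noncomputable section

namespace WittenZeta

open Complex Set Metric MeasureTheory Filter Topology

variable {n : ℕ} {κ : Type*} [Fintype κ]

lemma continuous_torusIntegrand (p : κ → Bool) (f : κ → (Fin n → ℝ) →ₗ[ℝ] ℝ) {s : ℂ}
    (hs : 1 < s.re) : Continuous (torusIntegrand p f s) :=
  continuous_finsetProd _ fun k _ => continuous_const.mul
    ((continuous_periodicZeta (p k) hs).comp (f k).continuous_of_finiteDimensional)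

lemma measurable_coneIntegrand (p : κ → Bool) (f : κ → (Fin n → ℝ) →ₗ[ℝ] ℝ) {s : ℂ}
    (hs : 1 < s.re) : Measurable (coneIntegrand p f s) := by
  unfold coneIntegrand
  refine Measurable.ite ?_ ?_ measurable_const
  · have : {w : (Fin n → ℝ) × ℝ | ∀ i, 0 ≤ w.1 i ∧ w.1 i ≤ w.2} =
        ⋂ i, {w | 0 ≤ w.1 i} ∩ {w | w.1 i ≤ w.2} := by
      ext; simp
    rw [this]
    exact MeasurableSet.iInter fun i => (measurableSet_le (by fun_prop) (by fun_prop)).inter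
      (measurableSet_le (by fun_prop) (by fun_prop))
  · have h := (continuous_torusIntegrand p f hs).measurable.comp
      (f := fun w : (Fin n → ℝ) × ℝ => w.2⁻¹ • w.1) (by fun_prop)
    simp only [Function.comp_def] at h
    refine (Measurable.mul ?_ h).mul ?_
    · fun_prop
    · fun_prop

/-- Generators of the standard orthant in `ℝ^n × ℝ`, the last coordinate listed first. -/
def stdGenerators (n : ℕ) : Fin (n + 1) → (Fin n → ℝ) × ℝ :=
  Fin.cons (0, 1) fun i => (Pi.single i 1, 0)

lemma sum_smul_stdGenerators (x : Fin (n + 1) → ℝ) :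
    ∑ l, x l • stdGenerators n l = (fun i => x i.succ, x 0) := by
  rw [Fin.sum_univ_succ]
  ext1
  · simp only [stdGenerators, Fin.cons_zero, Fin.cons_succ, Prod.fst_add, Prod.smul_fst, smul_zero,
      zero_add, Prod.fst_sum]
    ext i
    simp [Finset.sum_apply, Pi.single_apply]
  · simp [stdGenerators, Prod.snd_sum]

lemma coneIntegrand_zero_chart (p : κ → Bool) (f : κ → (Fin n → ℝ) →ₗ[ℝ] ℝ) (s : ℂ) {y : ℝ}
    (hy : 0 < y) {u : Fin n → ℝ} (hu : u ∈ unitCube (Fin n)) :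
    coneIntegrand p f s (∑ l, (y • ((0 : Fin (n + 1)).insertNth 1 u : Fin (n + 1) → ℝ)) l •
      stdGenerators n l) = ((y : ℂ) ^ n)⁻¹ * cexp (-y) * torusIntegrand p f s u := by
  rw [sum_smul_stdGenerators, Fin.insertNth_zero']
  simp only [Pi.smul_apply, Fin.cons_zero, Fin.cons_succ, smul_eq_mul, mul_one]
  rw [coneIntegrand, if_pos fun i => ⟨mul_nonneg hy.le (hu i).1.le,
    mul_le_of_le_one_right hy.le (hu i).2.le⟩]
  have : y⁻¹ • (fun i => y * u i) = u := by
    ext i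
    simp [hy.ne']
  rw [this]
  ring

lemma coneIntegrand_succ_chart (p : κ → Bool) (f : κ → (Fin n → ℝ) →ₗ[ℝ] ℝ) (s : ℂ) {y : ℝ}
    (hy : 0 < y) {u : Fin n → ℝ} (hu : u ∈ unitCube (Fin n)) {i : Fin (n + 1)} (hi : i ≠ 0) :
    coneIntegrand p f s (∑ l, (y • (i.insertNth 1 u : Fin (n + 1) → ℝ)) l •
      stdGenerators n l) = 0 := by
  rw [sum_smul_stdGenerators]
  obtain ⟨j, rfl⟩ := Fin.exists_succ_eq.mpr hi
  refine if_neg fun h => ?_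
  have h1 := (h j).2
  obtain ⟨k, hk⟩ := Fin.exists_succAbove_eq hi.symm
  simp only [Pi.smul_apply, Fin.insertNth_apply_same, smul_eq_mul, mul_one] at h1
  rw [← hk, Fin.insertNth_apply_succAbove] at h1
  nlinarith [(hu k).2]

lemma ae_polarMeasure (n : ℕ) : ∀ᵐ q ∂polarMeasure n, 0 < q.1 ∧ q.2 ∈ unitCube (Fin n) := by
  have h1 : ∀ᵐ y ∂((volume.restrict (Ioi (0 : ℝ))).withDensity fun y => ENNReal.ofReal (y ^ n)),
      0 < y := (withDensity_absolutelyContinuous _ _).ae_le (ae_restrict_mem measurableSet_Ioi)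
  have h2 : ∀ᵐ u ∂(volume.restrict (unitCube (Fin n))), u ∈ unitCube (Fin n) :=
    ae_restrict_mem (measurableSet_unitCube _)
  exact (Measure.quasiMeasurePreserving_fst.ae h1).and (Measure.quasiMeasurePreserving_snd.ae h2)

lemma integrable_exp_density (n : ℕ) : Integrable (fun y : ℝ => ((y : ℂ) ^ n)⁻¹ * cexp (-y))
    ((volume.restrict (Ioi (0 : ℝ))).withDensity fun y => ENNReal.ofReal (y ^ n)) := by
  rw [integrable_withDensity_iff_integrable_smul' (by fun_prop) (by simp)]
  have h := integrableOn_exp_mul_complex_Ioi (a := -1) (by simp) 0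
  refine h.congr_fun (fun y hy => ?_) measurableSet_Ioi
  have hy0 : 0 < y := hy
  have hy' : (y : ℂ) ^ n ≠ 0 := pow_ne_zero _ (by exact_mod_cast hy0.ne')
  simp only
  rw [ENNReal.toReal_ofReal (pow_nonneg hy0.le n), Complex.real_smul, ofReal_pow,
    mul_inv_cancel_left₀ hy']
  ring_nf

lemma integrableOn_coneIntegrand (p : κ → Bool) (f : κ → (Fin n → ℝ) →ₗ[ℝ] ℝ) {s : ℂ}
    (hs : 1 < s.re) : IntegrableOn (fun x => coneIntegrand p f s (∑ l, x l • stdGenerators n l))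
      (orthant (Fin (n + 1))) := by
  have hm : Measurable fun x : Fin (n + 1) → ℝ =>
      coneIntegrand p f s (∑ l, x l • stdGenerators n l) :=
    (measurable_coneIntegrand p f hs).comp (by
      simp only [sum_smul_stdGenerators]
      fun_prop)
  rw [IntegrableOn, restrict_orthant_eq_sum, integrable_finsetSum_measure]
  intro i _
  rw [integrable_map_measure hm.aestronglyMeasurable (continuous_polarChart i).aemeasurable]
  by_cases hi : i = 0
  · subst hi
    have h1 : Integrable (torusIntegrand p f s) (volume.restrict (unitCube (Fin n))) := by
      refine ((continuous_torusIntegrand p f hs).continuousOn.integrableOn_compact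
        (isCompact_univ_pi fun _ => isCompact_Icc) (K := Set.pi univ fun _ => Icc 0 1)).mono_set ?_
      rw [unitCube_eq_pi]
      exact Set.pi_mono fun _ _ => Ioo_subset_Icc_self
    refine ((integrable_exp_density n).mul_prod h1).congr ?_
    filter_upwards [ae_polarMeasure n] with q hq
    exact (coneIntegrand_zero_chart p f s hq.1 hq.2).symm
  · refine (integrable_zero _ _ _).congr ?_
    filter_upwards [ae_polarMeasure n] with q hq
    exact (coneIntegrand_succ_chart p f s hq.1 hq.2 hi).symm

/-- The torus integral of a product of periodic zeta functions continues meromorphically, with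
poles of order at most the dimension, up to the gamma factors. -/
theorem torusContinuation (K : ℕ) (p : κ → Bool) (f : κ → (Fin n → ℝ) →ₗ[ℝ] ℝ) :
    ∃ J, HasContinuation K n J ∧ ∀ s : ℂ, 1 < s.re → s.re < 2 →
      ∫ t in unitCube (Fin n), torusIntegrand p f s t = (∏ k, gammaFactor (p k) s) * J s := by
  obtain ⟨J, hJ, h⟩ := coneContinuation K p f (stdGenerators n)
    (fun l i => by
      refine Fin.cases ?_ (fun j => ?_) l
      · simp [stdGenerators]
      · by_cases hij : i = j
        · simp [stdGenerators, hij]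
        · simp [stdGenerators, hij])
    (fun l => by refine Fin.cases ?_ (fun j => ?_) l <;> simp [stdGenerators])
    (fun l => by refine Fin.cases ?_ (fun j => ?_) l <;> simp [stdGenerators])
    (fun s h1 _ => integrableOn_coneIntegrand p f h1)
  refine ⟨J, hJ, fun s h1 h2 => ?_⟩
  rw [← h s h1 h2, integral_orthant_eq_sum (integrableOn_coneIntegrand p f h1),
    Finset.sum_eq_single (0 : Fin (n + 1))]
  · refine setIntegral_congr_fun (measurableSet_unitCube _) fun u hu => ?_
    have hy : ∀ y ∈ Ioi (0 : ℝ), (y : ℂ) ^ n * coneIntegrand p f s (∑ l,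
        (y • ((0 : Fin (n + 1)).insertNth 1 u : Fin (n + 1) → ℝ)) l • stdGenerators n l) =
        cexp (-1 * y) * torusIntegrand p f s u := by
      intro y hy
      have hy0 : 0 < y := hy
      have hy' : (y : ℂ) ^ n ≠ 0 := pow_ne_zero _ (by exact_mod_cast hy0.ne')
      rw [coneIntegrand_zero_chart p f s hy0 hu, ← mul_assoc, mul_inv_cancel_left₀ hy', neg_one_mul]
    rw [setIntegral_congr_fun measurableSet_Ioi hy, integral_mul_const,
      integral_exp_mul_complex_Ioi (by simp)]
    simp
  · intro i _ hi
    refine (setIntegral_congr_fun (measurableSet_unitCube _) fun u hu => ?_).trans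
      (integral_zero _ _)
    refine (setIntegral_congr_fun measurableSet_Ioi fun y hy => ?_).trans (integral_zero _ _)
    rw [coneIntegrand_succ_chart p f s hy hu hi, mul_zero]
  · simp

end WittenZeta

end

noncomputable section

namespace WittenZeta

open Complex Set Metric MeasureTheory Filter Topology

/-- The standard character of `ℝ / ℤ`. -/
def unitExp (x : ℝ) : ℂ := cexp (2 * Real.pi * I * x)

lemma unitExp_add (x y : ℝ) : unitExp (x + y) = unitExp x * unitExp y := by
  rw [unitExp, unitExp, unitExp, ← Complex.exp_add]
  congr 1
  push_cast
  ring

lemma unitExp_sum {κ : Type*} (T : Finset κ) (f : κ → ℝ) :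
    unitExp (∑ k ∈ T, f k) = ∏ k ∈ T, unitExp (f k) := by
  classical
  induction T using Finset.induction_on with
  | empty => simp [unitExp]
  | insert a T ha ih => rw [Finset.sum_insert ha, Finset.prod_insert ha, unitExp_add, ih]

lemma norm_unitExp (x : ℝ) : ‖unitExp x‖ = 1 := by
  rw [unitExp, show (2 * Real.pi * I * x : ℂ) = ((2 * Real.pi * x : ℝ) : ℂ) * I by
    push_cast; ring, norm_exp_ofReal_mul_I]

lemma continuous_unitExp : Continuous unitExp := by
  unfold unitExp; fun_prop

lemma integral_unitExp_int_mul (k : ℤ) :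
    ∫ t in Ioo (0 : ℝ) 1, unitExp (k * t) = if k = 0 then 1 else 0 := by
  rw [← integral_Ioc_eq_integral_Ioo, ← intervalIntegral.integral_of_le zero_le_one]
  by_cases hk : k = 0
  · simp [hk, unitExp]
  · rw [if_neg hk]
    have h2 : (2 * Real.pi * I * k : ℂ) ≠ 0 := by
      simp [Real.pi_ne_zero, hk]
    have h3 : ∀ t : ℝ, unitExp (k * t) = cexp (2 * Real.pi * I * k * t) := fun t => by
      rw [unitExp]
      push_cast
      ring_nf
    simp only [h3]
    rw [integral_exp_mul_complex h2]
    have : (2 * Real.pi * I * k : ℂ) * (1 : ℝ) = k * (2 * Real.pi * I) := by push_cast; ring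
    rw [this, Complex.exp_int_mul_two_pi_mul_I]
    simp

lemma hasSum_periodicZeta_unitExp (odd : Bool) {s : ℂ} (hs : 1 < s.re) (c : ℝ) :
    HasSum (fun v : ℤ => latticePow odd s v * unitExp (v * c)) (periodicZeta odd s c) := by
  refine (hasSum_periodicZeta odd hs c).congr_fun fun v => ?_
  rw [unitExp]
  push_cast
  ring_nf

instance isFiniteMeasure_restrict_Ioo_one : IsFiniteMeasure (volume.restrict (Ioo (0 : ℝ) 1)) :=
  ⟨by simp⟩

instance isFiniteMeasure_restrict_unitCube (n : ℕ) :
    IsFiniteMeasure (volume.restrict (unitCube (Fin n))) :=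
  ⟨by simp [volume_unitCube]⟩

lemma integral_periodicZeta_mul_unitExp (odd : Bool) {s : ℂ} (hs : 1 < s.re) (L : ℤ) :
    ∫ t in Ioo (0 : ℝ) 1, periodicZeta odd s t * unitExp (-(L * t)) = latticePow odd s L := by
  have h := hasSum_integral_of_dominated_convergence (μ := volume.restrict (Ioo (0 : ℝ) 1))
    (F := fun (v : ℤ) (t : ℝ) => latticePow odd s v * unitExp (v * t) * unitExp (-(L * t)))
    (f := fun t => periodicZeta odd s t * unitExp (-(L * t)))
    (fun v _ => ‖latticePow odd s v‖)
    (fun v => Continuous.aestronglyMeasurable (by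
      have := continuous_unitExp
      fun_prop))
    (fun v => Eventually.of_forall fun t => by simp [norm_unitExp])
    (Eventually.of_forall fun t => summable_norm_latticePow odd hs)
    (integrable_const _)
    (Eventually.of_forall fun t => (hasSum_periodicZeta_unitExp odd hs t).mul_right _)
  have h2 : ∀ v : ℤ, ∫ t in Ioo (0 : ℝ) 1,
      latticePow odd s v * unitExp (v * t) * unitExp (-(L * t)) =
      if v = L then latticePow odd s L else 0 := by
    intro v
    have : ∀ t : ℝ, latticePow odd s v * unitExp (v * t) * unitExp (-(L * t)) =
        latticePow odd s v * unitExp ((v - L : ℤ) * t) := by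
      intro t
      rw [mul_assoc, ← unitExp_add]
      congr 2
      push_cast
      ring
    simp only [this]
    rw [integral_const_mul, integral_unitExp_int_mul]
    by_cases hv : v = L
    · simp [hv]
    · simp [hv, sub_eq_zero]
  simp only [h2] at h
  exact h.unique (hasSum_ite_eq L _)

lemma summable_and_hasSum_prod {α : Type*} {n : ℕ} {f : Fin n → α → ℂ}
    (hf : ∀ i, Summable fun a => ‖f i a‖) :
    (Summable fun v : Fin n → α => ‖∏ i, f i (v i)‖) ∧
      HasSum (fun v : Fin n → α => ∏ i, f i (v i)) (∏ i, ∑' a, f i a) := by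
  induction n with
  | zero =>
    refine ⟨(hasSum_fintype _).summable, ?_⟩
    simp
  | succ n ih =>
    obtain ⟨h1, h2⟩ := ih (f := fun i => f i.succ) fun i => hf _
    obtain ⟨e, he⟩ : ∃ e : α × (Fin n → α) ≃ (Fin (n + 1) → α), ∀ q, e q = Fin.cons q.1 q.2 :=
      ⟨Fin.consEquiv fun _ => α, fun _ => rfl⟩
    have heq : ∀ q : α × (Fin n → α), ∏ i, f i (e q i) = f 0 q.1 * ∏ i, f (Fin.succ i) (q.2 i) := by
      rintro ⟨a, v⟩
      rw [he, Fin.prod_univ_succ]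
      simp
    have hf0 : HasSum (f 0) (∑' a, f 0 a) := (Summable.of_norm (hf 0)).hasSum
    have hn := Summable.mul_norm (f := f 0)
      (g := fun v : Fin n → α => ∏ i, f (Fin.succ i) (v i)) (hf 0) h1
    have hprod := Summable.of_norm hn
    have h3 := HasSum.mul hf0 h2 hprod
    constructor
    · refine (Equiv.summable_iff e (f := fun v : Fin (n + 1) → α => ‖∏ i, f i (v i)‖)).mp ?_
      simp only [Function.comp_def, heq]
      exact hn
    · refine (Equiv.hasSum_iff e (f := fun v : Fin (n + 1) → α => ∏ i, f i (v i))).mp ?_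
      simp only [Function.comp_def, heq]
      rw [Fin.prod_univ_succ]
      exact h3

variable {d r : ℕ}

/-- The linear form dual to the `i`-th coordinate in the torus integral. -/
def dualForm (A : Fin d → Fin r → ℤ) : Fin d ⊕ Fin r → (Fin d → ℝ) →ₗ[ℝ] ℝ :=
  Sum.elim (fun j => LinearMap.proj j) fun i => -∑ j, (A j i : ℝ) • LinearMap.proj j

/-- The lattice form attached to an index. -/
def latticeForm (A : Fin d → Fin r → ℤ) (v : Fin r → ℤ) : Fin d ⊕ Fin r → ℤ :=
  Sum.elim (fun j => ∑ i, A j i * v i) v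

/-- A lattice sum over the values of linear forms as an integral over a torus. -/
theorem hasSum_lattice_eq_integral (A : Fin d → Fin r → ℤ) (p : Fin d ⊕ Fin r → Bool) {s : ℂ}
    (hs : 1 < s.re) :
    HasSum (fun v : Fin r → ℤ => ∏ k, latticePow (p k) s (latticeForm A v k))
      (∫ t in unitCube (Fin d), ∏ k, periodicZeta (p k) s (dualForm A k t)) := by
  have hbound : ∀ k, ∃ C : ℝ, ∀ c, ‖periodicZeta (p k) s c‖ ≤ C := fun k => by
    refine ⟨∑' v : ℤ, ‖latticePow (p k) s v‖, fun c => ?_⟩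
    rw [← (hasSum_periodicZeta_unitExp (p k) hs c).tsum_eq]
    have : ∀ v : ℤ, ‖latticePow (p k) s v * unitExp (v * c)‖ = ‖latticePow (p k) s v‖ := fun v => by
      rw [norm_mul, norm_unitExp, mul_one]
    refine (norm_tsum_le_tsum_norm ?_).trans (le_of_eq (by simp only [this]))
    simpa only [this] using summable_norm_latticePow (p k) hs
  choose C hC using hbound
  have hcoef : ∀ v : Fin r → ℤ, ∏ k, latticePow (p k) s (latticeForm A v k) =
      ∫ t in unitCube (Fin d), (∏ j, periodicZeta (p (Sum.inl j)) s (t j)) *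
        ∏ i, (latticePow (p (Sum.inr i)) s (v i) * unitExp (v i * dualForm A (Sum.inr i) t)) := by
    intro v
    have h1 : ∀ t : Fin d → ℝ, (∏ j, periodicZeta (p (Sum.inl j)) s (t j)) *
        ∏ i, (latticePow (p (Sum.inr i)) s (v i) * unitExp (v i * dualForm A (Sum.inr i) t)) =
        (∏ i, latticePow (p (Sum.inr i)) s (v i)) * ∏ j, (periodicZeta (p (Sum.inl j)) s (t j) *
          unitExp (-((∑ i, A j i * v i : ℤ) * t j))) := by
      intro t
      rw [Finset.prod_mul_distrib, Finset.prod_mul_distrib, ← unitExp_sum, ← unitExp_sum]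
      have : ∑ i, (v i : ℝ) * dualForm A (Sum.inr i) t =
          ∑ j, -(((∑ i, A j i * v i : ℤ) : ℝ) * t j) := by
        simp only [dualForm, Sum.elim_inr, LinearMap.neg_apply, LinearMap.sum_apply,
          LinearMap.smul_apply, LinearMap.proj_apply, smul_eq_mul, mul_neg, Finset.mul_sum,
          Finset.sum_neg_distrib]
        push_cast
        simp only [Finset.sum_mul]
        rw [Finset.sum_comm]
        congr 1
        refine Finset.sum_congr rfl fun j _ => Finset.sum_congr rfl fun i _ => by ring
      rw [this]
      ring
    simp only [h1]
    rw [integral_const_mul, unitCube_eq_pi, volume_pi, Measure.restrict_pi_pi,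
      integral_fintype_prod_eq_prod (fun j x => periodicZeta (p (Sum.inl j)) s x *
          unitExp (-((∑ i, A j i * v i : ℤ) * x)))]
    rw [Fintype.prod_sum_type, mul_comm]
    congr 1
    refine Finset.prod_congr rfl fun j _ => ?_
    rw [integral_periodicZeta_mul_unitExp _ hs]
    rfl
  simp only [hcoef]
  have hsum := fun t : Fin d → ℝ => summable_and_hasSum_prod
    (f := fun i (a : ℤ) => latticePow (p (Sum.inr i)) s a * unitExp (a * dualForm A (Sum.inr i) t))
    (fun i => by
      simp only [norm_mul, norm_unitExp, mul_one]
      exact summable_norm_latticePow _ hs)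
  have hpcont : Continuous fun t : Fin d → ℝ => ∏ j, periodicZeta (p (Sum.inl j)) s (t j) :=
    continuous_finsetProd _ fun j _ => (continuous_periodicZeta _ hs).comp (continuous_apply j)
  refine hasSum_integral_of_dominated_convergence
    (fun v _ => (∏ j, C (Sum.inl j)) * ‖∏ i, latticePow (p (Sum.inr i)) s (v i)‖) ?_ ?_ ?_ ?_ ?_
  · intro v
    refine (hpcont.mul (continuous_finsetProd _ fun i _ => continuous_const.mul
      (continuous_unitExp.comp (continuous_const.mul ?_)))).aestronglyMeasurable
    exact (dualForm A (Sum.inr i)).continuous_of_finiteDimensional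
  · refine fun v => Eventually.of_forall fun t => ?_
    rw [norm_mul, Finset.prod_mul_distrib, norm_mul, ← unitExp_sum, norm_unitExp, mul_one]
    refine mul_le_mul_of_nonneg_right ?_ (norm_nonneg _)
    rw [norm_prod]
    exact Finset.prod_le_prod (fun _ _ => norm_nonneg _) fun j _ => hC _ _
  · refine Eventually.of_forall fun t => ?_
    have := (hsum 0).1
    simp only [map_zero, mul_zero] at this
    have h0 : unitExp 0 = 1 := by simp [unitExp]
    simp only [h0, mul_one] at this
    exact this.mul_left _
  · exact integrable_const _
  · refine Eventually.of_forall fun t => ?_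
    rw [Fintype.prod_sum_type]
    refine HasSum.mul_left _ ?_
    have := (hsum t).2
    simp only [(hasSum_periodicZeta_unitExp _ hs _).tsum_eq] at this
    exact this

end WittenZeta

end

noncomputable section

namespace WittenZeta

open Complex Set Metric MeasureTheory Filter Topology

lemma isConnected_strip (K : ℕ) : IsPreconnected (strip K) := by
  have h : strip K = re ⁻¹' Ioo (-(K : ℝ)) 2 := rfl
  rw [h]
  exact ((convex_Ioo (-(K : ℝ)) 2).linear_preimage reLm).isPreconnected

/-- Two meromorphic functions on a strip that agree on `1 < re s < 2` agree. -/
lemma eventuallyEq_of_strip {K : ℕ} {F G : ℂ → ℂ} (hF : MeromorphicOn F (strip K))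
    (hG : MeromorphicOn G (strip K)) (h : ∀ s : ℂ, 1 < s.re → s.re < 2 → F s = G s) {s : ℂ}
    (hs : s ∈ strip K) : F =ᶠ[𝓝[≠] s] G := by
  have hD : MeromorphicOn (F - G) (strip K) := fun z hz => (hF z hz).sub (hG z hz)
  have h0 : ((3 / 2 : ℝ) : ℂ) ∈ strip K :=
    mem_strip_of_one_lt (by rw [ofReal_re]; norm_num) (by rw [ofReal_re]; norm_num)
  have htop : meromorphicOrderAt (F - G) ((3 / 2 : ℝ) : ℂ) = ⊤ := by
    rw [meromorphicOrderAt_eq_top_iff]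
    refine Filter.Eventually.filter_mono nhdsWithin_le_nhds ?_
    have hopen : IsOpen {s : ℂ | 1 < s.re ∧ s.re < 2} :=
      (isOpen_lt continuous_const continuous_re).inter (isOpen_lt continuous_re continuous_const)
    filter_upwards [hopen.mem_nhds (show ((3 / 2 : ℝ) : ℂ) ∈ {s : ℂ | 1 < s.re ∧ s.re < 2} from
      ⟨by rw [ofReal_re]; norm_num, by rw [ofReal_re]; norm_num⟩)] with z hz
    simp [h z hz.1 hz.2]
  have hs' : meromorphicOrderAt (F - G) s = ⊤ := by
    by_contra hne
    exact hD.meromorphicOrderAt_ne_top_of_isPreconnected (isConnected_strip K) hs h0 hne htop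
  filter_upwards [meromorphicOrderAt_eq_top_iff.mp hs'] with z hz
  exact sub_eq_zero.mp hz

/-- A function holomorphic on `1 < re s` which continues meromorphically to all strips is the
restriction of a meromorphic function on the plane. -/
theorem exists_meromorphic_of_strips {D : ℂ → ℂ} (hD : ∀ s : ℂ, 1 < s.re → AnalyticAt ℂ D s)
    (h : ∀ K : ℕ, ∃ F, MeromorphicOn F (strip K) ∧ ∀ s : ℂ, 1 < s.re → s.re < 2 → F s = D s) :
    ∃ Z : ℂ → ℂ, Meromorphic Z ∧ ∀ s : ℂ, 1 < s.re → Z s = D s := by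
  classical
  choose F hF hFD using h
  let k : ℂ → ℕ := fun s => ⌈|s.re|⌉₊ + 1
  refine ⟨fun s => if 1 < s.re then D s else F (k s) s, fun s => ?_, fun s hs => if_pos hs⟩
  by_cases hs : 1 < s.re
  · refine (hD s hs).meromorphicAt.congr (Filter.Eventually.filter_mono nhdsWithin_le_nhds ?_)
    filter_upwards [(isOpen_lt continuous_const continuous_re).mem_nhds hs] with z hz
    exact (if_pos hz).symm
  · have hle : s.re ≤ 1 := not_lt.mp hs
    set K₀ := ⌈|s.re|⌉₊ + 3 with hK₀
    have habs : ∀ z : ℂ, |z.re| ≤ ⌈|z.re|⌉₊ := fun z => Nat.le_ceil _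
    have hs0 : s ∈ strip K₀ := by
      refine ⟨?_, by linarith⟩
      have := habs s
      have := neg_abs_le s.re
      rw [hK₀]; push_cast; linarith
    have hall : ∀ᶠ z in 𝓝[≠] s, ∀ K ∈ Finset.range (K₀ + 1), s ∈ strip K → F K z = F K₀ z := by
      rw [Filter.eventually_all_finset]
      intro K hK
      by_cases hsK : s ∈ strip K
      · have hsub : strip K ⊆ strip K₀ := fun z hz => ⟨by
          have : (K : ℝ) ≤ K₀ := by exact_mod_cast Nat.lt_succ_iff.mp (Finset.mem_range.mp hK)
          have := hz.1
          linarith, hz.2⟩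
        have := eventuallyEq_of_strip (hF K) (fun z hz => hF K₀ z (hsub hz))
          (fun z h1 h2 => (hFD K z h1 h2).trans (hFD K₀ z h1 h2).symm) hsK
        filter_upwards [this] with z hz _
        exact hz
      · exact Filter.Eventually.of_forall fun z h => absurd h hsK
    have hball : ∀ᶠ z in 𝓝[≠] s, |z.re - s.re| < 1 := by
      refine Filter.Eventually.filter_mono nhdsWithin_le_nhds ?_
      exact (isOpen_lt (continuous_abs.comp (continuous_re.sub continuous_const))
        continuous_const).mem_nhds (by simp)
    refine (hF K₀ s hs0).congr ?_
    filter_upwards [hall, hball] with z h1 h2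
    obtain ⟨h3, h4⟩ := abs_lt.mp h2
    by_cases hz : 1 < z.re
    · rw [if_pos hz]
      exact hFD K₀ z hz (by linarith)
    · rw [if_neg hz]
      refine (h1 (k z) (Finset.mem_range.mpr ?_) ⟨?_, by linarith⟩).symm
      · have h5 : |z.re| ≤ |s.re| + 1 := by
          have := abs_sub_abs_le_abs_sub z.re s.re
          linarith
        have h6 : ⌈|z.re|⌉₊ ≤ ⌈|s.re|⌉₊ + 1 := by
          rw [Nat.ceil_le]
          push_cast
          linarith [habs s]
        simp only [k, hK₀]
        omega
      · simp only [k]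
        push_cast
        have := habs z
        have := neg_abs_le z.re
        linarith

/-- `T`, given on `1 < re s < 2`, continues meromorphically to `strip K` with order at least `k`
at `-m`. -/
def ContinuesWithOrder (K : ℕ) (T : ℂ → ℂ) (m : ℕ) (k : ℤ) : Prop :=
  ∃ F : ℂ → ℂ, MeromorphicOn F (strip K) ∧ (k : WithTop ℤ) ≤ meromorphicOrderAt F (-(m : ℂ)) ∧
    ∀ s : ℂ, 1 < s.re → s.re < 2 → F s = T s

namespace ContinuesWithOrder

variable {K m : ℕ} {k : ℤ} {T T' : ℂ → ℂ}

lemma neg_mem_strip (hm : m < K) : -(m : ℂ) ∈ strip K := by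
  have h1 : (m : ℝ) < K := by exact_mod_cast hm
  have h2 : (0 : ℝ) ≤ m := Nat.cast_nonneg _
  refine ⟨?_, ?_⟩ <;> simp <;> linarith

lemma mono {k' : ℤ} (h : ContinuesWithOrder K T m k) (hk : k' ≤ k) :
    ContinuesWithOrder K T m k' := by
  obtain ⟨F, h1, h2, h3⟩ := h
  exact ⟨F, h1, le_trans (by exact_mod_cast hk) h2, h3⟩

lemma sum (hm : m < K) {κ : Type*} {S : Finset κ} {T : κ → ℂ → ℂ} (c : κ → ℂ)
    (h : ∀ i ∈ S, ContinuesWithOrder K (T i) m k) :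
    ContinuesWithOrder K (fun s => ∑ i ∈ S, c i * T i s) m k := by
  classical
  induction S using Finset.induction_on with
  | empty =>
    refine ⟨fun _ => 0, fun _ _ => analyticAt_const.meromorphicAt, ?_, fun s _ _ => by simp⟩
    rw [meromorphicOrderAt_eq_top_iff.mpr (Filter.Eventually.of_forall fun _ => rfl)]
    exact le_top
  | insert a S ha ih =>
    obtain ⟨F, h1, h2, h3⟩ := ih fun i hi => h i (Finset.mem_insert_of_mem hi)
    obtain ⟨G, g1, g2, g3⟩ := h a (Finset.mem_insert_self _ _)
    have hc : AnalyticAt ℂ (fun _ : ℂ => c a) (-(m : ℂ)) := analyticAt_const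
    have hmK := neg_mem_strip hm
    refine ⟨(fun _ => c a) * G + F, fun z hz => (analyticAt_const.meromorphicAt.mul (g1 z hz)).add
      (h1 z hz), ?_, fun s a1 a2 => ?_⟩
    · refine le_trans (le_min ?_ h2) (meromorphicOrderAt_add (hc.meromorphicAt.mul (g1 _ hmK))
        (h1 _ hmK))
      rw [meromorphicOrderAt_mul hc.meromorphicAt (g1 _ hmK)]
      exact le_add_of_nonneg_of_le hc.meromorphicOrderAt_nonneg g2
    · simp [Finset.sum_insert ha, h3 s a1 a2, g3 s a1 a2]

lemma congr (h : ContinuesWithOrder K T m k) (hT : ∀ s : ℂ, 1 < s.re → s.re < 2 → T s = T' s) :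
    ContinuesWithOrder K T' m k := by
  obtain ⟨F, h1, h2, h3⟩ := h
  exact ⟨F, h1, h2, fun s a b => (h3 s a b).trans (hT s a b)⟩

/-- The order of a meromorphic function on the plane, computed from a continuation of a multiple
by a nowhere vanishing entire function. -/
theorem le_order (hm : m < K) (h : ContinuesWithOrder K T m k) {Z c : ℂ → ℂ} (hZ : Meromorphic Z)
    (hc : ∀ s, AnalyticAt ℂ c s) (hc0 : ∀ s, c s ≠ 0)
    (hT : ∀ s : ℂ, 1 < s.re → s.re < 2 → T s = c s * Z s) :
    (k : WithTop ℤ) ≤ meromorphicOrderAt Z (-(m : ℂ)) := by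
  obtain ⟨F, h1, h2, h3⟩ := h
  have hcZ : MeromorphicOn (c * Z) (strip K) := fun z _ => (hc z).meromorphicAt.mul (hZ z)
  have := eventuallyEq_of_strip h1 hcZ (fun s a b => (h3 s a b).trans (hT s a b)) (neg_mem_strip hm)
  rw [meromorphicOrderAt_congr this, meromorphicOrderAt_mul_of_ne_zero (hc _) (hc0 _)] at h2
  exact h2

end ContinuesWithOrder

lemma one_le_order_of_zero {f : ℂ → ℂ} {s : ℂ} (hf : AnalyticAt ℂ f s) (h0 : f s = 0) :
    1 ≤ meromorphicOrderAt f s := by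
  rw [hf.meromorphicOrderAt_eq]
  have h1 := hf.analyticOrderAt_ne_zero.mpr h0
  cases hn : analyticOrderAt f s with
  | top => simp
  | coe n =>
    rw [hn] at h1
    rw [ENat.map_natCast]
    have : 1 ≤ n := Nat.one_le_iff_ne_zero.mpr fun h => h1 (by simp [h])
    exact_mod_cast this

variable {d r : ℕ}

/-- The sum over a lattice of a product of powers of absolute values of linear forms, twisted by
signs. -/
def latticeSum (A : Fin d → Fin r → ℤ) (p : Fin d ⊕ Fin r → Bool) (s : ℂ) : ℂ :=
  ∑' v : Fin r → ℤ, ∏ k, latticePow (p k) s (latticeForm A v k)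

open Classical in
/-- Meromorphic continuation of lattice sums, with a lower bound for the order at `-m`: each form
whose parity matches that of `m` contributes a zero, each dimension of the torus a pole. -/
theorem continuesWithOrder_latticeSum (A : Fin d → Fin r → ℤ) (p : Fin d ⊕ Fin r → Bool)
    {K m : ℕ} (hm : m < K) (hm0 : 0 < m) : ContinuesWithOrder K (latticeSum A p) m
      ((Finset.univ.filter fun k => (p k = true ↔ Odd m)).card - d) := by
  obtain ⟨J, ⟨F, hF, hFJ⟩, hJ⟩ := torusContinuation K p (dualForm A)
  let N := Fintype.card (Fin d ⊕ Fin r)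
  let P : ℂ → ℂ := fun s => ((s - 1) * s) ^ N
  have hP : ∀ s, AnalyticAt ℂ P s := fun s => by
    simp only [P]; fun_prop
  let γ : ℂ → ℂ := fun s => ∏ k, gammaFactor (p k) s
  have hγ : ∀ s ∈ strip K, AnalyticAt ℂ γ s := fun s hs =>
    Finset.analyticAt_fun_prod _ fun k _ => analyticAt_gammaFactor _ hs.2
  have hmK := ContinuesWithOrder.neg_mem_strip hm
  refine ⟨(P⁻¹ * γ) * F, fun z hz => ((hP z).meromorphicAt.inv.mul (hγ z hz).meromorphicAt).mul
    (hF z hz).1, ?_, fun s h1 h2 => ?_⟩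
  · have hP0 : P (-(m : ℂ)) ≠ 0 := by
      have h1 : -(m : ℂ) ≠ 0 := by simp; omega
      have h2 : -(m : ℂ) - 1 ≠ 0 := by
        intro h
        have : ((m + 1 : ℕ) : ℂ) = 0 := by push_cast; linear_combination -h
        exact absurd (Nat.cast_eq_zero.mp this) (by omega)
      exact pow_ne_zero _ (mul_ne_zero h2 h1)
    have hPi : AnalyticAt ℂ P⁻¹ (-(m : ℂ)) := (hP _).inv hP0
    rw [meromorphicOrderAt_mul (hPi.meromorphicAt.mul (hγ _ hmK).meromorphicAt) (hF _ hmK).1,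
      meromorphicOrderAt_mul hPi.meromorphicAt (hγ _ hmK).meromorphicAt]
    have ho : (((Finset.univ.filter fun k => (p k = true ↔ Odd m)).card : ℤ) : WithTop ℤ) ≤
        meromorphicOrderAt γ (-(m : ℂ)) := by
      have : meromorphicOrderAt γ (-(m : ℂ)) =
          ∑ k, meromorphicOrderAt (gammaFactor (p k)) (-(m : ℂ)) :=
        meromorphicOrderAt_fun_prod fun k _ => (analyticAt_gammaFactor _ hmK.2).meromorphicAt
      rw [this, Finset.card_filter]
      push_cast
      refine Finset.sum_le_sum fun k _ => ?_
      by_cases hk : p k = true ↔ Odd m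
      · rw [if_pos hk]
        exact one_le_order_of_zero (analyticAt_gammaFactor _ hmK.2) (gammaFactor_neg_nat_eq_zero _ hk)
      · rw [if_neg hk]
        exact (analyticAt_gammaFactor _ hmK.2).meromorphicOrderAt_nonneg
    rw [sub_eq_add_neg, WithTop.coe_add]
    exact add_le_add (le_add_of_nonneg_of_le hPi.meromorphicOrderAt_nonneg ho) (hF _ hmK).2
  · have hs0 : s ≠ 0 := fun h => by simp [h] at h1; linarith
    have hs1 : s - 1 ≠ 0 := fun h => by
      have := congrArg re h
      simp at this
      linarith
    have hP0 : P s ≠ 0 := pow_ne_zero _ (mul_ne_zero hs1 hs0)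
    have hint : ∫ t in unitCube (Fin d), torusIntegrand p (dualForm A) s t = P s *
        ∫ t in unitCube (Fin d), ∏ k, periodicZeta (p k) s (dualForm A k t) := by
      rw [← integral_const_mul]
      refine setIntegral_congr_fun (measurableSet_unitCube _) fun t _ => ?_
      simp only [torusIntegrand, P, N]
      rw [Finset.prod_mul_distrib, Finset.prod_const, Finset.card_univ]
    simp only [Pi.mul_apply, Pi.inv_apply]
    rw [hFJ s h1 h2, mul_assoc, ← hJ s h1 h2, hint, inv_mul_cancel_left₀ hP0, latticeSum,
      (hasSum_lattice_eq_integral A p h1).tsum_eq]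

end WittenZeta

end

noncomputable section

namespace WittenZeta

section RootSystem

set_option linter.unusedSectionVars false

variable {ι M N : Type*} [Fintype ι] [AddCommGroup M] [Module ℝ M] [AddCommGroup N] [Module ℝ N]
  {P : RootPairing ι ℝ M N}

/-- The index of the negative of a root. -/
def opp (P : RootPairing ι ℝ M N) (i : ι) : ι := P.reflectionPerm i i

@[simp] lemma root_opp (i : ι) : P.root (opp P i) = -P.root i := by
  simp [opp, P.root_reflectionPerm]

@[simp] lemma coroot_opp (i : ι) : P.coroot (opp P i) = -P.coroot i := by
  simp [opp, P.coroot_reflectionPerm]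

@[simp] lemma coroot'_opp (i : ι) (v : M) : P.coroot' (opp P i) v = -P.coroot' i v := by
  simp

lemma isPos_opp (b : P.Base) (i : ι) : b.IsPos (opp P i) ↔ ¬ b.IsPos i :=
  RootPairing.Base.IsPos.neg_iff_not b i

lemma reflectionPerm_opp (k i : ι) : P.reflectionPerm k (opp P i) = opp P (P.reflectionPerm k i) :=
  P.root.injective (by simp [P.root_reflectionPerm])

@[simp] lemma mem_positiveRoots (b : P.Base) {i : ι} : i ∈ positiveRoots b ↔ b.IsPos i := by
  simp [positiveRoots]

lemma coroot'_reflectionPerm_reflection (k i : ι) (v : M) :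
    P.coroot' (P.reflectionPerm k i) (P.reflection k v) = P.coroot' i v := by
  rw [P.coroot'_reflectionPerm]
  simp

variable [P.IsCrystallographic] [P.IsReduced] (b : P.Base)

lemma isPos_reflectionPerm_iff {j i : ι} (hj : j ∈ b.support) (h1 : i ≠ j) (h2 : i ≠ opp P j) :
    b.IsPos (P.reflectionPerm j i) ↔ b.IsPos i := by
  constructor
  · intro h
    have := h.reflectionPerm hj (fun e => h2 (by rw [← P.reflectionPerm_self j i, e]; rfl))
    simpa using this
  · intro h
    exact h.reflectionPerm hj h1

open Classical in
@[to_additive]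
lemma prod_positiveRoots_reflectionPerm {G : Type*} [CommMonoid G] {k : ι} (hk : k ∈ b.support)
    (h : ι → G) : ∏ i ∈ positiveRoots b, h (P.reflectionPerm k i) =
      h (opp P k) * ∏ i ∈ (positiveRoots b).erase k, h i := by
  have hkp : k ∈ positiveRoots b := by simpa using b.isPos_of_mem_support hk
  rw [← Finset.mul_prod_erase _ _ hkp]
  congr 1
  have hmaps : ∀ i ∈ (positiveRoots b).erase k,
      P.reflectionPerm k i ∈ (positiveRoots b).erase k := by
    intro i hi
    rw [Finset.mem_erase, mem_positiveRoots] at hi ⊢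
    refine ⟨fun e => ?_, hi.2.reflectionPerm hk hi.1⟩
    have : i = opp P k := by rw [← P.reflectionPerm_self k i, e]; rfl
    rw [this, isPos_opp] at hi
    exact hi.2 (b.isPos_of_mem_support hk)
  exact Finset.prod_nbij' (P.reflectionPerm k) (P.reflectionPerm k) hmaps hmaps
    (fun i _ => by simp) (fun i _ => by simp) (fun i _ => rfl)

/-- A function on the roots which is even has a product over the positive roots that is invariant
under simple reflections. -/
@[to_additive]
lemma prod_positiveRoots_reflectionPerm_of_even {G : Type*} [CommMonoid G] {k : ι}
    (hk : k ∈ b.support) (h : ι → G) (he : h (opp P k) = h k) :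
    ∏ i ∈ positiveRoots b, h (P.reflectionPerm k i) = ∏ i ∈ positiveRoots b, h i := by
  classical
  rw [prod_positiveRoots_reflectionPerm b hk, he, Finset.mul_prod_erase]
  simpa using b.isPos_of_mem_support hk

lemma coroot'_halfSum {k : ι} (hk : k ∈ b.support) : P.coroot' k (halfSum b) = 1 := by
  classical
  have h1 := sum_positiveRoots_reflectionPerm b hk P.root
  have hkp : k ∈ positiveRoots b := by simpa using b.isPos_of_mem_support hk
  have h2 := Finset.add_sum_erase _ P.root hkp
  simp only [P.root_reflectionPerm, root_opp] at h1
  rw [← map_sum, P.reflection_apply] at h1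
  have h3 : (P.coroot' k (∑ i ∈ positiveRoots b, P.root i)) • P.root k = (2 : ℝ) • P.root k := by
    generalize P.coroot' k (∑ i ∈ positiveRoots b, P.root i) = c at h1 ⊢
    rw [← h2, sub_eq_iff_eq_add] at h1
    have h5 := congrArg (fun x => x - ∑ i ∈ (positiveRoots b).erase k, P.root i + P.root k) h1
    rw [two_smul]
    refine Eq.trans ?_ (h5.symm.trans ?_) <;> abel
  have h4 := smul_left_injective ℝ (P.ne_zero k) h3
  rw [halfSum, map_smul, h4]; norm_num

omit [Fintype ι] in
lemma isPos_flip [Finite ι] {i : ι} (hi : b.IsPos i) : b.flip.IsPos i := by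
  have := Fintype.ofFinite ι
  refine hi.induction_on_reflect (p := fun i => b.IsPos i → b.flip.IsPos i) ?_ ?_ hi
  · intro i hi _
    exact RootPairing.Base.isPos_of_mem_support (b := b.flip) hi
  · intro i j ih hj h
    have hij : i ≠ j := by
      rintro rfl
      exact (isPos_opp b i).mp h (b.isPos_of_mem_support hj)
    by_cases h2 : i = opp P j
    · have : P.reflectionPerm j i = j := by rw [h2]; exact P.reflectionPerm_self j j
      rw [this]
      exact RootPairing.Base.isPos_of_mem_support (b := b.flip) hj
    · exact (ih ((isPos_reflectionPerm_iff b hj hij h2).mp h)).reflectionPerm (b := b.flip) hj hij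

/-- Positive coroots are non-negative integral combinations of simple coroots. -/
lemma exists_coroot_eq_sum {i : ι} (hi : b.IsPos i) : ∃ f : ι → ℤ, 0 < f ∧
    Function.support f ⊆ b.support ∧ P.coroot i = ∑ j ∈ b.support, f j • P.coroot j := by
  obtain ⟨f, hf, h1, h2⟩ := b.flip.exists_root_eq_sum_int i
  refine ⟨f, h1.resolve_right fun h => ?_, hf, h2⟩
  have h3 := isPos_flip b hi
  rw [RootPairing.Base.isPos_iff, RootPairing.Base.height_eq_sum h2] at h3
  exact absurd h3 (not_lt.mpr (Finset.sum_nonpos fun i _ => h.le i))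

/-- A vector pairing positively with simple coroots pairs positively with positive coroots. -/
lemma coroot'_pos {v : M} (hv : ∀ k ∈ b.support, 0 < P.coroot' k v) {i : ι} (hi : b.IsPos i) :
    0 < P.coroot' i v := by
  obtain ⟨f, h1, h2, h3⟩ := exists_coroot_eq_sum b hi
  have h4 : P.coroot' i v = ∑ j ∈ b.support, (f j : ℝ) * P.coroot' j v := by
    show P.toLinearMap v (P.coroot i) = ∑ j ∈ b.support, (f j : ℝ) * P.toLinearMap v (P.coroot j)
    rw [h3, map_sum]
    simp
  rw [h4]
  obtain ⟨h5, j, hj⟩ := Pi.lt_def.mp h1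
  refine Finset.sum_pos' (fun k hk => mul_nonneg (by exact_mod_cast h5 k) (hv k hk).le)
    ⟨j, h2 (by simpa using hj.ne'), mul_pos (by exact_mod_cast hj) (hv j (h2 (by simpa using hj.ne')))⟩

variable [P.IsRootSystem]

/-- The coordinates of a weight: its pairings with the simple coroots. -/
def coords : M ≃ₗ[ℝ] (b.support → ℝ) :=
  P.toPerfPair.trans (b.toCoweightBasis.constr ℝ).symm

@[simp] lemma coords_apply (v : M) (k : b.support) : coords b v k = P.coroot' k v := by
  simp [coords, Module.Basis.constr]

lemma coroot'_coords_symm (y : b.support → ℝ) (k : b.support) :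
    P.coroot' k ((coords b).symm y) = y k := by
  rw [← coords_apply, LinearEquiv.apply_symm_apply]

lemma card_support : b.support.card = Module.finrank ℝ M := by
  rw [(coords b).finrank_eq, Module.finrank_fintype_fun_eq_card, Fintype.card_coe]

end RootSystem

end WittenZeta

end

noncomputable section

namespace WittenZeta

section WeylGroup

set_option linter.unusedSectionVars false

variable {ι M N : Type*} [Fintype ι] [AddCommGroup M] [Module ℝ M] [AddCommGroup N] [Module ℝ N]
  {P : RootPairing ι ℝ M N}

open RootPairing

lemma weylGroup_ext {w w' : P.weylGroup} (h : ∀ v : M, w • v = w' • v) : w = w' := by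
  apply Subtype.ext
  apply RootPairing.Equiv.weightHom_injective P
  exact LinearEquiv.ext h

lemma ofIdx_smul' (i : ι) (v : M) : weylGroup.ofIdx P i • v = P.reflection i v := rfl

lemma ofIdx_mul_self (i : ι) : weylGroup.ofIdx P i * weylGroup.ofIdx P i = 1 :=
  weylGroup_ext fun v => by rw [mul_smul, one_smul, ofIdx_smul', ofIdx_smul', P.reflection_same]

lemma ofIdx_reflectionPerm (j i : ι) : weylGroup.ofIdx P (P.reflectionPerm j i) =
    weylGroup.ofIdx P j * weylGroup.ofIdx P i * weylGroup.ofIdx P j :=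
  weylGroup_ext fun v => by
    rw [mul_smul, mul_smul]
    simp only [ofIdx_smul', P.reflection_reflectionPerm]
    rfl

lemma weylGroup_induction {p : P.weylGroup → Prop} (h1 : p 1)
    (hm : ∀ i w, p w → p (weylGroup.ofIdx P i * w)) (w : P.weylGroup) : p w := by
  obtain ⟨w, hw⟩ := w
  have key : ∀ w (hw : w ∈ P.weylGroup), ∀ w', p w' → p (⟨w, hw⟩ * w') := by
    intro w hw
    induction hw using weylGroup.induction with
    | mem i => intro w' h; exact hm i w' h
    | one => intro w' h; exact (one_mul w').symm ▸ h
    | mul x y hx hy h1 h2 =>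
      intro w' h
      have := h1 _ (h2 _ h)
      rwa [← mul_assoc] at this
  simpa using key w hw 1 h1

lemma coroot'_weylGroupToPerm (w : P.weylGroup) : ∀ (i : ι) (v : M),
    P.coroot' (P.weylGroupToPerm w i) (w • v) = P.coroot' i v := by
  refine weylGroup_induction (p := fun w => ∀ (i : ι) (v : M),
    P.coroot' (P.weylGroupToPerm w i) (w • v) = P.coroot' i v)
    (fun i v => ?_) (fun k w ih i v => ?_) w
  · rw [map_one, one_smul]; rfl
  · rw [map_mul, mul_smul, ofIdx_smul']
    exact (coroot'_reflectionPerm_reflection k _ _).trans (ih i v)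

lemma coroot'_smul (w : P.weylGroup) (i : ι) (v : M) :
    P.coroot' i (w • v) = P.coroot' (P.weylGroupToPerm w⁻¹ i) v := by
  have h : P.weylGroupToPerm w (P.weylGroupToPerm w⁻¹ i) = i := by
    rw [← Equiv.Perm.mul_apply, ← map_mul, mul_inv_cancel, map_one]; rfl
  conv_lhs => rw [← h]
  exact coroot'_weylGroupToPerm w _ v

lemma weylGroupToPerm_injective [P.IsRootSystem] : Function.Injective P.weylGroupToPerm := by
  intro w w' h
  apply Subtype.ext
  apply RootPairing.Equiv.weightHom_injective P
  apply LinearEquiv.toLinearMap_injective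
  refine LinearMap.ext_on_range (v := P.root) RootPairing.IsRootSystem.span_root_eq_top fun i => ?_
  have h1 := weylGroup_apply_root P w i
  have h2 := weylGroup_apply_root P w' i
  rw [h] at h1
  exact h1.trans h2.symm

instance [P.IsRootSystem] : Finite P.weylGroup :=
  Finite.of_injective _ weylGroupToPerm_injective

/-- The product of simple reflections along a word. -/
def wordProd (b : P.Base) (u : List b.support) : P.weylGroup :=
  (u.map fun i => weylGroup.ofIdx P (i : ι)).prod

lemma wordProd_cons (b : P.Base) (k : b.support) (u : List b.support) :
    wordProd b (k :: u) = weylGroup.ofIdx P (k : ι) * wordProd b u := by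
  simp [wordProd]

lemma wordProd_append (b : P.Base) (u u' : List b.support) :
    wordProd b (u ++ u') = wordProd b u * wordProd b u' := by
  simp [wordProd]

lemma ofIdx_opp (i : ι) : weylGroup.ofIdx P (opp P i) = weylGroup.ofIdx P i := by
  rw [opp, ofIdx_reflectionPerm, ofIdx_mul_self, one_mul]

open Classical in
/-- The number of positive roots that are negative on `v`. -/
def negCount (b : P.Base) (v : M) : ℕ := ∑ i ∈ positiveRoots b, if P.coroot' i v < 0 then 1 else 0

/-- A vector on which no coroot vanishes. -/
def IsRegular (P : RootPairing ι ℝ M N) (v : M) : Prop := ∀ i, P.coroot' i v ≠ 0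

variable [P.IsCrystallographic] [P.IsReduced] (b : P.Base)

lemma exists_wordProd (w : P.weylGroup) : ∃ u, wordProd b u = w := by
  have hrefl : ∀ i : ι, ∃ u, wordProd b u = weylGroup.ofIdx P i := by
    intro i
    refine b.induction_reflect i (p := fun i => ∃ u, wordProd b u = weylGroup.ofIdx P i) ?_ ?_ ?_
    · rintro i ⟨u, hu⟩
      exact ⟨u, hu.trans (ofIdx_opp i).symm⟩
    · intro i hi
      exact ⟨[⟨i, hi⟩], by simp [wordProd]⟩
    · rintro i j ⟨u, hu⟩ hj
      refine ⟨⟨j, hj⟩ :: (u ++ [⟨j, hj⟩]), ?_⟩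
      rw [wordProd_cons, wordProd_append, hu, ofIdx_reflectionPerm, mul_assoc]
      simp [wordProd]
  refine weylGroup_induction (p := fun w => ∃ u, wordProd b u = w) ⟨[], rfl⟩
    (fun i w ⟨u, hu⟩ => ?_) w
  obtain ⟨u', hu'⟩ := hrefl i
  exact ⟨u' ++ u, by rw [wordProd_append, hu, hu']⟩

lemma negCount_reflection_of_pos {k : ι} (hk : k ∈ b.support) {v : M} (hv : 0 < P.coroot' k v) :
    negCount b (P.reflection k v) = negCount b v + 1 := by
  classical
  have h1 : negCount b (P.reflection k v) = ∑ i ∈ positiveRoots b,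
      if P.coroot' (P.reflectionPerm k i) v < 0 then 1 else 0 :=
    Finset.sum_congr rfl fun i _ => by
      rw [← coroot'_reflectionPerm_reflection (P := P) k (P.reflectionPerm k i) v,
        P.reflectionPerm_self]
  have hkp : k ∈ positiveRoots b := by simpa using b.isPos_of_mem_support hk
  rw [h1, sum_positiveRoots_reflectionPerm b hk (fun i => if P.coroot' i v < 0 then 1 else 0),
    coroot'_opp, if_pos (by linarith), negCount, ← Finset.add_sum_erase _ _ hkp,
    if_neg (by linarith)]
  ring

lemma negCount_reflection_of_neg {k : ι} (hk : k ∈ b.support) {v : M} (hv : P.coroot' k v < 0) :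
    negCount b (P.reflection k v) + 1 = negCount b v := by
  have h : 0 < P.coroot' k (P.reflection k v) := by
    have := coroot'_reflectionPerm_reflection (P := P) k (opp P k) v
    rw [show P.reflectionPerm k (opp P k) = k from P.reflectionPerm_self k k, coroot'_opp] at this
    linarith
  have := negCount_reflection_of_pos b hk h
  rw [P.reflection_same] at this
  exact this.symm

lemma negCount_eq_zero {v : M} (h : ∀ i, b.IsPos i → 0 ≤ P.coroot' i v) : negCount b v = 0 :=
  Finset.sum_eq_zero fun i hi => if_neg (not_lt.mpr (h i (by simpa using hi)))

lemma coroot'_halfSum_pos {i : ι} (hi : b.IsPos i) : 0 < P.coroot' i (halfSum b) :=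
  coroot'_pos b (fun k hk => by rw [coroot'_halfSum b hk]; norm_num) hi

lemma isRegular_of_pos {v : M} (h : ∀ i, b.IsPos i → 0 < P.coroot' i v) : IsRegular P v := by
  intro i
  by_cases hi : b.IsPos i
  · exact (h i hi).ne'
  · have := h _ ((isPos_opp b i).mpr hi)
    rw [coroot'_opp] at this
    linarith

lemma IsRegular.smul {v : M} (h : IsRegular P v) (w : P.weylGroup) : IsRegular P (w • v) :=
  fun i => by rw [coroot'_smul]; exact h _

lemma IsRegular.reflection {v : M} (h : IsRegular P v) (k : ι) : IsRegular P (P.reflection k v) :=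
  h.smul (weylGroup.ofIdx P k)

lemma isRegular_halfSum : IsRegular P (halfSum b) :=
  isRegular_of_pos b fun _ hi => coroot'_halfSum_pos b hi

/-- The strong exchange property. -/
lemma exists_wordProd_exchange (u : List b.support) : ∀ {i : ι}, b.IsPos i →
    P.coroot' i (wordProd b u • halfSum b) < 0 →
    ∃ u', u'.length + 1 = u.length ∧ wordProd b u' = weylGroup.ofIdx P i * wordProd b u := by
  induction u with
  | nil =>
    intro i hi h
    have h1 : wordProd b [] = 1 := rfl
    rw [h1, one_smul] at h
    exact absurd h (coroot'_halfSum_pos b hi).le.not_gt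
  | cons j u ih =>
    intro i hi h
    by_cases hij : i = j
    · subst hij
      exact ⟨u, rfl, by rw [wordProd_cons, ← mul_assoc, ofIdx_mul_self, one_mul]⟩
    · have h1 := hi.reflectionPerm j.2 hij
      rw [wordProd_cons, mul_smul, ofIdx_smul', ← P.reflectionPerm_self (j : ι) i,
        coroot'_reflectionPerm_reflection] at h
      obtain ⟨u', h2, h3⟩ := ih h1 h
      refine ⟨j :: u', by simp [h2], ?_⟩
      rw [wordProd_cons, h3, ofIdx_reflectionPerm, wordProd_cons]
      simp only [← mul_assoc, ofIdx_mul_self, one_mul]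

lemma exists_wordProd_length (w : P.weylGroup) :
    ∃ u, wordProd b u = w ∧ u.length = negCount b (w • halfSum b) := by
  obtain ⟨u, rfl⟩ := exists_wordProd b w
  induction u with
  | nil =>
    refine ⟨[], rfl, ?_⟩
    have h1 : wordProd b [] = 1 := rfl
    rw [h1, one_smul, negCount_eq_zero b fun i hi => (coroot'_halfSum_pos b hi).le]
    rfl
  | cons j u ih =>
    obtain ⟨u', h1, h2⟩ := ih
    rw [wordProd_cons, mul_smul, ofIdx_smul']
    rcases lt_or_gt_of_ne ((isRegular_halfSum b).smul (wordProd b u) (j : ι)) with h | h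
    · obtain ⟨u'', h3, h4⟩ := exists_wordProd_exchange b u' (b.isPos_of_mem_support j.2)
        (by rw [h1]; exact h)
      refine ⟨u'', by rw [h4, h1], ?_⟩
      have := negCount_reflection_of_neg b j.2 h
      omega
    · refine ⟨j :: u', by rw [wordProd_cons, h1], ?_⟩
      rw [negCount_reflection_of_pos b j.2 h, List.length_cons, h2]

lemma negCount_wordProd_le (u : List b.support) :
    negCount b (wordProd b u • halfSum b) ≤ u.length := by
  induction u with
  | nil =>
    have h1 : wordProd b [] = 1 := rfl
    rw [h1, one_smul, negCount_eq_zero b fun i hi => (coroot'_halfSum_pos b hi).le]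
    exact Nat.zero_le _
  | cons j u ih =>
    rw [wordProd_cons, mul_smul, ofIdx_smul', List.length_cons]
    rcases lt_or_gt_of_ne ((isRegular_halfSum b).smul (wordProd b u) (j : ι)) with h | h
    · have := negCount_reflection_of_neg b j.2 h
      omega
    · have := negCount_reflection_of_pos b j.2 h
      omega

/-- The length of a Weyl group element is its number of inversions. -/
theorem weylLength_eq_negCount (w : P.weylGroup) :
    weylLength b w = negCount b (w • halfSum b) := by
  obtain ⟨u, h1, h2⟩ := exists_wordProd_length b w
  refine le_antisymm (Nat.sInf_le ⟨u, h2, h1⟩) ?_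
  obtain ⟨u', h3, h4⟩ := Nat.sInf_mem (s := {k | ∃ u : List b.support, u.length = k ∧
    (u.map fun i => weylGroup.ofIdx P (i : ι)).prod = w}) ⟨_, u, rfl, h1⟩
  have := negCount_wordProd_le b u'
  rw [show wordProd b u' = w from h4, h3] at this
  exact this

/-- Each regular vector is conjugate to a dominant one. -/
lemma exists_smul_pos {v : M} (hv : IsRegular P v) :
    ∃ w : P.weylGroup, ∀ i, b.IsPos i → 0 < P.coroot' i (w • v) := by
  induction h : negCount b v generalizing v with
  | zero =>
    refine ⟨1, fun i hi => ?_⟩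
    rw [one_smul]
    refine lt_of_le_of_ne (not_lt.mp fun hlt => ?_) (hv i).symm
    have := (Finset.sum_eq_zero_iff.mp h) i (by simpa using hi)
    rw [if_pos hlt] at this
    exact one_ne_zero this
  | succ n ih =>
    have : ∃ k ∈ b.support, P.coroot' k v < 0 := by
      by_contra! hc
      have h1 : ∀ i, b.IsPos i → 0 < P.coroot' i v := fun i hi =>
        coroot'_pos b (fun k hk => lt_of_le_of_ne (hc k hk) (hv k).symm) hi
      rw [negCount_eq_zero b fun i hi => (h1 i hi).le] at h
      omega
    obtain ⟨k, hk, hk'⟩ := this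
    obtain ⟨w, hw⟩ := ih (hv.reflection k)
      (by have := negCount_reflection_of_neg b hk hk'; omega)
    exact ⟨w * weylGroup.ofIdx P k, fun i hi => by rw [mul_smul]; exact hw i hi⟩

lemma coroot'_smul_pos_iff {v v' : M} (hv : ∀ i, b.IsPos i → 0 < P.coroot' i v)
    (hv' : ∀ i, b.IsPos i → 0 < P.coroot' i v') (w : P.weylGroup) (i : ι) :
    0 < P.coroot' i (w • v) ↔ 0 < P.coroot' i (w • v') := by
  have key : ∀ v : M, (∀ i, b.IsPos i → 0 < P.coroot' i v) → ∀ j,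
      (0 < P.coroot' j v ↔ b.IsPos j) := by
    intro v hv j
    refine ⟨fun h => ?_, hv j⟩
    by_contra hj
    have := hv _ ((isPos_opp b j).mpr hj)
    rw [coroot'_opp] at this
    linarith
  rw [coroot'_smul, coroot'_smul, key v hv, key v' hv']

/-- The Weyl group acts freely on chambers. -/
lemma eq_one_of_smul_pos {v : M} (hv : ∀ i, b.IsPos i → 0 < P.coroot' i v) {w : P.weylGroup}
    (hw : ∀ i, b.IsPos i → 0 < P.coroot' i (w • v)) : w = 1 := by
  obtain ⟨u, h1, h2⟩ := exists_wordProd_length b w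
  rw [negCount_eq_zero b fun i hi => ((coroot'_smul_pos_iff b hv
    (fun i hi => coroot'_halfSum_pos b hi) w i).mp (hw i hi)).le] at h2
  rw [← h1, List.length_eq_zero_iff.mp h2]
  rfl

end WeylGroup

end WittenZeta

end

noncomputable section

namespace WittenZeta

section Symmetrization

set_option linter.unusedSectionVars false

variable {ι M N : Type*} [Fintype ι] [AddCommGroup M] [Module ℝ M] [AddCommGroup N] [Module ℝ N]
  {P : RootPairing ι ℝ M N} [P.IsCrystallographic] [P.IsReduced] (b : P.Base)

open RootPairing

/-- Products of even functions over the positive roots are invariant under the Weyl group. -/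
@[to_additive sum_positiveRoots_smul]
lemma prod_positiveRoots_smul {G : Type*} [CommMonoid G] {h : ℝ → G} (he : ∀ x, h (-x) = h x)
    (w : P.weylGroup) (v : M) :
    ∏ i ∈ positiveRoots b, h (P.coroot' i (w • v)) = ∏ i ∈ positiveRoots b, h (P.coroot' i v) := by
  obtain ⟨u, rfl⟩ := exists_wordProd b w
  induction u with
  | nil =>
    have h1 : wordProd b [] = 1 := rfl
    rw [h1, one_smul]
  | cons k u ih =>
    rw [wordProd_cons, mul_smul, ofIdx_smul', ← ih,
      ← prod_positiveRoots_reflectionPerm_of_even b k.2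
        (fun i => h (P.coroot' i (wordProd b u • v))) (by simp only [coroot'_opp, he])]
    refine Finset.prod_congr rfl fun i _ => ?_
    rw [← coroot'_reflectionPerm_reflection (k : ι) (P.reflectionPerm k i), P.reflectionPerm_self]

open Classical in
/-- The positive roots that are not simple. -/
def nonsimpleRoots : Finset ι := positiveRoots b \ b.support

/-- An enumeration of the positive roots: first the nonsimple ones, then the simple ones. -/
def posIndex : Fin (nonsimpleRoots b).card ⊕ Fin b.support.card → ι :=
  Sum.elim (fun j => (nonsimpleRoots b).equivFin.symm j) fun i => b.support.equivFin.symm i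

lemma prod_posIndex {G : Type*} [CommMonoid G] (h : ι → G) :
    ∏ k, h (posIndex b k) = ∏ i ∈ positiveRoots b, h i := by
  classical
  have hsub : b.support ⊆ positiveRoots b := fun i hi => by
    simpa using b.isPos_of_mem_support hi
  rw [Fintype.prod_sum_type, ← Finset.prod_sdiff hsub]
  congr 1
  · rw [← Finset.prod_coe_sort (positiveRoots b \ b.support)]
    exact Equiv.prod_comp (nonsimpleRoots b).equivFin.symm (fun i => h (i : ι))
  · rw [← Finset.prod_coe_sort b.support]
    exact Equiv.prod_comp b.support.equivFin.symm (fun i => h (i : ι))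

lemma isPos_posIndex (k) : b.IsPos (posIndex b k) := by
  classical
  rcases k with j | i
  · have := ((nonsimpleRoots b).equivFin.symm j).2
    exact (mem_positiveRoots b).mp (Finset.mem_sdiff.mp this).1
  · exact b.isPos_of_mem_support (b.support.equivFin.symm i).2

lemma posIndex_injective : Function.Injective (posIndex b) := by
  classical
  refine Function.Injective.sumElim (fun i j h => ?_) (fun i j h => ?_) fun i j h => ?_
  · exact (nonsimpleRoots b).equivFin.symm.injective (Subtype.ext h)
  · exact b.support.equivFin.symm.injective (Subtype.ext h)
  · have h1 := ((nonsimpleRoots b).equivFin.symm i).2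
    refine (Finset.mem_sdiff.mp h1).2 ?_
    rw [h]
    exact (b.support.equivFin.symm j).2

/-- The coefficients of the nonsimple positive coroots. -/
def corootCoeff (j : Fin (nonsimpleRoots b).card) (i : Fin b.support.card) : ℤ :=
  (exists_coroot_eq_sum b (isPos_posIndex b (Sum.inl j))).choose (posIndex b (Sum.inr i))

variable [P.IsRootSystem]

/-- The weight with given integral coordinates. -/
def weightOfCoords (v : Fin b.support.card → ℤ) : M :=
  (coords b).symm fun k => (v (b.support.equivFin k) : ℝ)

lemma coroot'_weightOfCoords_simple (v : Fin b.support.card → ℤ) (k : b.support) :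
    P.coroot' k (weightOfCoords b v) = v (b.support.equivFin k) :=
  coroot'_coords_symm b _ k

lemma coroot'_weightOfCoords (v : Fin b.support.card → ℤ) (k) :
    P.coroot' (posIndex b k) (weightOfCoords b v) = (latticeForm (corootCoeff b) v k : ℝ) := by
  rcases k with j | i
  · obtain ⟨h1, h2, h3⟩ := (exists_coroot_eq_sum b (isPos_posIndex b (Sum.inl j))).choose_spec
    show P.toLinearMap _ (P.coroot _) = _
    rw [h3, map_sum, ← Finset.sum_coe_sort, ← Equiv.sum_comp b.support.equivFin.symm]
    simp only [latticeForm, Sum.elim_inl, Int.cast_sum, Int.cast_mul]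
    refine Finset.sum_congr rfl fun i _ => ?_
    rw [map_zsmul, zsmul_eq_mul]
    congr 1
    have := coroot'_weightOfCoords_simple b v (b.support.equivFin.symm i)
    rwa [Equiv.apply_symm_apply] at this
  · have := coroot'_weightOfCoords_simple b v (b.support.equivFin.symm i)
    rwa [Equiv.apply_symm_apply] at this

/-- Weights: the vectors with integral pairings with all coroots. -/
def IsWeight (P : RootPairing ι ℝ M N) (v : M) : Prop := ∀ i, ∃ z : ℤ, P.coroot' i v = z

lemma isWeight_weightOfCoords (v : Fin b.support.card → ℤ) : IsWeight P (weightOfCoords b v) := by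
  have hpos : ∀ i, b.IsPos i → ∃ z : ℤ, P.coroot' i (weightOfCoords b v) = z := by
    intro i hi
    obtain ⟨f, h1, h2, h3⟩ := exists_coroot_eq_sum b hi
    refine ⟨∑ j : b.support, f j * v (b.support.equivFin j), ?_⟩
    show P.toLinearMap _ (P.coroot _) = _
    rw [h3, map_sum, ← Finset.sum_coe_sort, Int.cast_sum]
    refine Finset.sum_congr rfl fun i _ => ?_
    rw [map_zsmul, zsmul_eq_mul, Int.cast_mul, ← coroot'_weightOfCoords_simple b v i]
    rfl
  intro i
  by_cases hi : b.IsPos i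
  · exact hpos i hi
  · obtain ⟨z, hz⟩ := hpos _ ((isPos_opp b i).mpr hi)
    rw [coroot'_opp] at hz
    exact ⟨-z, by rw [Int.cast_neg, ← hz, neg_neg]⟩

omit [P.IsCrystallographic] [P.IsReduced] [P.IsRootSystem] in
lemma IsWeight.smul {v : M} (h : IsWeight P v) (w : P.weylGroup) : IsWeight P (w • v) :=
  fun i => by rw [coroot'_smul]; exact h _

omit [P.IsCrystallographic] [P.IsReduced] [P.IsRootSystem] in
lemma IsWeight.add {v w : M} (hv : IsWeight P v) (hw : IsWeight P w) : IsWeight P (v + w) := by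
  intro i
  obtain ⟨z, hz⟩ := hv i
  obtain ⟨y, hy⟩ := hw i
  exact ⟨z + y, by rw [map_add, hz, hy, Int.cast_add]⟩

omit [P.IsCrystallographic] [P.IsReduced] [P.IsRootSystem] in
lemma IsWeight.neg {v : M} (hv : IsWeight P v) : IsWeight P (-v) := by
  intro i
  obtain ⟨z, hz⟩ := hv i
  exact ⟨-z, by rw [map_neg, hz, Int.cast_neg]⟩

/-- The integral coordinates of a weight. -/
def intCoords (v : M) (i : Fin b.support.card) : ℤ := ⌊P.coroot' (posIndex b (Sum.inr i)) v⌋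

lemma weightOfCoords_intCoords {v : M} (hv : IsWeight P v) :
    weightOfCoords b (intCoords b v) = v := by
  rw [weightOfCoords, LinearEquiv.symm_apply_eq]
  funext k
  have h1 : posIndex b (Sum.inr (b.support.equivFin k)) = k := by simp [posIndex]
  obtain ⟨z, hz⟩ := hv k
  rw [coords_apply, intCoords, h1, hz, Int.floor_intCast]

lemma weightOfCoords_injective : Function.Injective (weightOfCoords b) := by
  intro v v' h
  have h1 := (coords b).symm.injective h
  funext i
  have h2 := congrFun h1 (b.support.equivFin.symm i)
  simpa using h2

lemma weightOfCoords_one : weightOfCoords b (fun _ => 1) = halfSum b := by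
  rw [weightOfCoords, LinearEquiv.symm_apply_eq]
  funext k
  rw [coords_apply, coroot'_halfSum b k.2, Int.cast_one]

lemma isWeight_halfSum : IsWeight P (halfSum b) := by
  rw [← weightOfCoords_one]; exact isWeight_weightOfCoords b _

lemma coroot'_add_halfSum_pos {l : M} (hl : l ∈ dominantWeights b) {i : ι} (hi : b.IsPos i) :
    0 < P.coroot' i (l + halfSum b) := by
  refine coroot'_pos b (fun k hk => ?_) hi
  rw [map_add, coroot'_halfSum b hk]
  have : 0 ≤ P.coroot' k l := hl.2 k hk
  linarith

/-- A Weyl group element and a dominant weight give a regular lattice point. -/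
def latticePoint (p : P.weylGroup × dominantWeights b) : Fin b.support.card → ℤ :=
  intCoords b (p.1 • ((p.2 : M) + halfSum b))

lemma weightOfCoords_latticePoint (p : P.weylGroup × dominantWeights b) :
    weightOfCoords b (latticePoint b p) = p.1 • ((p.2 : M) + halfSum b) :=
  weightOfCoords_intCoords b
    ((IsWeight.add (fun i => p.2.2.1 i) (isWeight_halfSum b)).smul p.1)

lemma latticePoint_injective : Function.Injective (latticePoint b) := by
  rintro ⟨w, l⟩ ⟨w', l'⟩ h
  have h1 := weightOfCoords_latticePoint b (w, l)
  rw [h, weightOfCoords_latticePoint] at h1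
  simp only at h1
  have h2 : (w'⁻¹ * w) • ((l : M) + halfSum b) = (l' : M) + halfSum b := by
    rw [mul_smul, ← h1, inv_smul_smul]
  have h3 : w'⁻¹ * w = 1 := eq_one_of_smul_pos b (fun i hi => coroot'_add_halfSum_pos b l.2 hi)
    fun i hi => by rw [h2]; exact coroot'_add_halfSum_pos b l'.2 hi
  rw [h3, one_smul] at h2
  have h4 : w = w' := by rw [inv_mul_eq_one] at h3; exact h3.symm
  rw [h4, Subtype.ext (add_right_cancel h2)]

lemma exists_latticePoint_eq {v : Fin b.support.card → ℤ} (hv : IsRegular P (weightOfCoords b v)) :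
    ∃ p, latticePoint b p = v := by
  obtain ⟨w, hw⟩ := exists_smul_pos b hv
  have hint := (isWeight_weightOfCoords b v).smul w
  have hl : w • weightOfCoords b v - halfSum b ∈ dominantWeights b := by
    refine ⟨fun i => ?_, fun k hk => ?_⟩
    · rw [sub_eq_add_neg]
      exact hint.add (isWeight_halfSum b).neg i
    · obtain ⟨z, hz⟩ := hint k
      have h1 := hw k (b.isPos_of_mem_support hk)
      have h2 := coroot'_halfSum b hk
      have h3 : P.coroot' k (w • weightOfCoords b v - halfSum b) = z - 1 := by
        rw [map_sub, hz, h2]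
      have h4 : (0 : ℝ) ≤ z - 1 := by
        rw [hz] at h1
        have : (1 : ℤ) ≤ z := by exact_mod_cast h1
        have : (1 : ℝ) ≤ z := by exact_mod_cast this
        linarith
      exact h4.trans_eq h3.symm
  refine ⟨(w⁻¹, ⟨_, hl⟩), weightOfCoords_injective b ?_⟩
  rw [weightOfCoords_latticePoint]
  simp

lemma isRegular_weightOfCoords_iff (v : Fin b.support.card → ℤ) :
    IsRegular P (weightOfCoords b v) ↔ ∀ k, latticeForm (corootCoeff b) v k ≠ 0 := by
  constructor
  · intro h k
    have := h (posIndex b k)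
    rw [coroot'_weightOfCoords] at this
    exact_mod_cast this
  · intro h
    have hp : ∀ i, b.IsPos i → P.coroot' i (weightOfCoords b v) ≠ 0 := by
      classical
      intro i hi
      have h1 := (prod_posIndex b fun j => P.coroot' j (weightOfCoords b v)).symm
      intro h0
      rw [Finset.prod_eq_zero (i := i) (by simpa using hi) h0] at h1
      obtain ⟨k, -, hk⟩ := Finset.prod_eq_zero_iff.mp h1.symm
      rw [coroot'_weightOfCoords] at hk
      exact h k (by exact_mod_cast hk)
    intro i
    by_cases hi : b.IsPos i
    · exact hp i hi
    · have := hp _ ((isPos_opp b i).mpr hi)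
      rw [coroot'_opp] at this
      exact neg_ne_zero.mp this

/-- The product of the values of the positive coroots at the half-sum of positive roots. -/
def weylDenom : ℝ := ∏ i ∈ positiveRoots b, P.coroot' i (halfSum b)

lemma weylDenom_pos : 0 < weylDenom b :=
  Finset.prod_pos fun _ hi => coroot'_halfSum_pos b (by simpa using hi)

lemma weylDim_eq (l : M) : weylDim b l =
    (∏ i ∈ positiveRoots b, P.coroot' i (l + halfSum b)) / weylDenom b := rfl

lemma one_le_weylDim {l : M} (hl : l ∈ dominantWeights b) : 1 ≤ weylDim b l := by
  rw [weylDim_eq, one_le_div (weylDenom_pos b), weylDenom]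
  refine Finset.prod_le_prod (fun i hi => (coroot'_halfSum_pos b (by simpa using hi)).le)
    fun i hi => ?_
  rw [map_add]
  have hi' : b.IsPos i := by simpa using hi
  obtain ⟨f, h1, h2, h3⟩ := exists_coroot_eq_sum b hi'
  have h4 : P.coroot' i l = ∑ j ∈ b.support, (f j : ℝ) * P.coroot' j l := by
    show P.toLinearMap l (P.coroot i) = ∑ j ∈ b.support, (f j : ℝ) * P.toLinearMap l (P.coroot j)
    rw [h3, map_sum]
    simp
  have : 0 ≤ P.coroot' i l := by
    rw [h4]
    exact Finset.sum_nonneg fun k hk => mul_nonneg (by exact_mod_cast h1.le k) (hl.2 k hk)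
  linarith

lemma ofReal_prod_cpow {κ : Type*} (S : Finset κ) {x : κ → ℝ} (hx : ∀ i ∈ S, 0 ≤ x i) (s : ℂ) :
    ((∏ i ∈ S, x i : ℝ) : ℂ) ^ s = ∏ i ∈ S, (x i : ℂ) ^ s := by
  classical
  induction S using Finset.induction_on with
  | empty => simp
  | insert a S ha ih =>
    rw [Finset.prod_insert ha, Finset.prod_insert ha, Complex.ofReal_mul,
      Complex.mul_cpow_ofReal_nonneg (hx a (Finset.mem_insert_self _ _))
        (Finset.prod_nonneg fun i hi => hx i (Finset.mem_insert_of_mem hi)),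
      ih fun i hi => hx i (Finset.mem_insert_of_mem hi)]

/-- The terms of the lattice sum on the orbit of a dominant weight. -/
lemma prod_latticePow_latticePoint (s : ℂ) (p : P.weylGroup × dominantWeights b) :
    ∏ k, latticePow false s (latticeForm (corootCoeff b) (latticePoint b p) k) =
      (weylDenom b : ℂ) ^ (-s) * ((weylDim b (p.2 : M) : ℝ) : ℂ) ^ (-s) := by
  have hne := (isRegular_weightOfCoords_iff b (latticePoint b p)).mp (by
    rw [weightOfCoords_latticePoint]
    exact (isRegular_of_pos b fun i hi => coroot'_add_halfSum_pos b p.2.2 hi).smul _)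
  have h1 : ∀ k, latticePow false s (latticeForm (corootCoeff b) (latticePoint b p) k) =
      (fun x : ℝ => ((|x| : ℝ) : ℂ) ^ (-s))
        (P.coroot' (posIndex b k) (p.1 • ((p.2 : M) + halfSum b))) := by
    intro k
    rw [← weightOfCoords_latticePoint, coroot'_weightOfCoords, latticePow, if_neg (hne k)]
    simp [← Int.cast_abs]
  simp only [h1]
  rw [prod_posIndex b fun i => (fun x : ℝ => ((|x| : ℝ) : ℂ) ^ (-s))
    (P.coroot' i (p.1 • ((p.2 : M) + halfSum b))),
    prod_positiveRoots_smul b (h := fun x : ℝ => ((|x| : ℝ) : ℂ) ^ (-s)) (by simp)]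
  rw [← Complex.mul_cpow_ofReal_nonneg (weylDenom_pos b).le
    (zero_le_one.trans (one_le_weylDim b p.2.2)), ← Complex.ofReal_mul, weylDim_eq,
    mul_div_cancel₀ _ (weylDenom_pos b).ne', ofReal_prod_cpow _ fun i hi =>
      (coroot'_add_halfSum_pos b p.2.2 (by simpa using hi)).le]
  refine Finset.prod_congr rfl fun i hi => ?_
  rw [abs_of_pos (coroot'_add_halfSum_pos b p.2.2 (by simpa using hi))]

lemma latticePow_zero_right (odd : Bool) (s : ℂ) : latticePow odd s 0 = 0 := by
  simp [latticePow]

/-- The factor relating the lattice sum to the Witten zeta function. -/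
def latticeFactor (s : ℂ) : ℂ := Nat.card P.weylGroup * (weylDenom b : ℂ) ^ (-s)

lemma latticeFactor_ne_zero (s : ℂ) : latticeFactor b s ≠ 0 := by
  refine mul_ne_zero (Nat.cast_ne_zero.mpr Nat.card_pos.ne') ?_
  rw [Complex.cpow_def_of_ne_zero (by exact_mod_cast (weylDenom_pos b).ne')]
  exact Complex.exp_ne_zero _

lemma analyticAt_latticeFactor (s : ℂ) : AnalyticAt ℂ (latticeFactor b) s := by
  have h : Differentiable ℂ (latticeFactor b) := by
    unfold latticeFactor
    refine (differentiable_const _).mul (differentiable_id.neg.const_cpow (Or.inl ?_))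
    exact_mod_cast (weylDenom_pos b).ne'
  exact h.analyticAt s

lemma hasSum_latticePoint {s : ℂ} (hs : 1 < s.re) :
    HasSum (fun p : P.weylGroup × dominantWeights b =>
      (weylDenom b : ℂ) ^ (-s) * ((weylDim b (p.2 : M) : ℝ) : ℂ) ^ (-s))
      (latticeSum (corootCoeff b) (fun _ => false) s) := by
  have h := (hasSum_lattice_eq_integral (corootCoeff b) (fun _ => false) hs).summable.hasSum
  rw [← (latticePoint_injective b).hasSum_iff] at h
  · simpa only [Function.comp_def, prod_latticePow_latticePoint] using! h
  · intro v hv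
    by_contra hne
    refine hv (exists_latticePoint_eq b ((isRegular_weightOfCoords_iff b v).mpr fun k hk => ?_))
    exact hne (Finset.prod_eq_zero (Finset.mem_univ k) (by rw [hk, latticePow_zero_right]))

lemma summable_weylDim {s : ℂ} (hs : 1 < s.re) :
    Summable fun l : dominantWeights b => ((weylDim b (l : M) : ℝ) : ℂ) ^ (-s) := by
  have h := (hasSum_latticePoint b hs).summable.prod_factor (1 : P.weylGroup)
  simp only at h
  refine (summable_mul_left_iff ?_).mp h
  intro h0
  have := latticeFactor_ne_zero b s
  rw [latticeFactor, h0, mul_zero] at this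
  exact this rfl

/-- The lattice sum is the Witten zeta function, up to an elementary factor. -/
theorem latticeSum_eq {s : ℂ} (hs : 1 < s.re) :
    latticeSum (corootCoeff b) (fun _ => false) s =
      latticeFactor b s * ∑' l : dominantWeights b, ((weylDim b (l : M) : ℝ) : ℂ) ^ (-s) := by
  have h := (hasSum_latticePoint b hs).prod_fiberwise
    (fun w => (summable_weylDim b hs).hasSum.mul_left ((weylDenom b : ℂ) ^ (-s)))
  have := Fintype.ofFinite P.weylGroup
  rw [h.unique (hasSum_fintype _)]
  simp [latticeFactor, Nat.card_eq_fintype_card, mul_assoc]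

lemma analyticAt_tsum_weylDim {s : ℂ} (hs : 1 < s.re) :
    AnalyticAt ℂ (fun s => ∑' l : dominantWeights b, ((weylDim b (l : M) : ℝ) : ℂ) ^ (-s)) s := by
  set σ : ℝ := (1 + s.re) / 2 with hσ
  have hopen : IsOpen {z : ℂ | σ < z.re} := isOpen_lt continuous_const Complex.continuous_re
  have hpos : ∀ l : dominantWeights b, 0 < weylDim b (l : M) := fun l =>
    zero_lt_one.trans_le (one_le_weylDim b l.2)
  have hsum := (summable_weylDim b (s := (σ : ℂ)) (by rw [Complex.ofReal_re]; linarith)).norm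
  refine DifferentiableOn.analyticAt (s := {z : ℂ | σ < z.re})
    (Complex.differentiableOn_tsum_of_summable_norm hsum (fun l => ?_) hopen fun l z hz => ?_)
    (hopen.mem_nhds (show σ < s.re by linarith))
  · refine (differentiable_id.neg.const_cpow (Or.inl ?_)).differentiableOn
    exact_mod_cast (hpos l).ne'
  · rw [Complex.norm_cpow_eq_rpow_re_of_pos (hpos l), Complex.norm_cpow_eq_rpow_re_of_pos (hpos l)]
    refine Real.rpow_le_rpow_of_exponent_le (one_le_weylDim b l.2) ?_
    have : σ < z.re := hz
    simp only [Complex.neg_re, Complex.ofReal_re]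
    linarith

end Symmetrization

end WittenZeta

end

noncomputable section

namespace WittenZeta

section SignDegree

set_option linter.unusedSectionVars false

variable {ι M N : Type*} [Fintype ι] [AddCommGroup M] [Module ℝ M] [AddCommGroup N] [Module ℝ N]
  {P : RootPairing ι ℝ M N}

open RootPairing

/-- The sign of a coroot, as a function on the regular vectors. -/
def signFun (P : RootPairing ι ℝ M N) (i : ι) : {v : M // IsRegular P v} → ℂ :=
  fun v => ((SignType.sign (P.coroot' i (v : M)) : SignType) : ℂ)

lemma signFun_mul_self (i : ι) : signFun P i * signFun P i = 1 := by
  funext v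
  simp only [signFun, Pi.mul_apply, Pi.one_apply]
  rcases lt_or_gt_of_ne (v.2 i) with h | h
  · rw [sign_neg h]; simp
  · rw [sign_pos h]; simp

lemma signFun_opp (i : ι) : signFun P (opp P i) = -signFun P i := by
  funext v
  simp only [signFun, Pi.neg_apply, coroot'_opp]
  rcases lt_or_gt_of_ne (v.2 i) with h | h
  · rw [sign_neg h, sign_pos (neg_pos.mpr h)]; simp
  · rw [sign_pos h, sign_neg (neg_neg_of_pos h)]; simp

lemma prod_signFun_mul_self (S : Finset ι) : (∏ i ∈ S, signFun P i) * ∏ i ∈ S, signFun P i = 1 := by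
  rw [← Finset.prod_mul_distrib]
  exact Finset.prod_eq_one fun i _ => signFun_mul_self i

/-- The span of the constants and the signs of coroots. -/
def signSpan (P : RootPairing ι ℝ M N) : Submodule ℂ ({v : M // IsRegular P v} → ℂ) :=
  Submodule.span ℂ (insert 1 (Set.range (signFun P)))

lemma one_mem_signSpan : 1 ∈ signSpan P := Submodule.subset_span (Set.mem_insert _ _)

lemma signFun_mem_signSpan (i : ι) : signFun P i ∈ signSpan P :=
  Submodule.subset_span (Set.mem_insert_of_mem _ ⟨i, rfl⟩)

lemma signSpan_pow_mono {j k : ℕ} (h : j ≤ k) : signSpan P ^ j ≤ signSpan P ^ k :=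
  pow_le_pow_right₀ (Submodule.one_le.mpr one_mem_signSpan) h

lemma prod_signFun_mem (S : Finset ι) : ∏ i ∈ S, signFun P i ∈ signSpan P ^ S.card := by
  classical
  induction S using Finset.induction_on with
  | empty => rw [Finset.prod_empty, Finset.card_empty, pow_zero]; exact Submodule.one_le.mp le_rfl
  | insert a S ha ih =>
    rw [Finset.prod_insert ha, Finset.card_insert_of_notMem ha, pow_succ']
    exact Submodule.mul_mem_mul (signFun_mem_signSpan a) ih

lemma signSpan_pow_le_span (b : P.Base) (k : ℕ) : signSpan P ^ k ≤ Submodule.span ℂ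
    ((fun S : Finset ι => ∏ i ∈ S, signFun P i) '' {S | S ⊆ positiveRoots b ∧ S.card ≤ k}) := by
  classical
  induction k with
  | zero =>
    rw [pow_zero, Submodule.one_le]
    exact Submodule.subset_span ⟨∅, by simp, by simp⟩
  | succ k ih =>
    rw [pow_succ]
    refine (mul_le_mul_left ih _).trans ?_
    rw [signSpan, Submodule.span_mul_span, Submodule.span_le]
    rintro _ ⟨_, ⟨S, ⟨hS, hSk⟩, rfl⟩, f, hf, rfl⟩
    have key : ∀ i, b.IsPos i → (∏ i ∈ S, signFun P i) * signFun P i ∈ Submodule.span ℂ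
        ((fun S : Finset ι => ∏ i ∈ S, signFun P i) ''
          {S | S ⊆ positiveRoots b ∧ S.card ≤ k + 1}) := by
      intro i hi
      by_cases h : i ∈ S
      · refine Submodule.subset_span ⟨S.erase i, ⟨(Finset.erase_subset _ _).trans hS, ?_⟩, ?_⟩
        · have := Finset.card_erase_le (a := i) (s := S); omega
        · show ∏ j ∈ S.erase i, signFun P j = _
          rw [← Finset.prod_erase_mul _ _ h, mul_assoc, signFun_mul_self, mul_one]
      · refine Submodule.subset_span ⟨insert i S, ⟨?_, ?_⟩, ?_⟩
        · exact Finset.insert_subset (by simpa using hi) hS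
        · rw [Finset.card_insert_of_notMem h]; omega
        · show ∏ j ∈ insert i S, signFun P j = _
          rw [Finset.prod_insert h, mul_comm]
    rcases hf with rfl | ⟨i, rfl⟩
    · exact Submodule.subset_span ⟨S, ⟨hS, hSk.trans (Nat.le_succ k)⟩, (mul_one _).symm⟩
    · by_cases hi : b.IsPos i
      · exact key i hi
      · have := key _ ((isPos_opp b i).mpr hi)
        rw [signFun_opp, mul_neg] at this
        exact (Submodule.neg_mem_iff _).mp this

/-- The sets of at most `k` positive roots. -/
def smallRootSets (b : P.Base) (k : ℕ) : Finset (Finset ι) :=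
  (positiveRoots b).powerset.filter fun S => S.card ≤ k

lemma mem_smallRootSets {b : P.Base} {k : ℕ} {S : Finset ι} :
    S ∈ smallRootSets b k ↔ S ⊆ positiveRoots b ∧ S.card ≤ k := by
  simp [smallRootSets]

lemma exists_coeff_of_mem_signSpan_pow (b : P.Base) {k : ℕ} {f : {v : M // IsRegular P v} → ℂ}
    (hf : f ∈ signSpan P ^ k) : ∃ c : Finset ι → ℂ,
      f = ∑ S ∈ smallRootSets b k, c S • ∏ i ∈ S, signFun P i := by
  have h := signSpan_pow_le_span b k hf
  rw [show {S | S ⊆ positiveRoots b ∧ S.card ≤ k} = (smallRootSets b k : Set (Finset ι)) by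
    ext S; exact mem_smallRootSets.symm, Submodule.mem_span_image_finset_iff_exists_fun'] at h
  obtain ⟨c, hc⟩ := h
  exact ⟨c, hc.symm⟩

variable [P.IsCrystallographic] [P.IsReduced] (b : P.Base) [P.IsRootSystem]

open Classical in
/-- The parities attached to a set of positive roots: odd outside the set. -/
def parityOutside (S : Finset ι) (k : Fin (nonsimpleRoots b).card ⊕ Fin b.support.card) : Bool :=
  decide (posIndex b k ∉ S)

lemma prod_latticePow_parityOutside {S : Finset ι} (hS : S ⊆ positiveRoots b) (s : ℂ)
    {v : Fin b.support.card → ℤ} (hv : IsRegular P (weightOfCoords b v)) :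
    ∏ k, latticePow (parityOutside b S k) s (latticeForm (corootCoeff b) v k) =
      (((∏ i ∈ positiveRoots b, signFun P i) * ∏ i ∈ S, signFun P i) ⟨_, hv⟩) *
        ∏ k, latticePow false s (latticeForm (corootCoeff b) v k) := by
  classical
  have hne := (isRegular_weightOfCoords_iff b v).mp hv
  have h1 : ∀ k, latticePow (parityOutside b S k) s (latticeForm (corootCoeff b) v k) =
      (if posIndex b k ∈ S then 1 else signFun P (posIndex b k) ⟨_, hv⟩) *
        latticePow false s (latticeForm (corootCoeff b) v k) := by
    intro k
    by_cases hk : posIndex b k ∈ S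
    · simp [parityOutside, hk]
    · have h2 : signFun P (posIndex b k) ⟨_, hv⟩ = ((latticeForm (corootCoeff b) v k).sign : ℂ) := by
        simp only [signFun, coroot'_weightOfCoords]
        rcases lt_or_gt_of_ne (hne k) with h | h
        · rw [Int.sign_eq_neg_one_of_neg h, sign_neg (by exact_mod_cast h)]; simp
        · rw [Int.sign_eq_one_of_pos h, sign_pos (by exact_mod_cast h)]; simp
      simp [parityOutside, hk, h2, latticePow, hne k]
  simp only [h1]
  rw [Finset.prod_mul_distrib]
  congr 1
  rw [prod_posIndex b fun i => if i ∈ S then 1 else signFun P i ⟨_, hv⟩,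
    ← Finset.prod_sdiff hS, ← Finset.prod_sdiff hS, mul_assoc, prod_signFun_mul_self, mul_one,
    Finset.prod_apply]
  rw [Finset.prod_eq_one (s := S) fun i hi => if_pos hi, mul_one]
  exact Finset.prod_congr rfl fun i hi => if_neg (Finset.mem_sdiff.mp hi).2

/-- A relation of degree `k` expressing the product of the signs of all positive coroots gives a
relation between lattice sums. -/
lemma latticeSum_eq_sum {k : ℕ} {c : Finset ι → ℂ}
    (hc : ∏ i ∈ positiveRoots b, signFun P i =
      ∑ S ∈ smallRootSets b k, c S • ∏ i ∈ S, signFun P i)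
    {s : ℂ} (hs : 1 < s.re) : latticeSum (corootCoeff b) (fun _ => false) s =
      ∑ S ∈ smallRootSets b k, c S * latticeSum (corootCoeff b) (parityOutside b S) s := by
  have h := hasSum_sum (s := smallRootSets b k) fun S _ => ((hasSum_lattice_eq_integral
    (corootCoeff b) (parityOutside b S) hs).summable.hasSum.mul_left (c S))
  refine Eq.trans ?_ h.tsum_eq
  refine tsum_congr fun v => ?_
  by_cases hv : IsRegular P (weightOfCoords b v)
  · rw [Finset.sum_congr rfl fun S hS => by rw [prod_latticePow_parityOutside b
      (mem_smallRootSets.mp hS).1 s hv, ← mul_assoc], ← Finset.sum_mul]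
    have h1 := prod_signFun_mul_self (P := P) (positiveRoots b)
    nth_rewrite 2 [hc] at h1
    have h2 := congrFun h1 ⟨_, hv⟩
    simp only [Finset.mul_sum, Finset.sum_apply, Pi.mul_apply, Pi.smul_apply, smul_eq_mul,
      Pi.one_apply] at h2
    rw [Finset.sum_congr rfl fun S _ => ?_, h2, one_mul]
    simp only [Pi.mul_apply]
    ring
  · rw [isRegular_weightOfCoords_iff] at hv
    push Not at hv
    obtain ⟨j, hj⟩ := hv
    rw [Finset.prod_eq_zero (Finset.mem_univ j) (by rw [hj, latticePow_zero_right])]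
    refine (Finset.sum_eq_zero fun S _ => ?_).symm
    rw [Finset.prod_eq_zero (Finset.mem_univ j) (by rw [hj, latticePow_zero_right]), mul_zero]

lemma continuesWithOrder_of_even {K m : ℕ} (hK : m < K) (hm : 0 < m) (he : Even m) :
    ContinuesWithOrder K (latticeSum (corootCoeff b) fun _ => false) m (Module.finrank ℝ M) := by
  refine (continuesWithOrder_latticeSum (corootCoeff b) _ hK hm).mono (le_of_eq ?_)
  rw [Finset.filter_true_of_mem fun k _ => by simp [he]]
  simp [card_support b]

lemma continuesWithOrder_of_odd {K m : ℕ} (hK : m < K) (ho : Odd m) {k : ℕ}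
    (h : ∏ i ∈ positiveRoots b, signFun P i ∈ signSpan P ^ k) :
    ContinuesWithOrder K (latticeSum (corootCoeff b) fun _ => false) m
      (Module.finrank ℝ M - k) := by
  classical
  obtain ⟨c, hc⟩ := exists_coeff_of_mem_signSpan_pow b h
  refine (ContinuesWithOrder.sum hK (S := smallRootSets b k) c (T := fun S =>
    latticeSum (corootCoeff b) (parityOutside b S)) fun S hS => ?_).congr
    fun s h1 _ => (latticeSum_eq_sum b hc h1).symm
  refine (continuesWithOrder_latticeSum (corootCoeff b) _ hK ho.pos).mono ?_
  have h1 := Finset.card_filter_add_card_filter_not (s := Finset.univ)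
    (fun j => parityOutside b S j = true ↔ Odd m)
  have h2 : (Finset.univ.filter fun j => ¬(parityOutside b S j = true ↔ Odd m)).card ≤
      k := by
    refine le_trans ?_ (mem_smallRootSets.mp hS).2
    refine Finset.card_le_card_of_injOn (posIndex b) (fun j hj => ?_)
      (posIndex_injective b).injOn
    simpa [ho, parityOutside] using hj
  rw [Finset.card_univ, Fintype.card_sum, Fintype.card_fin, Fintype.card_fin] at h1
  have h0 := card_support b
  rw [← h0]
  have h3 : ((nonsimpleRoots b).card : ℤ) + b.support.card ≤
      (Finset.univ.filter fun j => (parityOutside b S j = true ↔ Odd m)).card + k := by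
    exact_mod_cast h1.symm.le.trans (Nat.add_le_add_left h2 _)
  have h4 : ((Finset.univ.filter fun j => (parityOutside b S j = true ↔ Odd m)).card : ℤ) =
      (@Finset.filter _ (fun j => (parityOutside b S j = true ↔ Odd m))
        (fun _ => Classical.propDecidable _) Finset.univ).card := by congr!
  rw [h4] at h3
  linarith

/-- The Witten zeta function exists. -/
theorem exists_isWittenZeta : ∃ Z : ℂ → ℂ, IsWittenZeta b Z := by
  obtain ⟨Z, hZ, h⟩ := exists_meromorphic_of_strips
    (D := fun s => ∑' l : dominantWeights b, ((weylDim b (l : M) : ℝ) : ℂ) ^ (-s))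
    (fun s hs => analyticAt_tsum_weylDim b hs) fun K => by
      obtain ⟨F, hF, -, hFT⟩ := (continuesWithOrder_of_even b (K := K + 3) (m := 2) (by omega)
        two_pos even_two)
      refine ⟨fun s => F s / latticeFactor b s, fun s hs => ?_, fun s h1 h2 => ?_⟩
      · refine (hF s ⟨?_, hs.2⟩).div (analyticAt_latticeFactor b s).meromorphicAt
        have : -(K : ℝ) < s.re := hs.1
        push_cast
        linarith
      · show F s / latticeFactor b s = _
        rw [hFT s h1 h2, latticeSum_eq b h1, mul_div_cancel_left₀ _ (latticeFactor_ne_zero b s)]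
  refine ⟨Z, hZ, fun s hs => ?_⟩
  rw [h s hs]
  exact (summable_weylDim b hs).hasSum

variable {b}

lemma IsWittenZeta.le_order {Z : ℂ → ℂ} (hZ : IsWittenZeta b Z) {m : ℕ} {k : ℤ}
    (h : ContinuesWithOrder (m + 1) (latticeSum (corootCoeff b) fun _ => false) m k) :
    (k : WithTop ℤ) ≤ meromorphicOrderAt Z (-(m : ℂ)) := by
  refine h.le_order (Nat.lt_succ_self m) hZ.1 (analyticAt_latticeFactor b)
    (latticeFactor_ne_zero b) fun s h1 _ => ?_
  rw [latticeSum_eq b h1, (hZ.2 s h1).tsum_eq]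

lemma IsWittenZeta.le_order_of_odd {Z : ℂ → ℂ} (hZ : IsWittenZeta b Z) {m : ℕ} (ho : Odd m) {k : ℕ}
    (h : ∏ i ∈ positiveRoots b, signFun P i ∈ signSpan P ^ k) :
    ((Module.finrank ℝ M - k : ℤ) : WithTop ℤ) ≤ meromorphicOrderAt Z (-(m : ℂ)) :=
  hZ.le_order (continuesWithOrder_of_odd b (Nat.lt_succ_self m) ho h)

end SignDegree

end WittenZeta

end

noncomputable section

namespace WittenZeta

section SignRank

set_option linter.unusedSectionVars false

variable {ι M N : Type*} [Fintype ι] [AddCommGroup M] [Module ℝ M] [AddCommGroup N] [Module ℝ N]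
  {P : RootPairing ι ℝ M N}

open RootPairing

lemma coroot'_eq_sum_smul {S : Finset ι} {f : ι → ℝ} (h : ∑ i ∈ S, f i • P.coroot i = 0) (v : M) :
    ∑ i ∈ S, f i * P.coroot' i v = 0 := by
  have := congrArg (P.toLinearMap v) h
  simpa using! this

/-- Signs of linearly dependent coroots satisfy a multiplicative relation. -/
lemma prod_one_add_signFun_eq_zero {C : Finset ι} (hC : C.Nonempty) {f : ι → ℝ}
    (hf : ∀ i ∈ C, f i ≠ 0) (h : ∑ i ∈ C, f i • P.coroot i = 0) :
    ∏ i ∈ C, (1 + ((SignType.sign (f i) : SignType) : ℂ) • signFun P i) = 0 := by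
  funext v
  have h1 := coroot'_eq_sum_smul h (v : M)
  have h2 : ∃ i ∈ C, f i * P.coroot' i (v : M) < 0 := by
    by_contra! hc
    obtain ⟨i, hi⟩ := hC
    exact mul_ne_zero (hf i hi) (v.2 i) ((Finset.sum_eq_zero_iff_of_nonneg hc).mp h1 i hi)
  obtain ⟨i, hi, hlt⟩ := h2
  rw [Finset.prod_apply, Pi.zero_apply]
  refine Finset.prod_eq_zero hi ?_
  simp only [Pi.add_apply, Pi.one_apply, Pi.smul_apply, smul_eq_mul, signFun]
  have h3 := sign_mul (f i) (P.coroot' i (v : M))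
  rw [sign_neg hlt] at h3
  have h4 : ((SignType.sign (f i) : SignType) : ℂ) *
      ((SignType.sign (P.coroot' i (v : M)) : SignType) : ℂ) = ((-1 : SignType) : ℂ) := by
    rw [h3]; simp
  rw [h4]; simp

/-- The product of the signs of a set of coroots has degree at most the rank of the set. -/
theorem prod_signFun_mem_finrank [FiniteDimensional ℝ N] (S : Finset ι) : ∏ i ∈ S, signFun P i ∈
    signSpan P ^ Module.finrank ℝ (Submodule.span ℝ (P.coroot '' (S : Set ι))) := by
  classical
  induction hn : S.card using Nat.strong_induction_on generalizing S with
  | _ n ih =>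
    subst hn
    by_cases hli : LinearIndepOn ℝ P.coroot (S : Set ι)
    · have h1 : Module.finrank ℝ (Submodule.span ℝ (P.coroot '' (S : Set ι))) = S.card := by
        have := finrank_span_eq_card hli
        rw [Set.image_eq_range]
        simpa using! this
      rw [h1]
      exact prod_signFun_mem S
    · rw [linearIndepOn_finset_iff] at hli
      push Not at hli
      obtain ⟨f, hf, i₀, hi₀, hne⟩ := hli
      set C := S.filter fun i => f i ≠ 0 with hC
      have hCS : C ⊆ S := Finset.filter_subset _ _
      have hCn : C.Nonempty := ⟨i₀, Finset.mem_filter.mpr ⟨hi₀, hne⟩⟩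
      have hsum : ∑ i ∈ C, f i • P.coroot i = 0 := by
        rw [← hf, hC, Finset.sum_filter]
        refine Finset.sum_congr rfl fun i _ => ?_
        by_cases h : f i = 0 <;> simp [h]
      have h1 := prod_one_add_signFun_eq_zero hCn (fun i hi => (Finset.mem_filter.mp hi).2) hsum
      rw [Finset.prod_one_add, ← Finset.insert_erase (Finset.mem_powerset_self C),
        Finset.sum_insert (Finset.notMem_erase _ _)] at h1
      set ε : ι → ℂ := fun i => ((SignType.sign (f i) : SignType) : ℂ) with hε
      have hεne : ∏ i ∈ C, ε i ≠ 0 := by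
        refine Finset.prod_ne_zero_iff.mpr fun i hi => ?_
        have : f i ≠ 0 := (Finset.mem_filter.mp hi).2
        simp only [hε]
        rcases lt_or_gt_of_ne this with h | h
        · rw [sign_neg h]; simp
        · rw [sign_pos h]; simp
      have h2 : (∏ i ∈ C, ε i) • ∏ i ∈ S, signFun P i =
          -∑ T ∈ C.powerset.erase C, (∏ i ∈ T, ε i) • ∏ i ∈ (S \ C) ∪ T, signFun P i := by
        rw [eq_neg_iff_add_eq_zero, ← zero_mul (∏ i ∈ S \ C, signFun P i), ← h1, add_mul,
          Finset.sum_mul]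
        congr 1
        · rw [Finset.prod_smul, smul_mul_assoc, mul_comm, Finset.prod_sdiff hCS]
        · refine Finset.sum_congr rfl fun T hT => ?_
          have hTC : T ⊆ C := Finset.mem_powerset.mp (Finset.mem_of_mem_erase hT)
          rw [Finset.prod_smul, smul_mul_assoc, mul_comm, Finset.prod_union]
          exact Finset.disjoint_of_subset_right hTC Finset.sdiff_disjoint
      rw [← Submodule.smul_mem_iff _ hεne, h2]
      refine neg_mem (Submodule.sum_mem _ fun T hT => Submodule.smul_mem _ _ ?_)
      have hTC : T ⊆ C := Finset.mem_powerset.mp (Finset.mem_of_mem_erase hT)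
      have hTS : (S \ C) ∪ T ⊆ S := Finset.union_subset Finset.sdiff_subset (hTC.trans hCS)
      have hss : (S \ C) ∪ T ⊂ S := by
        refine hTS.ssubset_of_ne fun he => ?_
        refine Finset.ne_of_mem_erase hT (hTC.antisymm fun i hi => ?_)
        have : i ∈ (S \ C) ∪ T := by rw [he]; exact hCS hi
        rcases Finset.mem_union.mp this with h | h
        · exact absurd hi (Finset.mem_sdiff.mp h).2
        · exact h
      refine signSpan_pow_mono ?_ (ih _ (Finset.card_lt_card hss) _ rfl)
      exact Submodule.finrank_mono (Submodule.span_mono (Set.image_mono (by exact_mod_cast hTS)))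

lemma IsRegular.neg {v : M} (h : IsRegular P v) : IsRegular P (-v) := fun i => by
  rw [map_neg]; exact neg_ne_zero.mpr (h i)

/-- Precomposition with `v ↦ -v`. -/
def reflectFun (f : {v : M // IsRegular P v} → ℂ) : {v : M // IsRegular P v} → ℂ :=
  fun v => f ⟨-v, v.2.neg⟩

lemma reflectFun_signFun (i : ι) : reflectFun (signFun P i) = -signFun P i := by
  funext v
  simp only [reflectFun, signFun, Pi.neg_apply, map_neg]
  rcases lt_or_gt_of_ne (v.2 i) with h | h
  · rw [sign_neg h, sign_pos (neg_pos.mpr h)]; simp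
  · rw [sign_pos h, sign_neg (neg_neg_of_pos h)]; simp

lemma reflectFun_prod_signFun (S : Finset ι) : reflectFun (∏ i ∈ S, signFun P i) =
    (-1 : ℂ) ^ S.card • ∏ i ∈ S, signFun P i := by
  have h : reflectFun (∏ i ∈ S, signFun P i) = ∏ i ∈ S, reflectFun (signFun P i) := by
    funext v; simp [reflectFun, Finset.prod_apply]
  rw [h, Finset.prod_congr rfl fun i _ => reflectFun_signFun i, Finset.prod_neg,
    Algebra.smul_def]
  simp

lemma add_reflectFun_mem {g : {v : M // IsRegular P v} → ℂ} (hg : g ∈ signSpan P) :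
    g + reflectFun g ∈ signSpan P ^ 0 := by
  refine Submodule.span_induction (p := fun g _ => g + reflectFun g ∈ signSpan P ^ 0)
    ?_ ?_ ?_ ?_ hg
  · rintro _ (rfl | ⟨i, rfl⟩)
    · have h1 : (1 : {v : M // IsRegular P v} → ℂ) ∈ signSpan P ^ 0 := by
        rw [pow_zero]; exact Submodule.one_le.mp le_rfl
      exact add_mem h1 h1
    · rw [reflectFun_signFun, add_neg_cancel]
      exact zero_mem _
  · convert! zero_mem (signSpan P ^ 0) using 1
    funext v; simp [reflectFun]
  · intro f g _ _ h1 h2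
    convert! add_mem h1 h2 using 1
    funext v; simp [reflectFun]; ring
  · intro a f _ h1
    convert! Submodule.smul_mem _ a h1 using 1
    funext v; simp [reflectFun]; ring

lemma sub_reflectFun_mem {k : ℕ} {f : {v : M // IsRegular P v} → ℂ}
    (hf : f ∈ signSpan P ^ (k + 1)) :
    f - (-1 : ℂ) ^ (k + 1) • reflectFun f ∈ signSpan P ^ k := by
  induction k generalizing f with
  | zero =>
    have := add_reflectFun_mem (P := P) (g := f) (by simpa using hf)
    simpa using this
  | succ k ih =>
    rw [pow_succ'] at hf
    refine Submodule.mul_induction_on hf (fun g hg f hf => ?_) fun f g h1 h2 => ?_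
    · have h1 := ih hf
      have h2 := add_reflectFun_mem hg
      have h3 : reflectFun f ∈ signSpan P ^ (k + 1) := by
        have h4 := sub_mem hf (signSpan_pow_mono (Nat.le_succ k) h1)
        rw [sub_sub_cancel] at h4
        exact (Submodule.smul_mem_iff _ (pow_ne_zero _ (by norm_num))).mp h4
      have h5 : g * (f - (-1 : ℂ) ^ (k + 1) • reflectFun f) ∈ signSpan P ^ (k + 1) := by
        rw [pow_succ']; exact Submodule.mul_mem_mul hg h1
      have h6 : (g + reflectFun g) * reflectFun f ∈ signSpan P ^ (k + 1) := by
        have := Submodule.mul_mem_mul h2 h3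
        rwa [← pow_add, zero_add] at this
      convert! sub_mem h5 (Submodule.smul_mem _ ((-1 : ℂ) ^ k) h6) using 1
      funext v
      simp [reflectFun, pow_succ]
      ring
    · convert! add_mem h1 h2 using 1
      funext v; simp [reflectFun]; ring

lemma prod_signFun_mem_of_parity {k : ℕ} {S : Finset ι}
    (h : ∏ i ∈ S, signFun P i ∈ signSpan P ^ (k + 1)) (hk : Even (S.card + k)) :
    ∏ i ∈ S, signFun P i ∈ signSpan P ^ k := by
  have h1 := sub_reflectFun_mem h
  rw [reflectFun_prod_signFun, smul_smul, ← pow_add,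
    Odd.neg_one_pow (by rw [show k + 1 + S.card = S.card + k + 1 by ring]; exact hk.add_one),
    neg_smul, one_smul, sub_neg_eq_add, ← two_smul ℂ] at h1
  exact (Submodule.smul_mem_iff _ two_ne_zero).mp h1

variable [P.IsCrystallographic] [P.IsReduced] (b : P.Base) [P.IsRootSystem]

include b in
lemma finiteDimensional_coweights : FiniteDimensional ℝ N :=
  Module.Finite.of_basis b.toCoweightBasis

include b in
lemma finrank_coweights : Module.finrank ℝ N = Module.finrank ℝ M := by
  rw [Module.finrank_eq_card_basis b.toCoweightBasis, Fintype.card_coe, card_support]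

/-- The product of the signs of the positive coroots has degree at most the rank. -/
lemma prod_signFun_positiveRoots_mem :
    ∏ i ∈ positiveRoots b, signFun P i ∈ signSpan P ^ Module.finrank ℝ M := by
  have := finiteDimensional_coweights b
  refine signSpan_pow_mono ?_ (prod_signFun_mem_finrank (positiveRoots b))
  rw [← finrank_coweights b]
  exact Submodule.finrank_le _

end SignRank

end WittenZeta

end

noncomputable section

namespace WittenZeta

section WeylDegrees

set_option linter.unusedSectionVars false

variable {ι M N : Type*} [Fintype ι] [AddCommGroup M] [Module ℝ M] [AddCommGroup N] [Module ℝ N]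
  {P : RootPairing ι ℝ M N}

open RootPairing Polynomial

/-- A product over the positive roots of `1` or `2X - 1`, by the relative sign of two vectors. -/
def signFactor (x y : ℂ) : ℂ[X] := C (x * y) * (1 + X * C (x * y - 1))

lemma prod_signFactor_eq {κ : Type*} (S : Finset κ) (x y : κ → ℂ) :
    ∏ i ∈ S, signFactor (x i) (y i) = C ((∏ i ∈ S, x i) * ∏ i ∈ S, y i) *
      ∑ T ∈ S.powerset, X ^ T.card * C (∏ i ∈ T, (x i * y i - 1)) := by
  simp only [signFactor, Finset.prod_mul_distrib, Finset.prod_one_add]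
  congr 1
  · rw [← map_prod, Finset.prod_mul_distrib]
  · refine Finset.sum_congr rfl fun T _ => ?_
    rw [Finset.prod_const, map_prod]

lemma sum_ite_eq_of_coeff {S : Finset (Finset ι)} {f : Finset ι → ℂ} (r : ℕ) :
    (∑ T ∈ S, X ^ T.card * C (f T) : ℂ[X]).coeff r = ∑ T ∈ S with T.card = r, f T := by
  rw [finsetSum_coeff, Finset.sum_filter]
  refine Finset.sum_congr rfl fun T _ => ?_
  rw [mul_comm, coeff_C_mul_X_pow]
  simp [eq_comm]

lemma X_pow_mul_eq_of_even {k : ℕ} (hk : Even k) (hk0 : 0 < k) :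
    ∃ u : ℂ[X], u.eval 0 ≠ 0 ∧ (2 * X - 1) ^ k - 1 = X * u := by
  have h0 : ((2 * X - 1) ^ k - 1 : ℂ[X]).eval 0 = 0 := by simp [hk.neg_one_pow]
  obtain ⟨u, hu⟩ := X_dvd_iff.mpr (by rw [← h0, ← coeff_zero_eq_eval_zero])
  refine ⟨u, ?_, hu⟩
  have h1 := congrArg (fun p => (derivative p).eval 0) hu
  have hodd : Odd (k - 1) := Nat.Even.sub_odd hk0 hk odd_one
  simp [derivative_pow, hodd.neg_one_pow] at h1
  rw [← h1]
  exact neg_ne_zero.mpr (mul_ne_zero (Nat.cast_ne_zero.mpr hk0.ne') two_ne_zero)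

lemma prod_degrees_eq (d : Multiset ℕ) (hd : ∀ k ∈ d, 0 < k) : ∃ u : ℂ[X], u.eval 0 ≠ 0 ∧
    (d.map fun k => ((2 * X - 1) ^ k - 1 : ℂ[X])).prod =
      X ^ Multiset.card (d.filter Even) * u := by
  induction d using Multiset.induction_on with
  | empty => exact ⟨1, by simp, by simp⟩
  | cons k d ih =>
    obtain ⟨u, h1, h2⟩ := ih fun j hj => hd j (Multiset.mem_cons_of_mem hj)
    rw [Multiset.map_cons, Multiset.prod_cons, h2]
    by_cases hk : Even k
    · obtain ⟨u', h3, h4⟩ := X_pow_mul_eq_of_even hk (hd k (Multiset.mem_cons_self k d))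
      refine ⟨u' * u, by rw [eval_mul]; exact mul_ne_zero h3 h1, ?_⟩
      rw [h4, Multiset.filter_cons_of_pos _ hk, Multiset.card_cons]
      ring
    · refine ⟨((2 * X - 1) ^ k - 1) * u, ?_, ?_⟩
      · rw [eval_mul]
        refine mul_ne_zero ?_ h1
        simp [(Nat.not_even_iff_odd.mp hk).neg_one_pow]
        norm_num
      · rw [Multiset.filter_cons_of_neg _ hk]
        ring

variable [P.IsCrystallographic] [P.IsReduced] (b : P.Base)

lemma prod_positiveRoots_perm {G : Type*} [CommMonoid G] (w : P.weylGroup) :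
    ∀ {h : ι → G}, (∀ i, h (opp P i) = h i) →
    ∏ i ∈ positiveRoots b, h (P.weylGroupToPerm w i) = ∏ i ∈ positiveRoots b, h i := by
  obtain ⟨u, rfl⟩ := exists_wordProd b w
  induction u with
  | nil => intro h _; rfl
  | cons k u ih =>
    intro h he
    rw [wordProd_cons, map_mul, ← prod_positiveRoots_reflectionPerm_of_even b k.2 h (he _)]
    exact ih (h := fun i => h (P.reflectionPerm k i)) fun i => by
      simp only [reflectionPerm_opp, he]

variable [P.IsRootSystem]

lemma signFun_halfSum (i : ι) (hi : b.IsPos i) : signFun P i ⟨_, isRegular_halfSum b⟩ = 1 := by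
  simp only [signFun]
  rw [sign_pos (coroot'_halfSum_pos b hi)]
  simp

lemma prod_signFactor_halfSum (w : P.weylGroup) :
    ∏ i ∈ positiveRoots b, signFactor (signFun P i ⟨_, isRegular_halfSum b⟩)
      (signFun P i ⟨_, (isRegular_halfSum b).smul w⟩) = (2 * X - 1) ^ weylLength b w := by
  classical
  rw [weylLength_eq_negCount, negCount, ← Finset.prod_pow_eq_pow_sum]
  refine Finset.prod_congr rfl fun i hi => ?_
  rw [signFun_halfSum b i (by simpa using hi), signFactor, one_mul]
  rcases lt_or_gt_of_ne ((isRegular_halfSum b).smul w i) with h | h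
  · rw [if_pos h]
    simp only [signFun, sign_neg h, SignType.coe_neg, SignType.coe_one, map_neg, map_one, map_sub,
      pow_one]
    ring
  · rw [if_neg h.le.not_gt]
    simp only [signFun]
    rw [sign_pos h]
    simp

lemma signFun_smul_eq (w w' : P.weylGroup) (i : ι) :
    signFun P (P.weylGroupToPerm w i) ⟨_, (isRegular_halfSum b).smul w'⟩ =
      signFun P i ⟨_, (isRegular_halfSum b).smul (w⁻¹ * w')⟩ := by
  have h := coroot'_weylGroupToPerm w i ((w⁻¹ * w') • halfSum b)
  rw [← mul_smul, mul_inv_cancel_left] at h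
  simp only [signFun, h]

lemma prod_signFactor_smul (w w' : P.weylGroup) :
    ∏ i ∈ positiveRoots b, signFactor (signFun P i ⟨_, (isRegular_halfSum b).smul w⟩)
      (signFun P i ⟨_, (isRegular_halfSum b).smul w'⟩) =
        (2 * X - 1) ^ weylLength b (w⁻¹ * w') := by
  rw [← prod_signFactor_halfSum, ← prod_positiveRoots_perm b w]
  · refine Finset.prod_congr rfl fun i _ => ?_
    rw [signFun_smul_eq, signFun_smul_eq]
    simp only [inv_mul_cancel, one_smul]
  · intro i
    rw [signFun_opp, signFactor]
    simp [signFactor]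

lemma exists_signFun_eq_halfSum (v : {v : M // IsRegular P v}) :
    ∃ w : P.weylGroup, ∀ i, signFun P i v = signFun P i ⟨_, (isRegular_halfSum b).smul w⟩ := by
  obtain ⟨w, hw⟩ := exists_smul_pos b v.2
  refine ⟨w⁻¹, fun i => ?_⟩
  have h := coroot'_smul_pos_iff b hw (fun i hi => coroot'_halfSum_pos b hi) w⁻¹ i
  rw [inv_smul_smul] at h
  have h1 := (isRegular_halfSum b).smul w⁻¹ i
  simp only [signFun]
  rcases lt_or_gt_of_ne (v.2 i) with h2 | h2
  · rw [sign_neg h2, sign_neg (lt_of_le_of_ne (not_lt.mp fun h3 => (h.mpr h3).not_gt h2) h1)]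
  · rw [sign_pos h2, sign_pos (h.mp h2)]

/-- The Poincaré polynomial at `2X - 1` as a sum over chambers. -/
lemma sum_prod_signFactor [Fintype P.weylGroup] (v : {v : M // IsRegular P v}) :
    ∑ w : P.weylGroup, ∏ i ∈ positiveRoots b, signFactor (signFun P i v)
      (signFun P i ⟨_, (isRegular_halfSum b).smul w⟩) =
    ∑ w : P.weylGroup, (2 * X - 1) ^ weylLength b w := by
  obtain ⟨w, hw⟩ := exists_signFun_eq_halfSum b v
  simp only [hw, prod_signFactor_smul]
  exact Equiv.sum_comp (Equiv.mulLeft w⁻¹) fun w => ((2 * X - 1) ^ weylLength b w : ℂ[X])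

lemma coeff_smul_prod_signFun_mem [Fintype P.weylGroup] (r : ℕ) :
    (∑ w : P.weylGroup, (2 * X - 1) ^ weylLength b w : ℂ[X]).coeff r •
      ∏ i ∈ positiveRoots b, signFun P i ∈ signSpan P ^ r := by
  classical
  have h : (∑ w : P.weylGroup, (2 * X - 1) ^ weylLength b w : ℂ[X]).coeff r •
      ∏ i ∈ positiveRoots b, signFun P i = ∑ w : P.weylGroup,
        (∏ i ∈ positiveRoots b, signFun P i ⟨_, (isRegular_halfSum b).smul w⟩) •
        ∑ T ∈ (positiveRoots b).powerset with T.card = r,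
          ∏ i ∈ T, (signFun P i ⟨_, (isRegular_halfSum b).smul w⟩ • signFun P i - 1) := by
    funext v
    have h1 := congrFun (prod_signFun_mul_self (P := P) (positiveRoots b)) v
    simp only [Pi.mul_apply, Pi.one_apply, Finset.prod_apply] at h1
    simp only [Pi.smul_apply, smul_eq_mul, Finset.sum_apply, Finset.prod_apply, Pi.sub_apply,
      Pi.one_apply]
    rw [← sum_prod_signFactor b v, finsetSum_coeff, Finset.sum_mul]
    refine Finset.sum_congr rfl fun w _ => ?_
    rw [prod_signFactor_eq, coeff_C_mul, sum_ite_eq_of_coeff]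
    simp only [mul_comm (signFun P _ v)]
    linear_combination (norm := ring_nf) (∏ i ∈ positiveRoots b,
      signFun P i ⟨_, (isRegular_halfSum b).smul w⟩) *
      (∑ T ∈ (positiveRoots b).powerset with T.card = r,
        ∏ i ∈ T, (signFun P i ⟨_, (isRegular_halfSum b).smul w⟩ * signFun P i v - 1)) * h1
  rw [h]
  refine Submodule.sum_mem _ fun w _ => Submodule.smul_mem _ _ (Submodule.sum_mem _ fun T hT => ?_)
  rw [← (Finset.mem_filter.mp hT).2]
  generalize T = T
  induction T using Finset.induction_on with
  | empty => rw [Finset.prod_empty, Finset.card_empty, pow_zero]; exact Submodule.one_le.mp le_rfl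
  | insert a S ha ih =>
    rw [Finset.prod_insert ha, Finset.card_insert_of_notMem ha, pow_succ']
    exact Submodule.mul_mem_mul
      (sub_mem (Submodule.smul_mem _ _ (signFun_mem_signSpan a)) one_mem_signSpan) ih

/-- The product of the signs of the positive coroots has degree at most the number of even Weyl
degrees. -/
theorem IsWeylDegrees.prod_signFun_mem {d : Multiset ℕ} (hd : IsWeylDegrees b d) :
    ∏ i ∈ positiveRoots b, signFun P i ∈ signSpan P ^ Multiset.card (d.filter Even) := by
  classical
  have := Fintype.ofFinite P.weylGroup
  obtain ⟨hcard, hpos, hprod⟩ := hd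
  refine (Submodule.smul_mem_iff _ ?_).mp (coeff_smul_prod_signFun_mem b _)
  set r := Multiset.card (d.filter Even)
  set q := (∑ w : P.weylGroup, (2 * X - 1) ^ weylLength b w : ℂ[X]) with hq
  obtain ⟨u, hu, hdu⟩ := prod_degrees_eq d hpos
  have h1 : q * (2 * X - 2) ^ Module.finrank ℝ M = X ^ r * u := by
    rw [← hdu]
    have h2 := congrArg (fun p : ℤ[X] => eval₂ (Int.castRingHom ℂ[X]) (2 * X - 1) p) hprod
    simp only [poincarePolynomial, finsum_eq_sum_of_fintype] at h2
    rw [eval₂_mul, eval₂_finsetSum, eval₂_pow, ← coe_eval₂RingHom, map_multiset_prod] at h2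
    simp only [coe_eval₂RingHom, eval₂_sub, eval₂_X, eval₂_one, eval₂_pow, Multiset.map_map,
      Function.comp_def] at h2
    rw [← h2, hq]
    congr 2
    ring
  have hX : ¬ X ∣ (2 * X - 2 : ℂ[X]) ^ Module.finrank ℝ M := by
    intro h
    have := prime_X.dvd_of_dvd_pow h
    rw [X_dvd_iff, coeff_zero_eq_eval_zero] at this
    simp at this
  obtain ⟨q', hq'⟩ := prime_X.pow_dvd_of_dvd_mul_right r hX ⟨u, h1⟩
  rw [hq'] at h1 ⊢
  rw [coeff_X_pow_mul', if_pos le_rfl, Nat.sub_self, coeff_zero_eq_eval_zero]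
  intro h0
  rw [mul_assoc] at h1
  have h2 := congrArg (eval 0) (mul_left_cancel₀ (pow_ne_zero r X_ne_zero) h1)
  rw [eval_mul, h0, zero_mul] at h2
  exact hu h2.symm

end WeylDegrees

end WittenZeta

end

noncomputable section

namespace WittenZeta

section OrbitSum

set_option linter.unusedSectionVars false

variable {ι M N : Type*} [Fintype ι] [AddCommGroup M] [Module ℝ M] [AddCommGroup N] [Module ℝ N]
  {P : RootPairing ι ℝ M N}

open RootPairing

/-- The product of the signs of two numbers, or `1` if the second one vanishes. -/
def signMul (x y : ℝ) : ℂ :=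
  if y = 0 then 1 else ((SignType.sign x : SignType) : ℂ) * ((SignType.sign y : SignType) : ℂ)

lemma signMul_neg_neg (x y : ℝ) : signMul (-x) (-y) = signMul x y := by
  simp only [signMul, neg_eq_zero, Left.sign_neg]
  split_ifs
  · rfl
  · simp

variable [P.IsCrystallographic] [P.IsReduced] (b : P.Base)

lemma prod_signMul_reflection {k : ι} (hk : k ∈ b.support) (v x : M) :
    ∏ i ∈ positiveRoots b, signMul (P.coroot' i (P.reflection k v))
      (P.coroot' i (P.reflection k x)) =
    ∏ i ∈ positiveRoots b, signMul (P.coroot' i v) (P.coroot' i x) := by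
  rw [← prod_positiveRoots_reflectionPerm_of_even b hk
    (fun i => signMul (P.coroot' i v) (P.coroot' i x))
    (by simp only [coroot'_opp, signMul_neg_neg])]
  refine Finset.prod_congr rfl fun i _ => ?_
  rw [← coroot'_reflectionPerm_reflection k (P.reflectionPerm k i) v,
    ← coroot'_reflectionPerm_reflection k (P.reflectionPerm k i) x, P.reflectionPerm_self]

lemma prod_signMul_of_pos {v : M} (hv : ∀ i, b.IsPos i → 0 < P.coroot' i v) (x : M) :
    ∏ i ∈ positiveRoots b, signMul (P.coroot' i v) (P.coroot' i x) = (-1) ^ negCount b x := by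
  classical
  rw [negCount, ← Finset.prod_pow_eq_pow_sum]
  refine Finset.prod_congr rfl fun i hi => ?_
  rw [signMul, sign_pos (hv i (by simpa using hi))]
  rcases lt_trichotomy (P.coroot' i x) 0 with h | h | h
  · rw [if_neg h.ne, if_pos h, sign_neg h]; simp
  · rw [if_pos h, if_neg h.not_lt]; simp
  · rw [if_neg h.ne', if_neg h.le.not_gt, sign_pos h]; simp

/-- A sum over a set of vectors stable under the Weyl group is constant on regular vectors. -/
lemma sum_prod_signMul {T : Finset M} (hT : ∀ k ∈ b.support, ∀ x ∈ T, P.reflection k x ∈ T)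
    {v : M} (hv : IsRegular P v) :
    ∑ x ∈ T, ∏ i ∈ positiveRoots b, signMul (P.coroot' i v) (P.coroot' i x) =
      ∑ x ∈ T, (-1) ^ negCount b x := by
  have hinv : ∀ k ∈ b.support, ∀ v : M,
      ∑ x ∈ T, ∏ i ∈ positiveRoots b, signMul (P.coroot' i (P.reflection k v)) (P.coroot' i x) =
      ∑ x ∈ T, ∏ i ∈ positiveRoots b, signMul (P.coroot' i v) (P.coroot' i x) := by
    intro k hk v
    refine Finset.sum_nbij' (P.reflection k) (P.reflection k) (hT k hk) (hT k hk)
      (fun x _ => P.reflection_same k x) (fun x _ => P.reflection_same k x) fun x _ => ?_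
    rw [← prod_signMul_reflection b hk, P.reflection_same]
  obtain ⟨w, hw⟩ := exists_smul_pos b hv
  have h1 : ∀ u : List b.support,
      ∑ x ∈ T, ∏ i ∈ positiveRoots b, signMul (P.coroot' i (wordProd b u • v)) (P.coroot' i x) =
      ∑ x ∈ T, ∏ i ∈ positiveRoots b, signMul (P.coroot' i v) (P.coroot' i x) := by
    intro u
    induction u with
    | nil =>
      have h1 : wordProd b [] = 1 := rfl
      rw [h1, one_smul]
    | cons k u ih =>
      rw [wordProd_cons, mul_smul, ofIdx_smul', hinv k k.2, ih]
  obtain ⟨u, rfl⟩ := exists_wordProd b w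
  rw [← h1 u]
  exact Finset.sum_congr rfl fun x _ => prod_signMul_of_pos b hw x

open Classical in
/-- The positive roots whose coroots vanish on a vector. -/
def perpRoots (x : M) : Finset ι := (positiveRoots b).filter fun i => P.coroot' i x = 0

/-- If a stable set of vectors has a nonzero alternating sum, then the degree of the sign of all
positive coroots is bounded by the degrees for the coroots orthogonal to these vectors. -/
theorem prod_signFun_mem_of_orbit {T : Finset M}
    (hT : ∀ k ∈ b.support, ∀ x ∈ T, P.reflection k x ∈ T)
    (hne : ∑ x ∈ T, (-1 : ℂ) ^ negCount b x ≠ 0) {k : ℕ}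
    (hk : ∀ x ∈ T, ∏ i ∈ perpRoots b x, signFun P i ∈ signSpan P ^ k) :
    ∏ i ∈ positiveRoots b, signFun P i ∈ signSpan P ^ k := by
  classical
  have h : (∑ x ∈ T, (-1 : ℂ) ^ negCount b x) • ∏ i ∈ positiveRoots b, signFun P i =
      ∑ x ∈ T, (∏ i ∈ positiveRoots b \ perpRoots b x,
        ((SignType.sign (P.coroot' i x) : SignType) : ℂ)) •
        ∏ i ∈ perpRoots b x, signFun P i := by
    funext v
    simp only [Pi.smul_apply, smul_eq_mul, Finset.sum_apply, Finset.prod_apply]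
    rw [← sum_prod_signMul b hT v.2, Finset.sum_mul]
    refine Finset.sum_congr rfl fun x _ => ?_
    have hsub : perpRoots b x ⊆ positiveRoots b := Finset.filter_subset _ _
    rw [← Finset.prod_sdiff hsub, ← Finset.prod_sdiff hsub,
      Finset.prod_eq_one (s := perpRoots b x)
        (f := fun i => signMul (P.coroot' i (v : M)) (P.coroot' i x))
        fun i hi => if_pos (Finset.mem_filter.mp hi).2,
      mul_one, ← mul_assoc, ← Finset.prod_mul_distrib]
    congr 1
    refine Finset.prod_congr rfl fun i hi => ?_
    have h1 : P.coroot' i x ≠ 0 := fun h0 => (Finset.mem_sdiff.mp hi).2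
      (Finset.mem_filter.mpr ⟨(Finset.mem_sdiff.mp hi).1, h0⟩)
    have h2 := congrFun (signFun_mul_self (P := P) i) v
    simp only [Pi.mul_apply, Pi.one_apply] at h2
    rw [signMul, if_neg h1]
    calc _ = ((SignType.sign (P.coroot' i x) : SignType) : ℂ) * (signFun P i v * signFun P i v) := by
            simp only [signFun]; ring
      _ = _ := by rw [h2, mul_one]
  rw [← Submodule.smul_mem_iff _ hne, h]
  exact Submodule.sum_mem _ fun x hx => Submodule.smul_mem _ _ (hk x hx)

variable [P.IsRootSystem]

lemma prod_signFun_perpRoots_mem {x : M} (hx : x ≠ 0) {n : ℕ} (hn : Module.finrank ℝ M = n + 1) :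
    ∏ i ∈ perpRoots b x, signFun P i ∈ signSpan P ^ n := by
  have := finiteDimensional_coweights b
  refine signSpan_pow_mono ?_ (prod_signFun_mem_finrank (perpRoots b x))
  have h1 : Submodule.span ℝ (P.coroot '' (perpRoots b x : Set ι)) ≤
      LinearMap.ker (P.toLinearMap x) := by
    rw [Submodule.span_le]
    rintro _ ⟨i, hi, rfl⟩
    exact (Finset.mem_filter.mp hi).2
  have h2 : P.toLinearMap x ≠ 0 := fun h0 => hx (P.toPerfPair.injective (by
    rw [map_zero]; exact h0))
  have h3 : Submodule.span ℝ (P.coroot '' (perpRoots b x : Set ι)) < ⊤ :=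
    lt_top_iff_ne_top.mpr fun h => h2 (LinearMap.ker_eq_top.mp (top_le_iff.mp (h ▸ h1)))
  have h4 := Submodule.finrank_lt h3.ne
  rw [finrank_coweights b] at h4
  omega

lemma odd_negCount_reflection (i : ι) : ∀ {v : M}, IsRegular P v →
    Odd (negCount b (P.reflection i v) + negCount b v) := by
  refine b.induction_reflect i (p := fun i => ∀ {v : M}, IsRegular P v →
    Odd (negCount b (P.reflection i v) + negCount b v)) ?_ ?_ ?_
  · intro i ih v hv
    have := ih hv
    rwa [← ofIdx_smul', ← ofIdx_opp, ofIdx_smul'] at this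
  · intro k hk v hv
    rcases lt_or_gt_of_ne (hv k) with h | h
    · rw [← negCount_reflection_of_neg b hk h]
      exact ⟨negCount b (P.reflection k v), by ring⟩
    · rw [negCount_reflection_of_pos b hk h]
      exact ⟨negCount b v, by ring⟩
  · intro i k ih hk v hv
    have hs : ∀ v, IsRegular P v → Odd (negCount b (P.reflection k v) + negCount b v) := by
      intro v hv
      rcases lt_or_gt_of_ne (hv k) with h | h
      · rw [← negCount_reflection_of_neg b hk h]
        exact ⟨negCount b (P.reflection k v), by ring⟩
      · rw [negCount_reflection_of_pos b hk h]
        exact ⟨negCount b v, by ring⟩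
    have h1 := hs v hv
    have h2 := ih (hv.reflection k)
    have h3 := hs _ ((hv.reflection k).reflection i)
    have h4 : P.reflection (P.reflectionPerm k i) v =
        P.reflection k (P.reflection i (P.reflection k v)) := by
      rw [P.reflection_reflectionPerm]; rfl
    rw [h4]
    rw [Nat.odd_iff] at *
    omega

lemma negCount_neg_halfSum : negCount b (-halfSum b) = (positiveRoots b).card := by
  classical
  rw [negCount, Finset.card_eq_sum_ones]
  refine Finset.sum_congr rfl fun i hi => if_pos ?_
  rw [map_neg]
  have := coroot'_halfSum_pos b (i := i) (by simpa using hi)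
  linarith

lemma negCount_halfSum : negCount b (halfSum b) = 0 :=
  negCount_eq_zero b fun _ hi => (coroot'_halfSum_pos b hi).le

open Classical in
/-- The number of positive coroots that do not vanish on a vector. -/
def nonzeroCount (x : M) : ℕ := ∑ i ∈ positiveRoots b, if P.coroot' i x = 0 then 0 else 1

lemma nonzeroCount_smul (w : P.weylGroup) (x : M) :
    nonzeroCount b (w • x) = nonzeroCount b x := by
  classical
  exact sum_positiveRoots_smul b (h := fun y : ℝ => if y = 0 then 0 else 1) (by simp) w x

lemma card_perpRoots_add_nonzeroCount (x : M) :
    (perpRoots b x).card + nonzeroCount b x = (positiveRoots b).card := by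
  classical
  rw [perpRoots, Finset.card_filter, nonzeroCount, ← Finset.sum_add_distrib,
    Finset.card_eq_sum_ones]
  refine Finset.sum_congr rfl fun i _ => ?_
  by_cases h : P.coroot' i x = 0
  · rw [if_pos h, if_pos h]
  · rw [if_neg h, if_neg h]

lemma negCount_eq_nonzeroCount {x : M} (hx : ∀ i, b.IsPos i → P.coroot' i x ≤ 0) :
    negCount b x = nonzeroCount b x := by
  classical
  refine Finset.sum_congr rfl fun i hi => ?_
  have h1 := hx i (by simpa using hi)
  rcases h1.lt_or_eq with h | h
  · rw [if_pos h, if_neg h.ne]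
  · rw [if_neg h.not_lt, if_pos h]

lemma coroot'_nonneg {v : M} (hv : ∀ k ∈ b.support, 0 ≤ P.coroot' k v) {i : ι} (hi : b.IsPos i) :
    0 ≤ P.coroot' i v := by
  obtain ⟨f, h1, h2, h3⟩ := exists_coroot_eq_sum b hi
  have h4 : P.coroot' i v = ∑ j ∈ b.support, (f j : ℝ) * P.coroot' j v := by
    show P.toLinearMap v (P.coroot i) = ∑ j ∈ b.support, (f j : ℝ) * P.toLinearMap v (P.coroot j)
    rw [h3, map_sum]
    simp
  rw [h4]
  exact Finset.sum_nonneg fun k hk => mul_nonneg (by exact_mod_cast h1.le k) (hv k hk)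

end OrbitSum

section CartanCoordinates

set_option linter.unusedSectionVars false

/-- The action of a simple reflection on the coordinates of a weight. -/
def reflectCoords {n : ℕ} (C : Matrix (Fin n) (Fin n) ℤ) (k : Fin n) (y : Fin n → ℤ) :
    Fin n → ℤ :=
  fun j => y j - y k * C k j

variable {ι M N : Type*} [Fintype ι] [AddCommGroup M] [Module ℝ M] [AddCommGroup N] [Module ℝ N]
  {P : RootPairing ι ℝ M N} [P.IsCrystallographic] [P.IsReduced] {b : P.Base} [P.IsRootSystem]
  {n : ℕ} {C : Matrix (Fin n) (Fin n) ℤ} {e : b.support ≃ Fin n}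

lemma pairing_eq_cartan (he : Matrix.reindex e e b.cartanMatrix = C) (i j : Fin n) :
    P.toLinearMap (P.root (e.symm i)) (P.coroot (e.symm j)) = C i j := by
  rw [← he]
  simp only [Matrix.reindex_apply, Matrix.submatrix_apply]
  exact (RootPairing.Base.algebraMap_cartanMatrixIn_apply ℤ b (e.symm i) (e.symm j)).symm

/-- The weight with given coordinates with respect to a numbering of the simple roots. -/
def weightOf (e : b.support ≃ Fin n) (y : Fin n → ℤ) : M := (coords b).symm fun k => (y (e k) : ℝ)

lemma coroot'_weightOf (y : Fin n → ℤ) (k : b.support) :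
    P.coroot' k (weightOf e y) = y (e k) := coroot'_coords_symm b _ k

lemma weightOf_injective : Function.Injective (weightOf e : (Fin n → ℤ) → M) := by
  intro y y' h
  have h1 := (coords b).symm.injective h
  funext i
  simpa using congrFun h1 (e.symm i)

lemma reflection_weightOf (he : Matrix.reindex e e b.cartanMatrix = C) (k : Fin n)
    (y : Fin n → ℤ) :
    P.reflection (e.symm k) (weightOf e y) = weightOf e (reflectCoords C k y) := by
  apply (coords b).injective
  funext j
  have h1 := pairing_eq_cartan he k (e j)
  rw [Equiv.symm_apply_apply] at h1
  have h2 : P.coroot' j (P.root (e.symm k)) = C k (e j) := h1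
  rw [coords_apply, coords_apply, P.reflection_apply, map_sub, map_smul, h2, coroot'_weightOf,
    coroot'_weightOf, coroot'_weightOf, Equiv.apply_symm_apply]
  simp [reflectCoords]

lemma weightOf_one : weightOf e (fun _ => 1) = halfSum b := by
  rw [weightOf, LinearEquiv.symm_apply_eq]
  funext k
  rw [coords_apply, coroot'_halfSum b k.2, Int.cast_one]

lemma weightOf_neg (y : Fin n → ℤ) : weightOf e (-y) = -weightOf e y := by
  rw [weightOf, weightOf, ← map_neg]
  congr 1
  funext k
  simp

/-- Parity of `negCount` along a word taking the half-sum of positive roots to its negative. -/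
lemma even_card_positiveRoots_of_word (he : Matrix.reindex e e b.cartanMatrix = C)
    (u : List (Fin n)) (hu : Even u.length)
    (h : u.foldr (reflectCoords C) (fun _ => 1) = fun _ => -1) : Even (positiveRoots b).card := by
  have key : ∀ u : List (Fin n),
      IsRegular P (weightOf e (u.foldr (reflectCoords C) fun _ => 1)) ∧
      Even (negCount b (weightOf e (u.foldr (reflectCoords C) fun _ => 1)) + u.length) := by
    intro u
    induction u with
    | nil =>
      rw [List.foldr_nil, weightOf_one]
      exact ⟨isRegular_halfSum b, by rw [negCount_halfSum]; exact Even.zero⟩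
    | cons k u ih =>
      rw [List.foldr_cons, ← reflection_weightOf he]
      refine ⟨ih.1.reflection _, ?_⟩
      have h1 := odd_negCount_reflection b (e.symm k : ι) ih.1
      have h2 := ih.2
      rw [List.length_cons]
      rw [Nat.odd_iff] at h1
      rw [Nat.even_iff] at *
      omega
  have h1 := (key u).2
  rw [h, show (fun _ => -1 : Fin n → ℤ) = -fun _ => 1 from rfl, weightOf_neg, weightOf_one,
    negCount_neg_halfSum] at h1
  exact (Nat.even_add.mp h1).mpr hu

end CartanCoordinates

section E6

open CartanMatrix

/-- The coordinates of the weights of the 27-dimensional representation of `E₆`. -/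
def e6Orbit : List (Fin 6 → ℤ) :=
  [![-1, -1, 1, 0, 0, 0], ![-1, 0, 0, 0, 0, 1], ![-1, 0, 0, 0, 1, -1], ![-1, 0, 0, 1, -1, 0],
    ![-1, 0, 1, 0, 0, 0], ![-1, 1, 1, -1, 0, 0], ![0, -1, -1, 1, 0, 0], ![0, -1, 0, 0, 1, 0],
    ![0, -1, 0, 1, -1, 1], ![0, -1, 0, 1, 0, -1], ![0, 0, -1, 1, 0, 0], ![0, 0, 0, -1, 1, 0],
    ![0, 0, 0, 0, -1, 1], ![0, 0, 0, 0, 0, -1], ![0, 0, 1, -1, 0, 1], ![0, 0, 1, -1, 1, -1],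
    ![0, 0, 1, 0, -1, 0], ![0, 1, -1, 0, 0, 0], ![0, 1, 0, -1, 1, 0], ![0, 1, 0, 0, -1, 1],
    ![0, 1, 0, 0, 0, -1], ![1, -1, 0, 0, 0, 0], ![1, 0, -1, 0, 0, 1], ![1, 0, -1, 0, 1, -1],
    ![1, 0, -1, 1, -1, 0], ![1, 0, 0, 0, 0, 0], ![1, 1, 0, -1, 0, 0]]

/-- The parity of the depth of a weight. -/
def e6Depth (y : Fin 6 → ℤ) : ℤ := y 1 + y 2 + y 3 + y 4

lemma e6Orbit_reflectCoords :
    ∀ y ∈ e6Orbit, ∀ k, reflectCoords E₆ k y ∈ e6Orbit := by decide +kernel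

lemma e6Orbit_nodup : e6Orbit.Nodup := by decide +kernel

lemma e6Orbit_dominant : ∀ y ∈ e6Orbit, (∀ k, 0 ≤ y k) → y = ![1, 0, 0, 0, 0, 0] := by
  decide +kernel

lemma e6Orbit_ne_zero : ∀ y ∈ e6Orbit, y ≠ 0 := by decide +kernel

lemma e6Orbit_depth : ∀ y ∈ e6Orbit, ∀ k, y k < 0 →
    (e6Depth (reflectCoords E₆ k y) + e6Depth y) % 2 = 1 := by decide +kernel

lemma e6Orbit_sum : (e6Orbit.map fun y => if e6Depth y % 2 = 0 then (1 : ℤ) else -1).sum = 3 := by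
  decide +kernel

lemma e6_longest_word : List.foldr (reflectCoords E₆) (fun _ => 1)
    [0, 2, 3, 4, 5, 1, 3, 4, 2, 3, 0, 2, 1, 3, 4, 5, 1, 3, 4, 2, 3, 0, 2, 1, 3, 4, 2, 3, 0, 2, 1, 3,
      0, 2, 1, 0] = fun _ => -1 := by decide +kernel

variable {ι M N : Type*} [Fintype ι] [AddCommGroup M] [Module ℝ M] [AddCommGroup N] [Module ℝ N]
  {P : RootPairing ι ℝ M N} [P.IsCrystallographic] [P.IsReduced] {b : P.Base} [P.IsRootSystem]
  {e : b.support ≃ Fin 6}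

lemma negCount_e6Orbit (he : Matrix.reindex e e b.cartanMatrix = E₆) {y : Fin 6 → ℤ}
    (hy : y ∈ e6Orbit) : ((negCount b (weightOf e y) : ℤ) + e6Depth y) % 2 = 0 ∧
      nonzeroCount b (weightOf e y) = nonzeroCount b (weightOf e ![1, 0, 0, 0, 0, 0]) := by
  induction h : negCount b (weightOf e y) generalizing y with
  | zero =>
    have : y = ![1, 0, 0, 0, 0, 0] := by
      refine e6Orbit_dominant y hy fun k => ?_
      have h1 := (Finset.sum_eq_zero_iff.mp h) (e.symm k)
        ((mem_positiveRoots b).mpr (b.isPos_of_mem_support (e.symm k).2))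
      rw [coroot'_weightOf, Equiv.apply_symm_apply] at h1
      by_contra hlt
      rw [if_pos (by exact_mod_cast not_le.mp hlt)] at h1
      exact one_ne_zero h1
    subst this
    exact ⟨by decide, rfl⟩
  | succ m ih =>
    have : ∃ k, y k < 0 := by
      by_contra! hc
      rw [negCount_eq_zero b fun i hi => coroot'_nonneg b (fun k hk => ?_) hi] at h
      · omega
      · have := coroot'_weightOf (e := e) y ⟨k, hk⟩
        rw [this]
        exact_mod_cast hc _
    obtain ⟨k, hk⟩ := this
    have h1 : P.coroot' (e.symm k : ι) (weightOf e y) < 0 := by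
      rw [coroot'_weightOf, Equiv.apply_symm_apply]
      exact_mod_cast hk
    have h2 := negCount_reflection_of_neg b (e.symm k).2 h1
    rw [reflection_weightOf he] at h2
    have h3 := ih (e6Orbit_reflectCoords y hy k) (by omega)
    have h4 := e6Orbit_depth y hy k hk
    have h5 := nonzeroCount_smul b (RootPairing.weylGroup.ofIdx P (e.symm k : ι)) (weightOf e y)
    rw [ofIdx_smul', reflection_weightOf he] at h5
    refine ⟨?_, h5.symm.trans h3.2⟩
    have h6 := h3.1
    push_cast
    omega

/-- For `E₆` the product of the signs of the positive coroots has degree at most `4`. -/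
theorem prod_signFun_mem_of_E6 (h : HasCartanType b E₆) :
    ∏ i ∈ positiveRoots b, signFun P i ∈ signSpan P ^ 4 := by
  classical
  obtain ⟨e, he⟩ := h
  have hrank : Module.finrank ℝ M = 5 + 1 := by
    rw [← card_support b, ← Fintype.card_coe, Fintype.card_congr e, Fintype.card_fin]
  have hN := even_card_positiveRoots_of_word he _ (by decide) e6_longest_word
  have hlow : (![0, 0, 0, 0, 0, -1] : Fin 6 → ℤ) ∈ e6Orbit := by decide +kernel
  have hnz : ∀ y ∈ e6Orbit, Even (nonzeroCount b (weightOf e y)) := by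
    intro y hy
    have h1 := negCount_e6Orbit he hlow
    rw [(negCount_e6Orbit he hy).2, ← h1.2, ← negCount_eq_nonzeroCount]
    · have h2 := h1.1
      rw [show e6Depth ![0, 0, 0, 0, 0, -1] = 0 by decide] at h2
      rw [Nat.even_iff]
      omega
    · intro i hi
      have h3 := coroot'_nonneg b (v := -weightOf e ![0, 0, 0, 0, 0, -1]) (fun k hk => ?_) hi
      · rw [map_neg] at h3
        linarith
      · have h4 := coroot'_weightOf (e := e) ![0, 0, 0, 0, 0, -1] ⟨k, hk⟩
        rw [map_neg, h4, neg_nonneg]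
        have : ∀ j, (![0, 0, 0, 0, 0, -1] : Fin 6 → ℤ) j ≤ 0 := by decide
        exact_mod_cast this _
  refine prod_signFun_mem_of_orbit b
    (T := e6Orbit.toFinset.map ⟨weightOf e, weightOf_injective⟩) ?_ ?_ ?_
  · intro k hk x hx
    obtain ⟨y, hy, rfl⟩ := Finset.mem_map.mp hx
    refine Finset.mem_map.mpr ⟨reflectCoords E₆ (e ⟨k, hk⟩) y, ?_, ?_⟩
    · exact List.mem_toFinset.mpr (e6Orbit_reflectCoords y (List.mem_toFinset.mp hy) _)
    · have := reflection_weightOf he (e ⟨k, hk⟩) y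
      rw [Equiv.symm_apply_apply] at this
      exact this.symm
  · rw [Finset.sum_map, List.sum_toFinset _ e6Orbit_nodup]
    have h1 : e6Orbit.map (fun y => (-1 : ℂ) ^ negCount b (weightOf e y)) =
        e6Orbit.map fun y => ((if e6Depth y % 2 = 0 then (1 : ℤ) else -1 : ℤ) : ℂ) := by
      refine List.map_congr_left fun y hy => ?_
      have h2 := (negCount_e6Orbit he hy).1
      split_ifs with h3
      · rw [Even.neg_one_pow (by rw [Nat.even_iff]; omega)]; simp
      · rw [Odd.neg_one_pow (by rw [Nat.odd_iff]; omega)]; simp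
    have h2 := congrArg (fun z : ℤ => (z : ℂ)) e6Orbit_sum
    simp only [Function.Embedding.coeFn_mk]
    rw [h1]
    simp only [Int.cast_list_sum, List.map_map, Function.comp_def] at h2
    rw [h2]
    norm_num
  · intro x hx
    obtain ⟨y, hy, rfl⟩ := Finset.mem_map.mp hx
    rw [List.mem_toFinset] at hy
    simp only [Function.Embedding.coeFn_mk]
    refine prod_signFun_mem_of_parity (prod_signFun_perpRoots_mem b ?_ hrank) ?_
    · intro h0
      refine e6Orbit_ne_zero y hy (weightOf_injective (e := e) (h0.trans ?_))
      rw [weightOf, eq_comm, LinearEquiv.symm_apply_eq, map_zero]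
      funext k
      simp
    · have h1 := card_perpRoots_add_nonzeroCount b (weightOf e y)
      have h2 := hnz y hy
      rw [Nat.even_iff] at *
      omega

end E6

end WittenZeta

end

noncomputable section

namespace WittenZeta

section SignVandermonde

/-- An alternating sum over a finite set of distinct reals. -/
lemma sum_prod_sign_sub {x : ℕ → ℝ} {J : Finset ℕ} :
    Set.InjOn x J → ∑ j ∈ J, ∏ l ∈ J.erase j, ((SignType.sign (x j - x l) : SignType) : ℂ) =
      if Odd J.card then 1 else 0 := by
  classical
  refine Finset.induction_on_max_value x J (by simp) ?_
  intro a s ha hmax ih hinj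
  have hlt : ∀ l ∈ s, x l < x a := fun l hl => lt_of_le_of_ne (hmax l hl) fun h =>
    ha (hinj (Finset.mem_insert_of_mem hl) (Finset.mem_insert_self a s) h ▸ hl)
  have h1 : ∀ j ∈ s, ∏ l ∈ (insert a s).erase j, ((SignType.sign (x j - x l) : SignType) : ℂ) =
      -∏ l ∈ s.erase j, ((SignType.sign (x j - x l) : SignType) : ℂ) := by
    intro j hj
    have hne : a ≠ j := fun h => ha (h ▸ hj)
    rw [Finset.erase_insert_of_ne hne, Finset.prod_insert fun h => ha (Finset.mem_of_mem_erase h),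
      sign_neg (sub_neg.mpr (hlt j hj))]
    simp
  rw [Finset.sum_insert ha, Finset.erase_insert ha, Finset.sum_congr rfl h1,
    Finset.sum_neg_distrib, ih (hinj.mono (by simp)), Finset.card_insert_of_notMem ha,
    Finset.prod_eq_one fun l hl => by rw [sign_pos (sub_pos.mpr (hlt l hl))]; simp]
  simp only [Nat.odd_add_one]
  by_cases h : Odd s.card <;> simp [h]

variable {Ω : Type*} (x : ℕ → Ω → ℝ)

/-- The sign of a difference, as a function. -/
def signSub (p q : ℕ) : Ω → ℂ := fun ω => ((SignType.sign (x p ω - x q ω) : SignType) : ℂ)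

lemma signSub_swap (p q : ℕ) : signSub x q p = -signSub x p q := by
  funext ω
  simp only [signSub, Pi.neg_apply]
  rw [← neg_sub, Left.sign_neg]
  simp

/-- The pairs in increasing order from a finite set. -/
def increasingPairs (J : Finset ℕ) : Finset (ℕ × ℕ) := (J ×ˢ J).filter fun p => p.1 < p.2

lemma mem_increasingPairs {J : Finset ℕ} {p : ℕ × ℕ} :
    p ∈ increasingPairs J ↔ p.1 ∈ J ∧ p.2 ∈ J ∧ p.1 < p.2 := by
  simp [increasingPairs, and_assoc]

/-- The sign of the Vandermonde product. -/
def signVandermonde (J : Finset ℕ) : Ω → ℂ := ∏ p ∈ increasingPairs J, signSub x p.1 p.2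

variable {x}

lemma signSub_mul_self {p q : ℕ} (h : ∀ ω, x p ω ≠ x q ω) :
    signSub x p q * signSub x p q = 1 := by
  funext ω
  simp only [signSub, Pi.mul_apply, Pi.one_apply]
  rcases lt_or_gt_of_ne (sub_ne_zero.mpr (h ω)) with h | h
  · rw [sign_neg h]; simp
  · rw [sign_pos h]; simp

lemma signVandermonde_erase {J : Finset ℕ} {j : ℕ} (hj : j ∈ J) : ∃ ε : ℂ, (ε = 1 ∨ ε = -1) ∧
    signVandermonde x J = ε • (signVandermonde x (J.erase j) * ∏ l ∈ J.erase j, signSub x j l) := by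
  classical
  have h1 : signVandermonde x J = signVandermonde x (J.erase j) *
      ∏ l ∈ J.erase j, signSub x (min j l) (max j l) := by
    rw [signVandermonde, signVandermonde, ← Finset.prod_filter_mul_prod_filter_not
      (increasingPairs J) (fun p => p.1 ≠ j ∧ p.2 ≠ j)]
    congr 1
    · refine Finset.prod_congr ?_ fun _ _ => rfl
      ext p
      simp only [Finset.mem_filter, mem_increasingPairs, Finset.mem_erase]
      tauto
    · refine (Finset.prod_bij (fun l _ => (min j l, max j l)) ?_ ?_ ?_ fun _ _ => rfl).symm
      · intro l hl
        obtain ⟨h1, h2⟩ := Finset.mem_erase.mp hl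
        simp only [Finset.mem_filter, mem_increasingPairs]
        rcases le_total j l with h | h
        · rw [min_eq_left h, max_eq_right h]
          exact ⟨⟨hj, h2, lt_of_le_of_ne h (Ne.symm h1)⟩, by simp⟩
        · rw [min_eq_right h, max_eq_left h]
          exact ⟨⟨h2, hj, lt_of_le_of_ne h h1⟩, by simp⟩
      · intro l _ l' _ h
        obtain ⟨h3, h4⟩ := Prod.mk.inj h
        omega
      · intro p hp
        simp only [Finset.mem_filter, mem_increasingPairs] at hp
        obtain ⟨⟨h1, h2, h3⟩, h4⟩ := hp
        by_cases h5 : p.1 = j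
        · refine ⟨p.2, Finset.mem_erase.mpr ⟨by omega, h2⟩, Prod.ext ?_ ?_⟩ <;> simp <;> omega
        · have h6 : p.2 = j := by tauto
          refine ⟨p.1, Finset.mem_erase.mpr ⟨h5, h1⟩, Prod.ext ?_ ?_⟩ <;> simp <;> omega
  have h2 : ∀ S : Finset ℕ, ∃ ε : ℂ, (ε = 1 ∨ ε = -1) ∧
      ∏ l ∈ S, signSub x (min j l) (max j l) = ε • ∏ l ∈ S, signSub x j l := by
    intro S
    induction S using Finset.induction_on with
    | empty => exact ⟨1, Or.inl rfl, by simp⟩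
    | insert a S ha ih =>
      obtain ⟨ε, h3, h4⟩ := ih
      rw [Finset.prod_insert ha, Finset.prod_insert ha, h4]
      rcases le_total j a with h | h
      · exact ⟨ε, h3, by rw [min_eq_left h, max_eq_right h, mul_smul_comm]⟩
      · refine ⟨-ε, by rcases h3 with rfl | rfl <;> simp, ?_⟩
        rw [min_eq_right h, max_eq_left h, signSub_swap x j a, mul_smul_comm, neg_mul, smul_neg,
          neg_smul]
  obtain ⟨ε, h3, h4⟩ := h2 (J.erase j)
  exact ⟨ε, h3, by rw [h1, h4, mul_smul_comm]⟩

lemma exists_signVandermonde_mul {J : Finset ℕ}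
    (hne : ∀ p ∈ J, ∀ q ∈ J, p ≠ q → ∀ ω, x p ω ≠ x q ω) {j : ℕ} (hj : j ∈ J) :
    ∃ ε : ℂ, signVandermonde x J * ∏ l ∈ J.erase j, signSub x j l =
      ε • signVandermonde x (J.erase j) := by
  obtain ⟨ε, -, h⟩ := signVandermonde_erase (x := x) hj
  refine ⟨ε, ?_⟩
  rw [h, smul_mul_assoc, mul_assoc, ← Finset.prod_mul_distrib, Finset.prod_eq_one, mul_one]
  intro l hl
  obtain ⟨h1, h2⟩ := Finset.mem_erase.mp hl
  exact signSub_mul_self (hne j hj l h2 h1.symm)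

/-- The sign of the Vandermonde product of `k` functions is a polynomial of degree `⌊k / 2⌋` in the
signs of the differences. -/
theorem signVandermonde_mem {F : Submodule ℂ (Ω → ℂ)} (J : Finset ℕ)
    (hF : ∀ p ∈ J, ∀ q ∈ J, p ≠ q → signSub x p q ∈ F)
    (hne : ∀ p ∈ J, ∀ q ∈ J, p ≠ q → ∀ ω, x p ω ≠ x q ω) :
    signVandermonde x J ∈ F ^ (J.card / 2) := by
  classical
  induction hn : J.card using Nat.strong_induction_on generalizing J with
  | _ n ih =>
    subst hn
    have hmono : ∀ {J' : Finset ℕ}, J' ⊆ J → J'.card < J.card →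
        signVandermonde x J' ∈ F ^ (J'.card / 2) := fun hs hc =>
      ih _ hc _ (fun p hp q hq => hF p (hs hp) q (hs hq))
        (fun p hp q hq => hne p (hs hp) q (hs hq)) rfl
    have hsum : ∀ {J' : Finset ℕ}, J' ⊆ J →
        ∑ j ∈ J', ∏ l ∈ J'.erase j, signSub x j l = if Odd J'.card then 1 else 0 := by
      intro J' hs
      funext ω
      have := sum_prod_sign_sub (x := fun j => x j ω) (J := J') fun p hp q hq h => by
        by_contra hpq
        exact hne p (hs hp) q (hs hq) hpq ω h
      simp only [Finset.sum_apply, Finset.prod_apply, signSub]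
      rw [this]
      split_ifs <;> rfl
    by_cases hodd : Odd J.card
    · have h2 := hsum (subset_refl J)
      rw [if_pos hodd] at h2
      rw [← mul_one (signVandermonde x J), ← h2, Finset.mul_sum]
      refine Submodule.sum_mem _ fun j hj => ?_
      obtain ⟨ε, hε⟩ := exists_signVandermonde_mul hne hj
      have hc := Finset.card_erase_add_one hj
      have h3 := hmono (Finset.erase_subset j J) (by omega)
      rw [show (J.erase j).card / 2 = J.card / 2 by rw [Nat.odd_iff] at hodd; omega] at h3
      rw [hε]
      exact Submodule.smul_mem _ _ h3
    · rcases J.eq_empty_or_nonempty with rfl | ⟨j₀, hj₀⟩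
      · have : signVandermonde x ∅ = 1 := by simp [signVandermonde, increasingPairs]
        rw [this, Finset.card_empty, pow_zero]
        exact Submodule.one_le.mp le_rfl
      · have h2 := hsum (subset_refl J)
        rw [if_neg hodd, ← Finset.add_sum_erase _ _ hj₀] at h2
        set J' := J.erase j₀ with hJ'
        have hc := Finset.card_erase_add_one hj₀
        have hs : J' ⊆ J := Finset.erase_subset _ _
        obtain ⟨ε, -, hε⟩ := signVandermonde_erase (x := x) hj₀
        rw [← hJ'] at hε hc
        rw [hε, eq_neg_of_add_eq_zero_left h2, mul_neg, Finset.mul_sum]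
        refine Submodule.smul_mem _ _ (neg_mem (Submodule.sum_mem _ fun j hj => ?_))
        obtain ⟨hj1, hj2⟩ := Finset.mem_erase.mp hj
        have hj₀' : j₀ ∈ J.erase j := Finset.mem_erase.mpr ⟨hj1.symm, hj₀⟩
        rw [← Finset.mul_prod_erase _ _ hj₀', Finset.erase_right_comm, ← hJ']
        obtain ⟨ε', hε'⟩ := exists_signVandermonde_mul
          (fun p hp q hq => hne p (hs hp) q (hs hq)) hj
        have hc' := Finset.card_erase_add_one hj
        have h3 := hmono ((Finset.erase_subset j J').trans hs) (by omega)
        rw [Nat.not_odd_iff_even, Nat.even_iff] at hodd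
        have h4 : J.card / 2 = (J'.erase j).card / 2 + 1 := by omega
        rw [mul_left_comm, hε', h4, pow_succ']
        exact Submodule.mul_mem_mul (hF j hj2 j₀ hj₀ hj1) (Submodule.smul_mem _ _ h3)

end SignVandermonde

section TypeA

set_option linter.unusedSectionVars false

variable {ι M N : Type*} [Fintype ι] [AddCommGroup M] [Module ℝ M] [AddCommGroup N] [Module ℝ N]
  {P : RootPairing ι ℝ M N} [P.IsCrystallographic] [P.IsReduced] {b : P.Base} [P.IsRootSystem]
  {n : ℕ} {C : Matrix (Fin n) (Fin n) ℤ} {e : b.support ≃ Fin n}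

lemma toLinearMap_reflection (k : ι) (v : M) (c : N) :
    P.toLinearMap (P.reflection k v) c = P.toLinearMap v (P.coreflection k c) := by
  simp only [P.reflection_apply, P.coreflection_apply, map_sub, map_smul, LinearMap.sub_apply,
    LinearMap.smul_apply, smul_eq_mul]
  simp only [RootPairing.coroot', RootPairing.root', LinearMap.flip_apply]
  ring

/-- The simple coroots, numbered by natural numbers. -/
def simpleCoroot (e : b.support ≃ Fin n) (k : ℕ) : N :=
  if h : k < n then P.coroot (e.symm ⟨k, h⟩) else 0

lemma simpleCoroot_of_lt {k : ℕ} (h : k < n) :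
    simpleCoroot e k = P.coroot (e.symm ⟨k, h⟩) := dif_pos h

lemma halfSum_simpleCoroot {k : ℕ} (h : k < n) :
    P.toLinearMap (halfSum b) (simpleCoroot e k) = 1 := by
  rw [simpleCoroot_of_lt h]
  exact coroot'_halfSum b (e.symm ⟨k, h⟩).2

lemma isPos_of_halfSum_pos {i : ι} (h : 0 < P.coroot' i (halfSum b)) : b.IsPos i := by
  by_contra hi
  have := coroot'_halfSum_pos b ((isPos_opp b i).mpr hi)
  rw [coroot'_opp] at this
  linarith

/-- Vectors whose consecutive differences are the simple coroots. -/
def partialCoroot (e : b.support ≃ Fin n) (j : ℕ) : N := -∑ i ∈ Finset.range j, simpleCoroot e i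

lemma partialCoroot_succ (j : ℕ) :
    partialCoroot e (j + 1) = partialCoroot e j - simpleCoroot e j := by
  simp [partialCoroot, Finset.sum_range_succ]
  abel

lemma halfSum_partialCoroot {j : ℕ} (hj : j ≤ n) :
    P.toLinearMap (halfSum b) (partialCoroot e j) = -j := by
  induction j with
  | zero => simp [partialCoroot]
  | succ j ih =>
    rw [partialCoroot_succ, map_sub, ih (by omega), halfSum_simpleCoroot (by omega)]
    push_cast
    ring

lemma root_partialCoroot (he : Matrix.reindex e e b.cartanMatrix = CartanMatrix.A n) {k : ℕ}
    (hk : k < n) {j : ℕ} (hj : j ≤ n) :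
    P.toLinearMap (P.root (e.symm ⟨k, hk⟩)) (partialCoroot e j) =
      (if j = k then 1 else 0) - (if j = k + 1 then 1 else 0) - (if k = 0 then 1 else 0) := by
  induction j with
  | zero => simp [partialCoroot, eq_comm]
  | succ j ih =>
    rw [partialCoroot_succ, map_sub, ih (by omega), simpleCoroot_of_lt (show j < n by omega),
      pairing_eq_cartan he]
    simp only [CartanMatrix.A, Matrix.of_apply, Fin.mk.injEq]
    split_ifs <;> first | omega | (push_cast; ring)

lemma coreflection_partialCoroot_sub
    (he : Matrix.reindex e e b.cartanMatrix = CartanMatrix.A n) {k : ℕ} (hk : k < n) {p q : ℕ}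
    (hp : p ≤ n) (hq : q ≤ n) :
    P.coreflection (e.symm ⟨k, hk⟩) (partialCoroot e p - partialCoroot e q) =
      partialCoroot e (Equiv.swap k (k + 1) p) - partialCoroot e (Equiv.swap k (k + 1) q) := by
  have key : ∀ p ≤ n, P.coreflection (e.symm ⟨k, hk⟩) (partialCoroot e p) =
      partialCoroot e (Equiv.swap k (k + 1) p) +
        (if k = 0 then (1 : ℝ) else 0) • simpleCoroot e k := by
    intro p hp
    have h1 : P.root' (e.symm ⟨k, hk⟩) (partialCoroot e p) = _ := root_partialCoroot he hk hp
    rw [P.coreflection_apply, h1, ← simpleCoroot_of_lt hk]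
    have h2 := partialCoroot_succ (e := e) k
    rw [Equiv.swap_apply_def]
    by_cases h3 : p = k
    · subst h3
      rw [if_pos rfl, if_neg (Nat.succ_ne_self p).symm, if_pos rfl, h2]
      module
    · by_cases h4 : p = k + 1
      · subst h4
        rw [if_neg h3, if_pos rfl, if_neg h3, if_pos rfl, h2]
        module
      · rw [if_neg h3, if_neg h4, if_neg h3, if_neg h4]
        module
  rw [map_sub, key p hp, key q hq]
  abel

lemma swap_le {k p : ℕ} (hk : k < n) (hp : p ≤ n) : Equiv.swap k (k + 1) p ≤ n := by
  rw [Equiv.swap_apply_def]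
  split_ifs <;> omega

lemma exists_coroot_eq_partialCoroot_sub
    (he : Matrix.reindex e e b.cartanMatrix = CartanMatrix.A n) (i : ι) :
    ∃ p ≤ n, ∃ q ≤ n, p ≠ q ∧ P.coroot i = partialCoroot e p - partialCoroot e q := by
  refine b.induction_reflect i (p := fun i => ∃ p ≤ n, ∃ q ≤ n, p ≠ q ∧
    P.coroot i = partialCoroot e p - partialCoroot e q) ?_ ?_ ?_
  · rintro i ⟨p, hp, q, hq, hne, h⟩
    exact ⟨q, hq, p, hp, hne.symm, (coroot_opp i).trans (by rw [h, neg_sub])⟩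
  · intro i hi
    refine ⟨e ⟨i, hi⟩, by omega, e ⟨i, hi⟩ + 1, by omega, by omega, ?_⟩
    rw [partialCoroot_succ, sub_sub_cancel, simpleCoroot_of_lt (e ⟨i, hi⟩).2]
    simp
  · rintro i j ⟨p, hp, q, hq, hne, h⟩ hj
    have h1 := coreflection_partialCoroot_sub he (e ⟨j, hj⟩).2 hp hq
    rw [Fin.eta, Equiv.symm_apply_apply, ← h, ← P.coroot_reflectionPerm] at h1
    exact ⟨_, swap_le (e ⟨j, hj⟩).2 hp, _, swap_le (e ⟨j, hj⟩).2 hq,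
      fun h2 => hne (Equiv.injective _ h2), h1⟩

lemma exists_index_of_lt (he : Matrix.reindex e e b.cartanMatrix = CartanMatrix.A n) {p q : ℕ}
    (hpq : p < q) (hq : q ≤ n) : ∃ i, P.coroot i = partialCoroot e p - partialCoroot e q := by
  induction q, hpq using Nat.le_induction with
  | base =>
    refine ⟨e.symm ⟨p, hq⟩, ?_⟩
    rw [partialCoroot_succ, sub_sub_cancel, simpleCoroot_of_lt hq]
  | succ q hpq ih =>
    obtain ⟨i, hi⟩ := ih (by omega)
    refine ⟨P.reflectionPerm (e.symm ⟨q, hq⟩) i, ?_⟩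
    rw [P.coroot_reflectionPerm, hi, coreflection_partialCoroot_sub he hq (by omega) (by omega),
      Equiv.swap_apply_left, Equiv.swap_apply_of_ne_of_ne (by omega) (by omega)]

lemma partialCoroot_sub_injective {p q p' q' : ℕ} (hpq : p < q) (hq : q ≤ n) (hpq' : p' < q')
    (hq' : q' ≤ n)
    (h : partialCoroot e p - partialCoroot e q = partialCoroot e p' - partialCoroot e q') :
    p = p' ∧ q = q' := by
  have h1 : ∀ i (hi : i < n) {j : ℕ}, j ≤ n →
      P.toLinearMap (weightOf e (Pi.single ⟨i, hi⟩ 1)) (partialCoroot e j) =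
        if i < j then -1 else 0 := by
    intro i hi j hj
    induction j with
    | zero => simp [partialCoroot]
    | succ j ih =>
      have h2 := coroot'_weightOf (e := e) (Pi.single ⟨i, hi⟩ 1) (e.symm ⟨j, hj⟩)
      rw [Equiv.apply_symm_apply] at h2
      rw [partialCoroot_succ, map_sub, ih (by omega), simpleCoroot_of_lt hj]
      refine (congrArg _ h2).trans ?_
      by_cases h3 : j = i
      · subst h3; simp
      · rw [Pi.single_eq_of_ne (by simpa using h3), Int.cast_zero, sub_zero]
        split_ifs <;> first | rfl | omega
  have h2 : ∀ i < n, ((if i < p then (-1 : ℝ) else 0) - if i < q then -1 else 0) =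
      (if i < p' then (-1 : ℝ) else 0) - if i < q' then -1 else 0 := by
    intro i hi
    have h3 := congrArg (P.toLinearMap (weightOf e (Pi.single ⟨i, hi⟩ 1))) h
    rwa [map_sub, map_sub, h1 i hi (by omega), h1 i hi hq, h1 i hi (by omega), h1 i hi hq'] at h3
  have hp : p = p' := by
    by_contra hne
    rcases lt_or_gt_of_ne hne with h3 | h3
    · have := h2 p (by omega)
      rw [if_neg (lt_irrefl p), if_pos hpq, if_pos h3, if_pos (by omega)] at this
      norm_num at this
    · have := h2 p' (by omega)
      rw [if_pos h3, if_pos (by omega), if_neg (lt_irrefl p'), if_pos hpq'] at this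
      norm_num at this
  refine ⟨hp, ?_⟩
  by_contra hne
  rcases lt_or_gt_of_ne hne with h3 | h3
  · have := h2 q (by omega)
    rw [if_neg (by omega), if_neg (lt_irrefl q), if_neg (by omega), if_pos h3] at this
    norm_num at this
  · have := h2 q' (by omega)
    rw [if_neg (by omega), if_pos h3, if_neg (by omega), if_neg (lt_irrefl q')] at this
    norm_num at this

/-- For `A n` the product of the signs of the positive coroots has degree at most
`⌊(n + 1) / 2⌋`. -/
theorem prod_signFun_mem_of_A (h : HasCartanType b (CartanMatrix.A n)) :
    ∏ i ∈ positiveRoots b, signFun P i ∈ signSpan P ^ ((n + 1) / 2) := by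
  classical
  obtain ⟨e, he⟩ := h
  let x : ℕ → {v : M // IsRegular P v} → ℝ := fun p v => P.toLinearMap v (partialCoroot e p)
  have hsub : ∀ {i : ι} {p q : ℕ}, P.coroot i = partialCoroot e p - partialCoroot e q →
      ∀ v : {v : M // IsRegular P v}, P.coroot' i (v : M) = x p v - x q v := by
    intro i p q hi v
    show P.toLinearMap (v : M) (P.coroot i) = _
    rw [hi, map_sub]
  have hsign : ∀ {i : ι} {p q : ℕ}, P.coroot i = partialCoroot e p - partialCoroot e q →
      signSub x p q = signFun P i := by
    intro i p q hi
    funext v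
    simp only [signSub, signFun]
    rw [hsub hi v]
  have hex : ∀ p ∈ Finset.range (n + 1), ∀ q ∈ Finset.range (n + 1), p ≠ q →
      ∃ i, P.coroot i = partialCoroot e p - partialCoroot e q := by
    intro p hp q hq hne
    rw [Finset.mem_range] at hp hq
    rcases lt_or_gt_of_ne hne with h | h
    · exact exists_index_of_lt he h (by omega)
    · obtain ⟨i, hi⟩ := exists_index_of_lt he h (by omega)
      exact ⟨opp P i, by rw [coroot_opp, hi, neg_sub]⟩
  have hmem := signVandermonde_mem (x := x) (F := signSpan P) (Finset.range (n + 1))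
    (fun p hp q hq hne => by
      obtain ⟨i, hi⟩ := hex p hp q hq hne
      rw [hsign hi]
      exact signFun_mem_signSpan i)
    (fun p hp q hq hne v => by
      obtain ⟨i, hi⟩ := hex p hp q hq hne
      have := v.2 i
      rw [hsub hi v] at this
      exact sub_ne_zero.mp this)
  rw [Finset.card_range] at hmem
  refine (congrArg (· ∈ signSpan P ^ ((n + 1) / 2)) ?_).mp hmem
  have hpos : ∀ {i : ι} {p q : ℕ}, p ≤ n → q ≤ n →
      P.coroot i = partialCoroot e p - partialCoroot e q → (b.IsPos i ↔ p < q) := by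
    intro i p q hp hq hi
    have h1 : P.coroot' i (halfSum b) = (q : ℝ) - p := by
      show P.toLinearMap _ (P.coroot i) = _
      rw [hi, map_sub, halfSum_partialCoroot hp, halfSum_partialCoroot hq]
      ring
    constructor
    · intro h
      have := coroot'_halfSum_pos b h
      rw [h1, sub_pos] at this
      exact_mod_cast this
    · intro h
      refine isPos_of_halfSum_pos (b := b) ?_
      rw [h1, sub_pos]
      exact_mod_cast h
  have hall : ∀ p ∈ increasingPairs (Finset.range (n + 1)),
      ∃ i, P.coroot i = partialCoroot e p.1 - partialCoroot e p.2 := by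
    intro p hp
    rw [mem_increasingPairs] at hp
    exact hex _ hp.1 _ hp.2.1 hp.2.2.ne
  choose φ hφ using hall
  refine Finset.prod_bij φ ?_ ?_ ?_ ?_
  · intro p hp
    have h1 := mem_increasingPairs.mp hp
    rw [Finset.mem_range, Finset.mem_range] at h1
    exact (mem_positiveRoots b).mpr ((hpos (by omega) (by omega) (hφ p hp)).mpr h1.2.2)
  · intro p hp q hq h
    have h1 := mem_increasingPairs.mp hp
    have h2 := mem_increasingPairs.mp hq
    rw [Finset.mem_range, Finset.mem_range] at h1 h2
    have h3 := (hφ p hp).symm.trans ((congrArg P.coroot h).trans (hφ q hq))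
    obtain ⟨h4, h5⟩ := partialCoroot_sub_injective h1.2.2 (by omega) h2.2.2 (by omega) h3
    exact Prod.ext h4 h5
  · intro i hi
    obtain ⟨p, hp, q, hq, -, h1⟩ := exists_coroot_eq_partialCoroot_sub he i
    have h2 := (hpos hp hq h1).mp ((mem_positiveRoots b).mp hi)
    have h3 : (p, q) ∈ increasingPairs (Finset.range (n + 1)) :=
      mem_increasingPairs.mpr ⟨Finset.mem_range.mpr (by omega), Finset.mem_range.mpr (by omega), h2⟩
    exact ⟨(p, q), h3, P.coroot.injective ((hφ _ h3).trans h1.symm)⟩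
  · intro p hp
    exact hsign (hφ p hp)

end TypeA

end WittenZeta

end

noncomputable section

namespace WittenZeta

section TypeD

set_option linter.unusedSectionVars false

variable {ι M N : Type*} [Fintype ι] [AddCommGroup M] [Module ℝ M] [AddCommGroup N] [Module ℝ N]
  {P : RootPairing ι ℝ M N} [P.IsCrystallographic] [P.IsReduced] {b : P.Base} [P.IsRootSystem]
  {m : ℕ} {e : b.support ≃ Fin (m + 3)}

/-- An orthogonal frame in which the simple coroots of type `D` are the differences of consecutive
vectors and the sum of the last two. -/
def frameD (e : b.support ≃ Fin (m + 3)) (j : ℕ) : N :=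
  (1 / 2 : ℝ) • (simpleCoroot e (m + 2) - simpleCoroot e (m + 1)) +
    ∑ i ∈ Finset.Ico j (m + 2), simpleCoroot e i

lemma frameD_last : frameD e (m + 2) =
    (1 / 2 : ℝ) • (simpleCoroot e (m + 2) - simpleCoroot e (m + 1)) := by
  simp [frameD]

lemma frameD_of_lt {j : ℕ} (hj : j < m + 2) :
    frameD e j = simpleCoroot e j + frameD e (j + 1) := by
  rw [frameD, frameD, Finset.sum_eq_sum_Ico_succ_bot hj]
  abel

lemma simpleCoroot_eq_frameD_sub {j : ℕ} (hj : j < m + 2) :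
    simpleCoroot e j = frameD e j - frameD e (j + 1) := by
  rw [frameD_of_lt hj, add_sub_cancel_right]

lemma simpleCoroot_last_eq : simpleCoroot e (m + 2) = frameD e (m + 1) + frameD e (m + 2) := by
  rw [frameD_of_lt (by omega), frameD_last]
  module

lemma root_frameD (he : Matrix.reindex e e b.cartanMatrix = CartanMatrix.D (m + 3)) {k : ℕ}
    (hk : k < m + 3) {j : ℕ} (hj : j ≤ m + 2) :
    P.toLinearMap (P.root (e.symm ⟨k, hk⟩)) (frameD e j) = if k = m + 2 then
      (if j = m + 1 then 1 else 0) + (if j = m + 2 then 1 else 0) else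
      (if j = k then 1 else 0) - (if j = k + 1 then 1 else 0) := by
  induction hj using Nat.decreasingInduction with
  | self =>
    rw [frameD_last, map_smul, map_sub, simpleCoroot_of_lt (by omega),
      simpleCoroot_of_lt (by omega), pairing_eq_cartan he, pairing_eq_cartan he]
    simp only [CartanMatrix.D, Matrix.of_apply, Fin.mk.injEq, smul_eq_mul]
    split_ifs <;> first | omega | (push_cast; norm_num; done) | (exfalso; simp only [or_true, true_or, and_true] at *; omega)
  | of_succ j hj ih =>
    rw [frameD_of_lt hj, map_add, ih, simpleCoroot_of_lt (by omega), pairing_eq_cartan he]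
    simp only [CartanMatrix.D, Matrix.of_apply, Fin.mk.injEq]
    split_ifs <;> first | omega | (push_cast; norm_num)

lemma coreflection_frameD (he : Matrix.reindex e e b.cartanMatrix = CartanMatrix.D (m + 3)) {k : ℕ}
    (hk : k < m + 2) {j : ℕ} (hj : j ≤ m + 2) :
    P.coreflection (e.symm ⟨k, by omega⟩) (frameD e j) = frameD e (Equiv.swap k (k + 1) j) := by
  have h1 : P.root' (e.symm ⟨k, by omega⟩) (frameD e j) = _ := root_frameD he (by omega) hj
  rw [P.coreflection_apply, h1, ← simpleCoroot_of_lt (by omega), simpleCoroot_eq_frameD_sub hk,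
    if_neg (by omega), Equiv.swap_apply_def]
  by_cases h3 : j = k
  · subst h3
    simp
  · by_cases h4 : j = k + 1
    · subst h4
      simp
    · simp [h3, h4]

/-- The sum of two consecutive vectors of the frame is a coroot. -/
lemma exists_coroot_eq_frameD_add
    (he : Matrix.reindex e e b.cartanMatrix = CartanMatrix.D (m + 3)) {j : ℕ} (hj : j ≤ m + 1) :
    ∃ β, P.coroot β = frameD e j + frameD e (j + 1) ∧ ∀ i ≤ m + 2,
      P.toLinearMap (P.root β) (frameD e i) =
        (if i = j then 1 else 0) + (if i = j + 1 then 1 else 0) := by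
  induction hj using Nat.decreasingInduction with
  | self =>
    refine ⟨e.symm ⟨m + 2, by omega⟩, ?_, fun i hi => ?_⟩
    · rw [← simpleCoroot_of_lt, simpleCoroot_last_eq]
    · rw [root_frameD he _ hi, if_pos rfl]
  | of_succ j hj ih =>
    obtain ⟨β, h1, h2⟩ := ih
    refine ⟨P.reflectionPerm (e.symm ⟨j + 1, by omega⟩)
      (P.reflectionPerm (e.symm ⟨j, by omega⟩) β), ?_, fun i hi => ?_⟩
    · rw [P.coroot_reflectionPerm, P.coroot_reflectionPerm, h1, map_add,
        coreflection_frameD he (by omega) (by omega), coreflection_frameD he (by omega) (by omega),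
        Equiv.swap_apply_right, Equiv.swap_apply_of_ne_of_ne (by omega) (by omega), map_add,
        coreflection_frameD he (by omega) (by omega), coreflection_frameD he (by omega) (by omega),
        Equiv.swap_apply_right, Equiv.swap_apply_of_ne_of_ne (by omega) (by omega)]
    · have hle : Equiv.swap (j + 1) (j + 1 + 1) i ≤ m + 2 := swap_le (by omega) hi
      rw [P.root_reflectionPerm, P.root_reflectionPerm, toLinearMap_reflection,
        toLinearMap_reflection, coreflection_frameD he (by omega) hi,
        coreflection_frameD he (by omega) hle, h2 _ (swap_le (by omega) hle)]
      simp only [Equiv.swap_apply_def]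
      split_ifs <;> first | omega | norm_num

/-- Pairs of coordinates can be negated by an even number of reflections. -/
lemma exists_negate_frameD (he : Matrix.reindex e e b.cartanMatrix = CartanMatrix.D (m + 3))
    (t : ℕ) (ht : 2 * t ≤ m + 2) : ∃ v : M, IsRegular P v ∧ Even (negCount b v) ∧
      ∀ i ≤ m + 2, P.toLinearMap v (frameD e i) =
        (if i < 2 * t then -1 else 1) * P.toLinearMap (halfSum b) (frameD e i) := by
  induction t with
  | zero =>
    exact ⟨halfSum b, isRegular_halfSum b, by rw [negCount_halfSum]; exact Even.zero,
      fun i _ => by simp⟩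
  | succ t ih =>
    obtain ⟨v, h1, h2, h3⟩ := ih (by omega)
    obtain ⟨β, h4, h5⟩ := exists_coroot_eq_frameD_add he (j := 2 * t) (by omega)
    have hk : 2 * t < m + 2 := by omega
    refine ⟨P.reflection (e.symm ⟨2 * t, by omega⟩) (P.reflection β v),
      (h1.reflection β).reflection _, ?_, fun i hi => ?_⟩
    · have h6 := odd_negCount_reflection b β h1
      have h7 := odd_negCount_reflection b (e.symm ⟨2 * t, by omega⟩ : ι) (h1.reflection β)
      rw [Nat.odd_iff] at h6 h7
      rw [Nat.even_iff] at *
      omega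
    · have hcore : ∀ i ≤ m + 2, P.coreflection β (frameD e i) =
          frameD e i - ((if i = 2 * t then (1 : ℝ) else 0) +
            (if i = 2 * t + 1 then 1 else 0)) • (frameD e (2 * t) + frameD e (2 * t + 1)) := by
        intro i hi
        have h6 : P.root' β (frameD e i) = _ := h5 i hi
        rw [P.coreflection_apply, h6, h4]
      rw [toLinearMap_reflection, toLinearMap_reflection, coreflection_frameD he hk hi,
        hcore _ (swap_le (by omega) hi), map_sub, map_smul, map_add, h3 _ (swap_le (by omega) hi),
        h3 _ (show 2 * t ≤ m + 2 by omega), h3 _ (show 2 * t + 1 ≤ m + 2 by omega)]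
      rw [Equiv.swap_apply_def]
      by_cases h6 : i = 2 * t
      · subst h6
        simp
      · by_cases h7 : i = 2 * t + 1
        · subst h7
          simp only [h6, if_true, if_false, Nat.lt_irrefl]
          rw [if_pos (show 2 * t + 1 < 2 * (t + 1) by omega)]
          simp
        · rw [if_neg h6, if_neg h7, if_neg h6, if_neg h7]
          have : i < 2 * t ↔ i < 2 * (t + 1) := by omega
          simp [this]

lemma even_card_positiveRoots_of_D
    (he : Matrix.reindex e e b.cartanMatrix = CartanMatrix.D (m + 3)) (hm : Even m) :
    Even (positiveRoots b).card := by
  obtain ⟨t, ht⟩ := hm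
  obtain ⟨v, -, h2, h3⟩ := exists_negate_frameD he (t + 1) (by omega)
  have hlast : P.toLinearMap (halfSum b) (frameD e (m + 2)) = 0 := by
    rw [frameD_last, map_smul, map_sub, halfSum_simpleCoroot (by omega),
      halfSum_simpleCoroot (by omega)]
    simp
  have h4 : ∀ i ≤ m + 2, P.toLinearMap v (frameD e i) =
      P.toLinearMap (-halfSum b) (frameD e i) := by
    intro i hi
    rw [h3 i hi, map_neg, LinearMap.neg_apply]
    split_ifs with h5
    · ring
    · have : i = m + 2 := by omega
      rw [this, hlast]
      ring
  have h5 : ∀ k < m + 3, P.toLinearMap v (simpleCoroot e k) =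
      P.toLinearMap (-halfSum b) (simpleCoroot e k) := by
    intro k hk
    by_cases h6 : k = m + 2
    · rw [h6, simpleCoroot_last_eq, map_add, map_add, h4 _ (by omega), h4 _ (by omega)]
    · rw [simpleCoroot_eq_frameD_sub (by omega), map_sub, map_sub, h4 _ (by omega),
        h4 _ (by omega)]
  have h6 : v = -halfSum b := by
    apply (coords b).injective
    funext k
    have h7 := h5 (e k) (e k).2
    rw [simpleCoroot_of_lt (e k).2, Fin.eta, Equiv.symm_apply_apply] at h7
    rw [coords_apply, coords_apply]
    exact h7
  rw [h6, negCount_neg_halfSum] at h2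
  exact h2

/-- For `D n` with `n` odd the product of the signs of the positive coroots has degree at most
`n - 1`. -/
theorem prod_signFun_mem_of_D {n : ℕ} (hn : 5 ≤ n) (ho : Odd n)
    (h : HasCartanType b (CartanMatrix.D n)) :
    Module.finrank ℝ M = n ∧ ∏ i ∈ positiveRoots b, signFun P i ∈ signSpan P ^ (n - 1) := by
  obtain ⟨e, he⟩ := h
  have hrank : Module.finrank ℝ M = n := by
    rw [← card_support b, ← Fintype.card_coe, Fintype.card_congr e, Fintype.card_fin]
  refine ⟨hrank, ?_⟩
  obtain ⟨m, rfl⟩ : ∃ m, n = m + 3 := ⟨n - 3, by omega⟩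
  have hm : Even m := by
    rw [Nat.odd_iff] at ho
    rw [Nat.even_iff]
    omega
  have h1 := prod_signFun_positiveRoots_mem b
  rw [hrank] at h1
  refine prod_signFun_mem_of_parity h1 ?_
  have h2 := even_card_positiveRoots_of_D he hm
  rw [Nat.even_iff] at *
  omega

end TypeD

end WittenZeta

end

theorem theorem1p2 {ι M N : Type*} [Fintype ι] [AddCommGroup M] [Module ℝ M]
    [AddCommGroup N] [Module ℝ N] (P : RootPairing ι ℝ M N) [P.IsRootSystem]
    [P.IsCrystallographic] [P.IsReduced] (b : P.Base) :
    -- the Witten zeta function exists as a meromorphic function on the complex plane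
    (∃ Z : ℂ → ℂ, WittenZeta.IsWittenZeta b Z) ∧
    ∀ Z : ℂ → ℂ, WittenZeta.IsWittenZeta b Z →
      -- negative even integers
      (∀ m : ℕ, 0 < m → Even m →
        ((Module.finrank ℝ M : ℤ) : WithTop ℤ) ≤ meromorphicOrderAt Z (-(m : ℂ))) ∧
      -- negative odd integers
      (∀ m : ℕ, Odd m →
        (∀ d : Multiset ℕ, WittenZeta.IsWeylDegrees b d →
          ((Multiset.card (d.filter Odd) : ℤ) : WithTop ℤ) ≤ meromorphicOrderAt Z (-(m : ℂ))) ∧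
        (∀ n : ℕ, WittenZeta.HasCartanType b (CartanMatrix.A n) →
          (((n / 2 : ℕ) : ℤ) : WithTop ℤ) ≤ meromorphicOrderAt Z (-(m : ℂ))) ∧
        (∀ n : ℕ, 5 ≤ n → Odd n → WittenZeta.HasCartanType b (CartanMatrix.D n) →
          1 ≤ meromorphicOrderAt Z (-(m : ℂ))) ∧
        (WittenZeta.HasCartanType b CartanMatrix.E₆ →
          2 ≤ meromorphicOrderAt Z (-(m : ℂ))) ∧
        0 ≤ meromorphicOrderAt Z (-(m : ℂ))) := by
  have hrank : ∀ {n : ℕ} {C : Matrix (Fin n) (Fin n) ℤ}, WittenZeta.HasCartanType b C →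
      Module.finrank ℝ M = n := by
    rintro n C ⟨e, -⟩
    rw [← WittenZeta.card_support b, ← Fintype.card_coe, Fintype.card_congr e, Fintype.card_fin]
  refine ⟨WittenZeta.exists_isWittenZeta b, fun Z hZ => ⟨fun m hm he => ?_, fun m ho =>
    ⟨fun d hd => ?_, fun n hn => ?_, fun n h5 hodd hn => ?_, fun hE => ?_, ?_⟩⟩⟩
  · exact hZ.le_order (WittenZeta.continuesWithOrder_of_even b (Nat.lt_succ_self m) hm he)
  · refine le_trans ?_ (hZ.le_order_of_odd ho (hd.prod_signFun_mem b))
    have h1 := congrArg Multiset.card (Multiset.filter_add_not Even d)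
    rw [Multiset.card_add, hd.1, Multiset.filter_congr (q := Odd) fun x _ =>
      Nat.not_even_iff_odd] at h1
    have h2 : (Multiset.card (d.filter Odd) : ℤ) ≤
        Module.finrank ℝ M - Multiset.card (d.filter Even) := by omega
    exact_mod_cast h2
  · refine le_trans ?_ (hZ.le_order_of_odd ho (WittenZeta.prod_signFun_mem_of_A hn))
    rw [hrank hn]
    have h2 : ((n / 2 : ℕ) : ℤ) ≤ (n : ℤ) - ((n + 1) / 2 : ℕ) := by omega
    exact_mod_cast h2
  · refine le_trans ?_ (hZ.le_order_of_odd ho (WittenZeta.prod_signFun_mem_of_D h5 hodd hn).2)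
    rw [hrank hn]
    have h2 : (1 : ℤ) ≤ (n : ℤ) - (n - 1 : ℕ) := by omega
    exact_mod_cast h2
  · refine le_trans ?_ (hZ.le_order_of_odd ho (WittenZeta.prod_signFun_mem_of_E6 hE))
    rw [hrank hE]
    norm_num
  · refine le_trans ?_ (hZ.le_order_of_odd ho (WittenZeta.prod_signFun_positiveRoots_mem b))
    rw [sub_self]
    rfl
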